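/- **Lemma.** Let $\Omega=(-\pi,\pi)^3$ and let $\langle u,v\rangle=\int_\Omega u\cdot v\,dx$ and $|u|=\langle u,u\rangle^{1/2}$ denote the inner product and norm of $L^2(\Omega)^3$ (real $2\pi$-periodic vector fields). Let $H$ be the closure in $L^2(\Omega)^3$ of the $2\pi$-periodic, divergence-free, real trigonometric polynomial vector fields with zero average, and let $\mathcal P$ be the orthogonal projection of $L^2(\Omega)^3$ onto $H$. For $\alpha,\sigma\in\mathbb R$ and $u=\sum_{k\in\mathbb Z^3\setminus\{0\}}\hat u(k)e^{ik\cdot x}\in H$, put $$A^\alpha e^{\sigma A^{1/2}}u=\sum_{k\neq0}|k|^{2\alpha}e^{\sigma|k|}\hat u(k)e^{ik\cdot x},\qquad |u|_{\alpha,\sigma}=|A^\alpha e^{\sigma A^{1/2}}u|,\qquad G_{\alpha,\sigma}=\{u\in H:\ |u|_{\alpha,\sigma}<\infty\},$$ and $\mathcal D(A^\alpha)=G_{\alpha,0}$, $V=\mathcal D(A^{1/2})$, $A=A^1$ (the Stokes operator). For $u,v\in\mathcal D(A)$ let $B(u,v)=\mathcal P\big((u\cdot\nabla)v\big)$. For $u^0\in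 V$ and $T\in(0,\infty]$, a *regular solution* on $[0,T)$ of the Navier–Stokes equations $$\frac{du}{dt}+Au+B(u,u)=0,\qquad u(0)=u^0, \tag{1}$$ is a function $u$ that is continuous from $[0,T)$ to $V$ (with norm $|A^{1/2}\cdot|$), satisfies $u(0)=u^0$, and for every $t\in(0,T)$ has $u(t)\in\mathcal D(A)$, is differentiable at $t$ as an $H$-valued function, and satisfies the equation at $t$. There is a constant $K\ge1$ such that $$|B(u,v)|_{\alpha,\sigma}\le K^\alpha\,|u|_{\alpha+1/2,\sigma}\,|v|_{\alpha+1/2,\sigma}\qquad\text{for all }\alpha\ge\tfrac12,\ \sigma\ge0,\ u,v\in G_{\alpha+1/2,\sigma}. \tag{2}$$ Let $K\ge 1$ be any constant for which (2) holds and write $C_\alpha=K^\alpha$. Let $\alpha\ge\frac12$, $\delta\in(0,1)$, and let $u^0\in\mathcal D(A^\alpha)$ satisfy $$|A^\alpha u^0|<\frac{\delta}{2C_\alpha}.$$ Then there is a regular solution $u$ of (1) on $[0,\infty)$; it is unique, in the sense that any regular solution of (1) on some $[0,T)$, $T\in(0,\infty]$, coincides with $u$ on $[0,T)$; and $u(t)\in\mathcal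 D(A^\beta)$ for all $\beta>0$ and $t>0$. Moreover, for every $\sigma>0$, $$u(t)\in G_{\alpha,\sigma}\quad\text{and}\quad |u(t)|_{\alpha,\sigma}\le e^{-(1-\delta)t}\,|A^\alpha u^0|\qquad\text{for all } t\ge 4\sigma/\delta.$$ -/

import Mathlib

open MeasureTheory Filter Topology

noncomputable section

namespace NSE

instance factTwoPiPos : Fact ((0 : ℝ) < 2 * Real.pi) := ⟨Real.two_pi_pos⟩

/-- The three-dimensional torus `(ℝ / 2πℤ)³`; functions on it are the `2π`-periodic functions
on `ℝ³`, and its volume (of total mass `(2π)³`) is Lebesgue measure on `(-π, π)³`. -/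
abbrev Torus : Type := Fin 3 → AddCircle (2 * Real.pi)

/-- `L²(Ω)³`: real vector fields on the torus, with `⟨u, v⟩ = ∫ u · v` and `|u| = ⟨u, u⟩^{1/2}`. -/
abbrev L2 : Type := Lp (EuclideanSpace ℝ (Fin 3)) 2 (volume : Measure Torus)

/-- The exponential `x ↦ e^{i k · x}`. -/
def expMode (k : Fin 3 → ℤ) (x : Torus) : ℂ := ∏ j, fourier (k j) (x j)

/-- The Fourier coefficient `(2π)⁻³ ∫ u(x) e^{-i k · x} dx ∈ ℂ³`. -/
def fourierCoef (u : L2) (k : Fin 3 → ℤ) : EuclideanSpace ℂ (Fin 3) :=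
  WithLp.toLp 2 fun i =>
    (((2 * Real.pi) ^ 3 : ℝ) : ℂ)⁻¹ * ∫ x : Torus, ((u x i : ℝ) : ℂ) * expMode (-k) x

/-- The Euclidean length `|k|` of a wave vector. -/
def waveLen (k : Fin 3 → ℤ) : ℝ := Real.sqrt (∑ j, (k j : ℝ) ^ 2)

/-- The real trigonometric polynomial vector fields `∑ c_k e^{i k · x}` that have zero average
(`k ≠ 0`) and are divergence free (`k · c_k = 0`). -/
def trigFields : Set L2 :=
  {u | ∃ (S : Finset (Fin 3 → ℤ)) (c : (Fin 3 → ℤ) → EuclideanSpace ℂ (Fin 3)),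
    (0 : Fin 3 → ℤ) ∉ S ∧ (∀ k ∈ S, ∑ j, (k j : ℂ) * c k j = 0) ∧
    ∀ᵐ x : Torus, ∀ i, ((u x i : ℝ) : ℂ) = ∑ k ∈ S, c k i * expMode k x}

/-- The space `H`, the closure of `trigFields` in `L²(Ω)³`. -/
def H : Submodule ℝ L2 := (Submodule.span ℝ trigFields).topologicalClosure

instance completeH : CompleteSpace H :=
  (Submodule.isClosed_topologicalClosure _).completeSpace_coe

/-- The orthogonal (Leray) projection of `L²(Ω)³` onto `H`. -/
def leray (u : L2) : L2 := H.starProjection u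

/-- `w` is the image of `u` under the Fourier multiplier with symbol `m`, i.e. `w ∈ L²(Ω)³` and
`w = ∑ m(k) û(k) e^{i k · x}`. -/
def IsMultiplierImage (m : (Fin 3 → ℤ) → ℂ) (u w : L2) : Prop :=
  ∀ k, fourierCoef w k = m k • fourierCoef u k

open Classical in
/-- The Fourier multiplier with symbol `m`, as an operator in `L²(Ω)³` (with the value `0` outside
its natural domain). An element of `L²(Ω)³` is determined by its Fourier coefficients. -/
def multiplier (m : (Fin 3 → ℤ) → ℂ) (u : L2) : L2 :=
  if h : ∃ w, IsMultiplierImage m u w then h.choose else 0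

/-- The symbol `|k|^{2α} e^{σ|k|}` of `A^α e^{σ A^{1/2}}`. -/
def gevreySymbol (α σ : ℝ) (k : Fin 3 → ℤ) : ℂ :=
  ((waveLen k ^ (2 * α) * Real.exp (σ * waveLen k) : ℝ) : ℂ)

/-- The Gevrey class `G_{α,σ} = D(A^α e^{σ A^{1/2}}) ⊆ H`. In particular `D(A^α) = G_{α,0}`
and `V = D(A^{1/2}) = G_{1/2,0}`. -/
def gevrey (α σ : ℝ) : Set L2 :=
  {u | u ∈ H ∧ ∃ w, IsMultiplierImage (gevreySymbol α σ) u w}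

/-- The Gevrey norm `|u|_{α,σ} = |A^α e^{σ A^{1/2}} u|`, meaningful for `u ∈ G_{α,σ}`. -/
def gevreyNorm (α σ : ℝ) (u : L2) : ℝ := ‖multiplier (gevreySymbol α σ) u‖

/-- The Stokes operator `A` (on `D(A) = G_{1,0}`); `A = -Δ` has the symbol `|k|²`. -/
def stokes (u : L2) : L2 := multiplier (gevreySymbol 1 0) u

/-- The partial derivative `∂_j`, with symbol `i k_j`. -/
def partialDeriv (j : Fin 3) (u : L2) : L2 := multiplier (fun k => Complex.I * (k j : ℂ)) u

open Classical in
/-- `(u · ∇) v = ∑_j u_j ∂_j v` as an element of `L²(Ω)³` (it is square integrable for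
`u, v ∈ D(A)`; the value is `0` if it is not). -/
def advection (u v : L2) : L2 :=
  if h : MemLp (fun x : Torus => ∑ j, (u x j) • (partialDeriv j v x)) 2 volume
  then h.toLp _ else 0

/-- `B(u, v) = P((u · ∇) v)`. -/
def B (u v : L2) : L2 := leray (advection u v)

/-- `u` is a regular solution on `[0, T)`, `T ∈ (0, ∞]`, of `u' + A u + B(u, u) = 0`, `u(0) = u₀`:
it is continuous from `[0, T)` to `V`, and on `(0, T)` it takes values in `D(A)`, is
differentiable in `H`, and satisfies the equation. -/
structure IsRegularSolution (u₀ : L2) (T : EReal) (u : ℝ → L2) : Prop where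
  initial : u 0 = u₀
  mem_V : ∀ t : ℝ, 0 ≤ t → (t : EReal) < T → u t ∈ gevrey (1 / 2) 0
  continuous_V : ∀ t : ℝ, 0 ≤ t → (t : EReal) < T →
    Tendsto (fun s => gevreyNorm (1 / 2) 0 (u s - u t))
      (𝓝[{s : ℝ | 0 ≤ s ∧ (s : EReal) < T}] t) (𝓝 0)
  mem_domain : ∀ t : ℝ, 0 < t → (t : EReal) < T → u t ∈ gevrey 1 0
  equation : ∀ t : ℝ, 0 < t → (t : EReal) < T →
    HasDerivAt u (-stokes (u t) - B (u t) (u t)) t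

/-- `K` is a constant in the estimate `|B(u,v)|_{α,σ} ≤ K^α |u|_{α+1/2,σ} |v|_{α+1/2,σ}`,
for all `α ≥ 1/2`, `σ ≥ 0` and `u, v ∈ G_{α+1/2,σ}`. -/
def IsBilinearConst (K : ℝ) : Prop :=
  ∀ α σ : ℝ, 1 / 2 ≤ α → 0 ≤ σ → ∀ u ∈ gevrey (α + 1 / 2) σ, ∀ v ∈ gevrey (α + 1 / 2) σ,
    B u v ∈ gevrey α σ ∧
      gevreyNorm α σ (B u v) ≤ K ^ α * gevreyNorm (α + 1 / 2) σ u * gevreyNorm (α + 1 / 2) σ v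

end NSE

end

open MeasureTheory Filter Topology

noncomputable section

namespace NSE

/-! The heart is a differential inequality for a Gevrey norm whose radius grows linearly in time.
Put `c = δ/4` and `y(t) = |u(t)|_{α, ct}`. Pairing the equation with `u` in this norm and using (2)
gives `(y²)' ≤ 2 (c - 1 + K^α y) |u|²_{α+1/2, ct}`. The term `-1` is the dissipation, `c` the price
of the moving radius (one factor `|k|`, at most `|k|²` since `|k| ≥ 1`), and `K^α y` the
nonlinearity. While `K^α y ≤ δ/2`, the bracket is at most `3δ/4 - 1 < -(1 - δ)`, and `|u|_{α+1/2,
ct} ≥ y`. Hence `y` decays like `e^{-(1-δ)t}`, so the smallness perpetuates itself. For `t ≥ 4σ/δ`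
the radius `ct` is at least `σ`, which is the claimed bound.

To make this rigorous, all operators are expressed through Fourier coefficients and the inequality
is proved for Galerkin solutions (`IsGalerkin.gevreyNorm_le`). These exist on any bounded time
interval because, in the unknown `z = A^α u`, the Galerkin field does not point out of a small ball
(`exists_galerkin`).

Convergence uses no compactness. The energy estimate `exists_inner_difference_le` for the difference
of two truncated flows bounds `⟨B(w,u), w⟩` and `⟨B(v,w), w⟩` by lattice sums with total weight
`7/4`. Since `7/4 > 3/2`, the sums converge. Since `7/4 < 2`, a quarter of a power of `|k|` is left
over, and it serves both to absorb the nonlinearity into the dissipation and to make the truncation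
error small. Gronwall then shows that the Galerkin solutions are Cauchy in `L²`, uniformly on
bounded time intervals. The same estimate without truncation error gives uniqueness.

The limit inherits the Gevrey bounds and solves the equation mode by mode. For `t > 0` the radius is
positive, so all coefficients, including those of the time derivative, decay exponentially. This
yields every `D(A^β)`, continuity in `V`, and differentiability in `L²`. At `t = 0` there is no
radius to spend. There continuity follows from `L²` convergence and `|A^α u(t)| ≤ |A^α u⁰|`.

Existence of `K` in (2) is a weighted convolution estimate: the triangle inequality distributes the
weight of `k` over `j` and `k - j`, and the leftover factor `|j|⁻² + |k-j|⁻²` is square summable in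
dimension three, uniformly in `k`. -/

/-! ### The exponentials as a Hilbert basis of scalar `L²` on the torus. -/

/-- The volume `(2π)³` of the torus. -/
def torusVol : ℝ := (2 * Real.pi) ^ 3

lemma torusVol_pos : 0 < torusVol := by unfold torusVol; positivity

/-- The exponential `e^{i k · x}` as a continuous map. -/
def expModeC (k : Fin 3 → ℤ) : C(Torus, ℂ) where
  toFun := expMode k
  continuous_toFun := by unfold expMode; fun_prop

@[simp] lemma expModeC_apply (k : Fin 3 → ℤ) (x : Torus) : expModeC k x = expMode k x := rfl

lemma expMode_neg (k : Fin 3 → ℤ) (x : Torus) :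
    expMode (-k) x = (starRingEnd ℂ) (expMode k x) := by
  simp [expMode, map_prod]

lemma expMode_add (k l : Fin 3 → ℤ) (x : Torus) :
    expMode (k + l) x = expMode k x * expMode l x := by
  simp only [expMode, Pi.add_apply, fourier_add, Finset.prod_mul_distrib]

lemma expMode_zero (x : Torus) : expMode 0 x = 1 := by simp [expMode]

lemma norm_expMode (k : Fin 3 → ℤ) (x : Torus) : ‖expMode k x‖ = 1 := by
  simp only [expMode, norm_prod, fourier_apply, Circle.norm_coe, Finset.prod_const_one]

lemma continuous_expMode (k : Fin 3 → ℤ) : Continuous (expMode k) := (expModeC k).continuous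

lemma integral_fourier (n : ℤ) :
    ∫ x : AddCircle (2 * Real.pi), fourier n x = if n = 0 then ((2 * Real.pi : ℝ) : ℂ) else 0 := by
  have h := (orthonormal_iff_ite.mp (orthonormal_fourier (T := 2 * Real.pi))) 0 n
  rw [ContinuousMap.inner_toLp] at h
  simp only [fourier_zero, map_one, mul_one] at h
  rw [AddCircle.integral_haarAddCircle] at h
  have hpi : ((2 * Real.pi : ℝ) : ℂ) ≠ 0 := by
    exact_mod_cast Real.two_pi_pos.ne'
  rw [Complex.real_smul, Complex.ofReal_inv] at h
  have h2 : ∫ x : AddCircle (2 * Real.pi), fourier n x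
      = ((2 * Real.pi : ℝ) : ℂ) * (if (0 : ℤ) = n then (1 : ℂ) else 0) := by
    rw [← h, mul_inv_cancel_left₀ hpi]
  rw [h2]
  by_cases hn : n = 0
  · simp [hn]
  · simp [hn, Ne.symm hn]

lemma integral_expMode (k : Fin 3 → ℤ) :
    ∫ x : Torus, expMode k x = if k = 0 then (torusVol : ℂ) else 0 := by
  unfold expMode
  rw [MeasureTheory.integral_fintype_prod_volume_eq_prod
    (f := fun j (y : AddCircle (2 * Real.pi)) => fourier (k j) y)]
  simp only [integral_fourier]
  split_ifs with h
  · subst h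
    simp [torusVol]
  · obtain ⟨i, hi⟩ := Function.ne_iff.mp h
    exact Finset.prod_eq_zero (Finset.mem_univ i) (by simpa using hi)

/-- The star subalgebra generated by the exponentials. -/
def expSubalgebra : StarSubalgebra ℂ C(Torus, ℂ) where
  toSubalgebra := Algebra.adjoin ℂ (Set.range expModeC)
  star_mem' := by
    change Algebra.adjoin ℂ (Set.range expModeC) ≤
      star (Algebra.adjoin ℂ (Set.range expModeC))
    refine Algebra.adjoin_le ?_
    rintro _ ⟨n, rfl⟩
    refine Algebra.subset_adjoin ⟨-n, ?_⟩
    ext1 x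
    simp only [expModeC_apply, expMode_neg, starRingEnd_apply, ContinuousMap.star_apply]

lemma expSubalgebra_coe :
    Subalgebra.toSubmodule expSubalgebra.toSubalgebra = Submodule.span ℂ (Set.range expModeC) := by
  apply Algebra.adjoin_eq_span_of_subset
  refine .trans (fun x ↦ Submonoid.closure_induction (fun _ ↦ id) ⟨0, ?_⟩ ?_)
    Submodule.subset_span
  · ext z; simp [expMode_zero]
  · rintro _ _ _ _ ⟨m, rfl⟩ ⟨n, rfl⟩
    refine ⟨m + n, ?_⟩
    ext z
    simp [expMode_add]

lemma expMode_single (x : Torus) (i : Fin 3) : expMode (Pi.single i 1) x = fourier 1 (x i) := by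
  unfold expMode
  rw [Finset.prod_eq_single i]
  · simp
  · intro j _ hj
    simp [Pi.single_eq_of_ne hj]
  · simp

lemma expSubalgebra_separatesPoints : expSubalgebra.SeparatesPoints := by
  intro x y hxy
  rw [Ne, funext_iff, not_forall] at hxy
  obtain ⟨i, hi⟩ := hxy
  refine ⟨_, ⟨expModeC (Pi.single i 1), Algebra.subset_adjoin ⟨Pi.single i 1, rfl⟩, rfl⟩, ?_⟩
  intro h
  have h1 : expMode (Pi.single i 1) x = expMode (Pi.single i 1) y := h
  rw [expMode_single, expMode_single, fourier_one, fourier_one] at h1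
  exact hi (AddCircle.injective_toCircle Real.two_pi_pos.ne' (Circle.ext h1))

/-- Stone–Weierstrass: the exponentials are closed under products and conjugation, and `e^{i x_j}`
alone separates the `j`-th coordinate. -/
lemma span_expModeC_closure :
    (Submodule.span ℂ (Set.range expModeC)).topologicalClosure = ⊤ := by
  rw [← expSubalgebra_coe]
  exact congr_arg (Subalgebra.toSubmodule <| StarSubalgebra.toSubalgebra ·)
    (ContinuousMap.starSubalgebra_topologicalClosure_eq_top_of_separatesPoints _
      expSubalgebra_separatesPoints)

/-- Scalar complex `L²` functions on the torus. -/
abbrev L2c : Type := Lp ℂ 2 (volume : Measure Torus)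

/-- The normalised exponential in `L²`. -/
def expLp (k : Fin 3 → ℤ) : L2c :=
  (((Real.sqrt torusVol)⁻¹ : ℝ) : ℂ) • ContinuousMap.toLp (E := ℂ) 2 volume ℂ (expModeC k)

lemma sqrtVol_ne : ((Real.sqrt torusVol : ℝ) : ℂ) ≠ 0 := by
  exact_mod_cast (Real.sqrt_pos.2 torusVol_pos).ne'

lemma orthonormal_expLp : Orthonormal ℂ expLp := by
  rw [orthonormal_iff_ite]
  intro m n
  unfold expLp
  rw [inner_smul_left, inner_smul_right, ContinuousMap.inner_toLp]
  simp only [expModeC_apply, ← expMode_neg, ← expMode_add]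
  rw [integral_expMode]
  have hs : ((Real.sqrt torusVol : ℝ) : ℂ) * ((Real.sqrt torusVol : ℝ) : ℂ) = (torusVol : ℂ) := by
    rw [← Complex.ofReal_mul, Real.mul_self_sqrt torusVol_pos.le]
  by_cases h : m = n
  · simp only [h, add_neg_cancel, if_true, Complex.conj_ofReal]
    rw [← hs, Complex.ofReal_inv]
    have := sqrtVol_ne
    field_simp
  · rw [if_neg h, if_neg (by rw [add_neg_eq_zero]; exact fun e => h e.symm)]
    simp

lemma span_expLp_closure :
    (Submodule.span ℂ (Set.range expLp)).topologicalClosure = ⊤ := by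
  have h : Submodule.span ℂ (Set.range expLp)
      = Submodule.span ℂ (Set.range fun k => ContinuousMap.toLp (E := ℂ) 2
        (volume : Measure Torus) ℂ (expModeC k)) := by
    apply le_antisymm
    · rw [Submodule.span_le]
      rintro _ ⟨k, rfl⟩
      exact Submodule.smul_mem _ _ (Submodule.subset_span ⟨k, rfl⟩)
    · rw [Submodule.span_le]
      rintro _ ⟨k, rfl⟩
      have : ContinuousMap.toLp (E := ℂ) 2 (volume : Measure Torus) ℂ (expModeC k)
          = ((Real.sqrt torusVol : ℝ) : ℂ) • expLp k := by
        rw [expLp, smul_smul, Complex.ofReal_inv, mul_inv_cancel₀ sqrtVol_ne, one_smul]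
      simp only [SetLike.mem_coe]
      rw [this]
      exact Submodule.smul_mem _ _ (Submodule.subset_span ⟨k, rfl⟩)
  rw [h]
  simpa only [Submodule.map_span, ContinuousLinearMap.coe_coe, ← Set.range_comp,
    Function.comp_def] using
    (ContinuousMap.toLp_denseRange ℂ (volume : Measure Torus) ℂ
      (by simp : (2 : ENNReal) ≠ ⊤)).topologicalClosure_map_submodule span_expModeC_closure

/-- The exponentials as a Hilbert basis. -/
def expBasis : HilbertBasis (Fin 3 → ℤ) ℂ L2c :=
  HilbertBasis.mk orthonormal_expLp span_expLp_closure.ge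

/-- Fourier coefficient of a scalar function. -/
def scalarCoef (f : Torus → ℂ) (k : Fin 3 → ℤ) : ℂ :=
  (torusVol : ℂ)⁻¹ * ∫ x : Torus, f x * expMode (-k) x

lemma expBasis_repr (f : L2c) (k : Fin 3 → ℤ) :
    expBasis.repr f k = ((Real.sqrt torusVol : ℝ) : ℂ) * scalarCoef f k := by
  rw [HilbertBasis.repr_apply_apply, expBasis, HilbertBasis.coe_mk, expLp, inner_smul_left,
    MeasureTheory.L2.inner_def]
  have h : ∫ a, inner ℂ ((ContinuousMap.toLp (E := ℂ) 2 (volume : Measure Torus) ℂ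
      (expModeC k)) a) (f a) = ∫ x : Torus, f x * expMode (-k) x := by
    apply integral_congr_ae
    filter_upwards [ContinuousMap.coeFn_toLp (p := 2) (𝕜 := ℂ) (volume : Measure Torus)
      (expModeC k)] with x hx
    rw [hx, RCLike.inner_apply, expMode_neg, expModeC_apply]
  rw [h, scalarCoef]
  have hs : ((Real.sqrt torusVol : ℝ) : ℂ) * ((Real.sqrt torusVol : ℝ) : ℂ) = (torusVol : ℂ) := by
    rw [← Complex.ofReal_mul, Real.mul_self_sqrt torusVol_pos.le]
  rw [← hs, Complex.conj_ofReal, Complex.ofReal_inv]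
  have := sqrtVol_ne
  field_simp

lemma scalar_parseval (f : L2c) :
    HasSum (fun k => torusVol * ‖scalarCoef f k‖ ^ 2) (‖f‖ ^ 2) := by
  have h := lp.hasSum_norm (p := 2) (by norm_num) (expBasis.repr f)
  rw [LinearIsometryEquiv.norm_map] at h
  simp only [ENNReal.toReal_ofNat, Real.rpow_two, expBasis_repr, norm_mul, Complex.norm_real,
    mul_pow, Real.norm_eq_abs, sq_abs, Real.sq_sqrt torusVol_pos.le] at h
  exact h

lemma scalarCoef_injective {f g : L2c} (h : ∀ k, scalarCoef f k = scalarCoef g k) : f = g := by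
  apply expBasis.repr.injective
  ext k
  rw [expBasis_repr, expBasis_repr, h]

lemma exists_scalarCoef_eq {c : (Fin 3 → ℤ) → ℂ} (hc : Summable fun k => ‖c k‖ ^ 2) :
    ∃ f : L2c, ∀ k, scalarCoef f k = c k := by
  have hm : Memℓp (fun k => ((Real.sqrt torusVol : ℝ) : ℂ) * c k) 2 := by
    apply memℓp_gen
    simp only [ENNReal.toReal_ofNat, Real.rpow_two, norm_mul, mul_pow]
    exact hc.mul_left _
  refine ⟨expBasis.repr.symm ⟨_, hm⟩, fun k => ?_⟩
  have h := expBasis_repr (expBasis.repr.symm ⟨_, hm⟩) k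
  rw [LinearIsometryEquiv.apply_symm_apply] at h
  exact (mul_left_cancel₀ sqrtVol_ne h).symm

/-! ### Fourier coefficients of real vector fields: Parseval, Riesz–Fischer, dominated convergence.
-/

/-- Wave vectors. -/
abbrev K3 : Type := Fin 3 → ℤ

/-- The space `ℂ³` of Fourier coefficients. -/
abbrev C3 : Type := EuclideanSpace ℂ (Fin 3)

/-- The `i`-th component of a vector field, as a complex valued function. -/
def component (i : Fin 3) : L2 →L[ℝ] L2c :=
  (Complex.ofRealCLM ∘L (EuclideanSpace.proj i : EuclideanSpace ℝ (Fin 3) →L[ℝ] ℝ)).compLpL 2 volume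

lemma component_ae (i : Fin 3) (u : L2) : component i u =ᵐ[volume] fun x => ((u x i : ℝ) : ℂ) := by
  have := ContinuousLinearMap.coeFn_compLp
    (Complex.ofRealCLM ∘L (EuclideanSpace.proj i : EuclideanSpace ℝ (Fin 3) →L[ℝ] ℝ)) u
  filter_upwards [this] with x hx
  exact hx

lemma scalarCoef_congr {f g : Torus → ℂ} (h : f =ᵐ[volume] g) (k : K3) :
    scalarCoef f k = scalarCoef g k := by
  unfold scalarCoef
  congr 1
  apply integral_congr_ae
  filter_upwards [h] with x hx
  rw [hx]

lemma fourierCoef_apply (u : L2) (k : K3) (i : Fin 3) :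
    fourierCoef u k i = scalarCoef (component i u) k := by
  rw [scalarCoef_congr (component_ae i u)]
  rfl

lemma norm_sq_eq_sum_component (u : L2) : ‖u‖ ^ 2 = ∑ i, ‖component i u‖ ^ 2 := by
  have h2 : ∀ i, ‖component i u‖ ^ 2 = ∫ x, (u x i) ^ 2 := by
    intro i
    rw [← inner_self_eq_norm_sq (𝕜 := ℂ), L2.inner_def, ← integral_re (L2.integrable_inner _ _)]
    apply integral_congr_ae
    filter_upwards [component_ae i u] with x hx
    rw [hx]
    simp [← Complex.ofReal_mul, sq]
  rw [← real_inner_self_eq_norm_sq, L2.inner_def]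
  simp_rw [h2]
  rw [← integral_finsetSum]
  · apply integral_congr_ae
    filter_upwards with x
    rw [real_inner_self_eq_norm_sq, EuclideanSpace.norm_sq_eq]
    simp
  · intro i _
    have := (L2.integrable_inner (𝕜 := ℂ) (component i u) (component i u)).re
    refine this.congr ?_
    filter_upwards [component_ae i u] with x hx
    rw [hx]
    simp [← Complex.ofReal_mul, sq]

lemma hasSum_norm_sq (u : L2) :
    HasSum (fun k => torusVol * ‖fourierCoef u k‖ ^ 2) (‖u‖ ^ 2) := by
  rw [norm_sq_eq_sum_component]
  have := hasSum_sum (s := Finset.univ) fun i _ => scalar_parseval (component i u)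
  refine this.congr_fun fun k => ?_
  rw [EuclideanSpace.norm_sq_eq, Finset.mul_sum]
  simp_rw [fourierCoef_apply]

lemma summable_norm_sq (u : L2) : Summable fun k => ‖fourierCoef u k‖ ^ 2 :=
  (summable_mul_left_iff torusVol_pos.ne').1 (hasSum_norm_sq u).summable

lemma norm_sq_eq (u : L2) : ‖u‖ ^ 2 = torusVol * ∑' k, ‖fourierCoef u k‖ ^ 2 := by
  rw [← (hasSum_norm_sq u).tsum_eq, tsum_mul_left]

lemma scalarCoef_add (f g : L2c) (k : K3) :
    scalarCoef (f + g : L2c) k = scalarCoef f k + scalarCoef g k := by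
  apply mul_left_cancel₀ sqrtVol_ne
  rw [mul_add, ← expBasis_repr, ← expBasis_repr, ← expBasis_repr, map_add]
  rfl

lemma scalarCoef_smul (r : ℂ) (f : L2c) (k : K3) :
    scalarCoef (r • f : L2c) k = r * scalarCoef f k := by
  apply mul_left_cancel₀ sqrtVol_ne
  rw [mul_left_comm, ← expBasis_repr, ← expBasis_repr, map_smul]
  rfl

lemma torusVol_mul_norm_fourierCoef_sq_le (u : L2) (k : K3) :
    torusVol * ‖fourierCoef u k‖ ^ 2 ≤ ‖u‖ ^ 2 :=
  le_hasSum (hasSum_norm_sq u) k fun j _ => by have := torusVol_pos; positivity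

/-- Allows the volume factor of Parseval's identity to be dropped wherever a crude upper bound
suffices. -/
lemma one_le_torusVol : 1 ≤ torusVol := by
  unfold torusVol
  exact one_le_pow₀ (by linarith [Real.pi_gt_three])

lemma norm_fourierCoef_le (u : L2) (k : K3) : ‖fourierCoef u k‖ ≤ ‖u‖ := by
  have h := torusVol_mul_norm_fourierCoef_sq_le u k
  have h1 := one_le_torusVol
  have : ‖fourierCoef u k‖ ^ 2 ≤ ‖u‖ ^ 2 := by nlinarith [sq_nonneg ‖fourierCoef u k‖]
  exact (sq_le_sq₀ (norm_nonneg _) (norm_nonneg _)).1 this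

/-- The Fourier coefficient as a continuous linear map. -/
def fourierCLM (k : K3) : L2 →L[ℝ] C3 :=
  LinearMap.mkContinuous
    { toFun := fun u => fourierCoef u k
      map_add' := fun u v => by
        ext i
        rw [fourierCoef_apply, map_add, scalarCoef_add, ← fourierCoef_apply, ← fourierCoef_apply]
        rfl
      map_smul' := fun r u => by
        ext i
        have : component i (r • u) = (r : ℂ) • component i u := by
          rw [map_smul]
          rfl
        rw [fourierCoef_apply, this, scalarCoef_smul, ← fourierCoef_apply]
        rfl }
    1 (fun u => by simpa using norm_fourierCoef_le u k)

@[simp] lemma fourierCLM_apply (k : K3) (u : L2) : fourierCLM k u = fourierCoef u k := rfl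

@[simp] lemma fourierCoef_add (u v : L2) (k : K3) :
    fourierCoef (u + v) k = fourierCoef u k + fourierCoef v k := (fourierCLM k).map_add u v

@[simp] lemma fourierCoef_sub (u v : L2) (k : K3) :
    fourierCoef (u - v) k = fourierCoef u k - fourierCoef v k := (fourierCLM k).map_sub u v

@[simp] lemma fourierCoef_neg (u : L2) (k : K3) :
    fourierCoef (-u) k = -fourierCoef u k := (fourierCLM k).map_neg u

@[simp] lemma fourierCoef_smul (r : ℝ) (u : L2) (k : K3) :
    fourierCoef (r • u) k = r • fourierCoef u k := (fourierCLM k).map_smul r u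

lemma fourierCoef_ext {u v : L2} (h : ∀ k, fourierCoef u k = fourierCoef v k) : u = v := by
  have : ‖u - v‖ ^ 2 = 0 := by
    rw [norm_sq_eq]
    simp [h]
  exact sub_eq_zero.1 (norm_eq_zero.1 (pow_eq_zero_iff two_ne_zero |>.1 this))

lemma hasSum_inner (u v : L2) :
    HasSum (fun k => torusVol * inner ℝ (fourierCoef u k) (fourierCoef v k)) (inner ℝ u v) := by
  have h := ((hasSum_norm_sq (u + v)).sub (hasSum_norm_sq (u - v))).div_const 4
  have hp : ∀ {E : Type} [NormedAddCommGroup E] [InnerProductSpace ℝ E] (x y : E),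
      (‖x + y‖ ^ 2 - ‖x - y‖ ^ 2) / 4 = inner ℝ x y := fun x y => by
    rw [norm_add_sq_real, norm_sub_sq_real]
    ring
  rw [hp] at h
  refine h.congr_fun fun k => ?_
  rw [← hp, fourierCoef_add, fourierCoef_sub]
  ring

lemma scalarCoef_conj (f : Torus → ℂ) (k : K3) :
    scalarCoef (fun x => (starRingEnd ℂ) (f x)) k = (starRingEnd ℂ) (scalarCoef f (-k)) := by
  unfold scalarCoef
  rw [map_mul, ← integral_conj, map_inv₀, Complex.conj_ofReal]
  congr 2
  ext x
  rw [map_mul, neg_neg, expMode_neg]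

lemma fourierCoef_neg_index (u : L2) (k : K3) (i : Fin 3) :
    fourierCoef u (-k) i = (starRingEnd ℂ) (fourierCoef u k i) := by
  have h := scalarCoef_conj (fun x => ((u x i : ℝ) : ℂ)) (-k)
  simp only [Complex.conj_ofReal, neg_neg] at h
  exact h

/-- The conjugation symmetry of the Fourier coefficients of a real field. -/
def IsRealSeq (c : K3 → C3) : Prop := ∀ k i, c (-k) i = (starRingEnd ℂ) (c k i)

lemma isRealSeq_fourierCoef (u : L2) : IsRealSeq (fourierCoef u) :=
  fun k i => fourierCoef_neg_index u k i

/-- Riesz–Fischer in each component; the symmetry of `c` is what makes the resulting complex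
functions real. Every operator below is built by prescribing coefficients through this lemma. -/
lemma exists_fourierCoef_eq {c : K3 → C3} (hr : IsRealSeq c) (hc : Summable fun k => ‖c k‖ ^ 2) :
    ∃ u : L2, ∀ k, fourierCoef u k = c k := by
  have hci : ∀ i, Summable fun k => ‖c k i‖ ^ 2 := fun i =>
    Summable.of_nonneg_of_le (fun k => by positivity)
      (fun k => by gcongr; exact PiLp.norm_apply_le (c k) i) hc
  choose f hf using fun i => exists_scalarCoef_eq (hci i)
  -- By `hr`, the component and its conjugate have the same coefficients, hence agree almost
  -- everywhere.
  have hconj : ∀ i, ∀ᵐ x : Torus, (starRingEnd ℂ) (f i x) = f i x := by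
    intro i
    have hm : MemLp (fun x => (starRingEnd ℂ) (f i x)) 2 (volume : Measure Torus) := (Lp.memLp (f i)).star
    have : hm.toLp _ = f i := by
      apply scalarCoef_injective
      intro k
      rw [scalarCoef_congr hm.coeFn_toLp, scalarCoef_conj, hf, hf, hr, Complex.conj_conj]
    filter_upwards [hm.coeFn_toLp, this ▸ hm.coeFn_toLp] with x hx hx'
    rw [← hx']
  have hm : MemLp (fun x => (WithLp.toLp 2 fun i => (f i x).re : EuclideanSpace ℝ (Fin 3))) 2
      (volume : Measure Torus) :=
    MemLp.of_eval_piLp fun i => (Lp.memLp (f i)).re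
  refine ⟨hm.toLp _, fun k => ?_⟩
  ext i
  rw [← hf i k]
  change scalarCoef (fun x => (((hm.toLp _ : L2) x i : ℝ) : ℂ)) k = _
  apply scalarCoef_congr
  filter_upwards [hm.coeFn_toLp, hconj i] with x hx hx'
  rw [hx]
  exact Complex.conj_eq_iff_re.1 hx'

/-- Dominated convergence for Fourier coefficients. -/
lemma tendsto_of_fourierCoef {ι : Type*} {l : Filter ι} {f : ι → L2} {g : L2} {M : K3 → ℝ}
    (hM : Summable fun k => M k ^ 2)
    (hf : ∀ k, Tendsto (fun i => fourierCoef (f i) k) l (𝓝 (fourierCoef g k)))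
    (hb : ∀ᶠ i in l, ∀ k, ‖fourierCoef (f i) k‖ ≤ M k) : Tendsto f l (𝓝 g) := by
  rcases l.eq_or_neBot with rfl | hl
  · exact tendsto_bot
  have hg : ∀ k, ‖fourierCoef g k‖ ≤ M k := fun k =>
    le_of_tendsto (hf k).norm (hb.mono fun i hi => hi k)
  have key : Tendsto (fun i => ∑' k, ‖fourierCoef (f i - g) k‖ ^ 2) l (𝓝 (∑' _ : K3, (0 : ℝ))) := by
    refine tendsto_tsum_of_dominated_convergence (bound := fun k => 4 * M k ^ 2)
      (hM.mul_left 4) (fun k => ?_) (hb.mono fun i hi k => ?_)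
    · have := ((hf k).sub_const (fourierCoef g k)).norm.pow 2
      simpa using this
    · rw [Real.norm_of_nonneg (by positivity), fourierCoef_sub]
      have h1 := (norm_sub_le (fourierCoef (f i) k) (fourierCoef g k)).trans
        (add_le_add (hi k) (hg k))
      calc _ ≤ (M k + M k) ^ 2 := by gcongr
        _ = _ := by ring
  rw [tsum_zero] at key
  have h2 : Tendsto (fun i => ‖f i - g‖ ^ 2) l (𝓝 0) := by
    simp_rw [norm_sq_eq]
    simpa using key.const_mul torusVol
  rw [tendsto_iff_norm_sub_tendsto_zero]
  have h3 := h2.sqrt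
  simpa [Real.sqrt_sq] using h3

/-! ### Wave vectors, the symbol of the Leray projection, and the space `H` in Fourier variables. -/

lemma waveLen_nonneg (k : K3) : 0 ≤ waveLen k := Real.sqrt_nonneg _

@[simp] lemma waveLen_zero : waveLen 0 = 0 := by simp [waveLen]

@[simp] lemma waveLen_neg (k : K3) : waveLen (-k) = waveLen k := by simp [waveLen]

lemma one_le_waveLen {k : K3} (hk : k ≠ 0) : 1 ≤ waveLen k := by
  obtain ⟨i, hi⟩ := Function.ne_iff.mp hk
  rw [waveLen, Real.one_le_sqrt]
  have h1 : (1 : ℝ) ≤ (k i : ℝ) ^ 2 := by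
    have : 1 ≤ (k i) ^ 2 := by
      have : (k i) ^ 2 ≠ 0 := pow_ne_zero 2 hi
      have := sq_nonneg (k i)
      omega
    exact_mod_cast this
  exact h1.trans (Finset.single_le_sum (f := fun j => (k j : ℝ) ^ 2)
    (fun j _ => sq_nonneg _) (Finset.mem_univ i))

lemma waveLen_pos {k : K3} (hk : k ≠ 0) : 0 < waveLen k := one_pos.trans_le (one_le_waveLen hk)

/-- The wave vector as an element of `ℂ³`. -/
def waveVec (k : K3) : C3 := WithLp.toLp 2 fun j => (k j : ℂ)

lemma norm_waveVec (k : K3) : ‖waveVec k‖ = waveLen k := by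
  rw [EuclideanSpace.norm_eq, waveLen]
  simp [waveVec]

lemma inner_waveVec (k : K3) (c : C3) : inner ℂ (waveVec k) c = ∑ j, (k j : ℂ) * c j := by
  rw [PiLp.inner_apply]
  simp [waveVec, mul_comm]

lemma waveLen_add_le (k l : K3) : waveLen (k + l) ≤ waveLen k + waveLen l := by
  rw [← norm_waveVec, ← norm_waveVec, ← norm_waveVec]
  refine le_trans (le_of_eq ?_) (norm_add_le _ _)
  congr 1
  ext j
  simp [waveVec]

lemma abs_apply_le_waveLen (k : K3) (j : Fin 3) : |(k j : ℝ)| ≤ waveLen k := by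
  rw [← norm_waveVec]
  simpa [waveVec] using PiLp.norm_apply_le (waveVec k) j

open Classical in
/-- The symbol of the Leray projection: the orthogonal projection onto the complement of `k`
(and `0` for `k = 0`). -/
def projCoef (k : K3) : C3 →L[ℂ] C3 :=
  if k = 0 then 0 else (Submodule.span ℂ {waveVec k})ᗮ.starProjection

@[simp] lemma projCoef_zero_index : projCoef 0 = 0 := by simp [projCoef]

lemma projCoef_of_ne {k : K3} (hk : k ≠ 0) :
    projCoef k = (Submodule.span ℂ {waveVec k})ᗮ.starProjection := by simp [projCoef, hk]

lemma projCoef_apply {k : K3} (hk : k ≠ 0) (c : C3) :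
    projCoef k c = c - ((∑ j, (k j : ℂ) * c j) / ((waveLen k : ℝ) : ℂ) ^ 2) • waveVec k := by
  rw [projCoef_of_ne hk, Submodule.starProjection_orthogonal_val,
    Submodule.starProjection_singleton, inner_waveVec, norm_waveVec]
  simp

lemma norm_projCoef_le (k : K3) (c : C3) : ‖projCoef k c‖ ≤ ‖c‖ := by
  by_cases hk : k = 0
  · simp [hk]
  · rw [projCoef_of_ne hk]
    exact Submodule.norm_starProjection_apply_le _ _

lemma projCoef_idem (k : K3) (c : C3) : projCoef k (projCoef k c) = projCoef k c := by
  by_cases hk : k = 0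
  · simp [hk]
  · rw [projCoef_of_ne hk]
    exact Submodule.starProjection_eq_self_iff.2 (Submodule.starProjection_apply_mem _ _)

lemma real_inner_C3 (a b : C3) : inner ℝ a b = (inner ℂ a b : ℂ).re := rfl

lemma inner_projCoef (k : K3) (a b : C3) :
    inner ℝ (projCoef k a) b = inner ℝ a (projCoef k b) := by
  rw [real_inner_C3, real_inner_C3]
  congr 1
  by_cases hk : k = 0
  · simp [hk]
  · rw [projCoef_of_ne hk]
    exact Submodule.inner_starProjection_left_eq_right _ _ _

lemma projCoef_eq_self_iff {k : K3} (hk : k ≠ 0) (c : C3) :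
    projCoef k c = c ↔ ∑ j, (k j : ℂ) * c j = 0 := by
  rw [projCoef_of_ne hk, Submodule.starProjection_eq_self_iff, Submodule.mem_orthogonal_singleton_iff_inner_right,
    inner_waveVec]

lemma IsRealSeq.projCoef {c : K3 → C3} (hc : IsRealSeq c) :
    IsRealSeq fun k => projCoef k (c k) := by
  intro k i
  dsimp only
  by_cases hk : k = 0
  · simp [hk]
  · rw [projCoef_apply hk, projCoef_apply (neg_ne_zero.2 hk), waveLen_neg]
    have h1 : ∑ j, (((-k) j : ℤ) : ℂ) * c (-k) j = -(starRingEnd ℂ) (∑ j, (k j : ℂ) * c k j) := by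
      simp [map_sum, hc k]
    have h2 : waveVec (-k) i = -(starRingEnd ℂ) (waveVec k i) := by simp [waveVec]
    simp only [PiLp.sub_apply, PiLp.smul_apply, smul_eq_mul, h1, h2, hc k i, map_sub, map_mul,
      map_div₀, map_pow, Complex.conj_ofReal]
    ring

/-- Hermitian symbols, which map real fields to real fields. -/
def IsHermSymbol (m : K3 → ℂ) : Prop := ∀ k, m (-k) = (starRingEnd ℂ) (m k)

lemma IsHermSymbol.smul {m : K3 → ℂ} (hm : IsHermSymbol m) {c : K3 → C3} (hc : IsRealSeq c) :
    IsRealSeq fun k => m k • c k := by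
  intro k i
  simp [hm k, hc k i]

lemma isHermSymbol_ofReal {m : K3 → ℝ} (hm : ∀ k, m (-k) = m k) :
    IsHermSymbol fun k => (m k : ℂ) := fun k => by simp [hm k]

/-- The closed half-space frequency cut-off `1_{|k| ≤ N}`. -/
def cutoff (N : ℝ) (k : K3) : ℝ := if waveLen k ≤ N then 1 else 0

lemma cutoff_neg (N : ℝ) (k : K3) : cutoff N (-k) = cutoff N k := by simp [cutoff]

lemma finite_waveLen_le (N : ℝ) : {k : K3 | waveLen k ≤ N}.Finite := by
  refine (Set.Finite.pi' (t := fun _ : Fin 3 => Set.Icc (-⌈N⌉) ⌈N⌉)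
    fun _ => Set.finite_Icc _ _).subset fun k hk j => ?_
  have h := abs_le.1 ((abs_apply_le_waveLen k j).trans (le_trans hk (Int.le_ceil N)))
  exact ⟨by exact_mod_cast h.1, by exact_mod_cast h.2⟩

/-- The finite set of nonzero wave vectors of length at most `N`. -/
def ballModes (N : ℝ) : Finset K3 := (finite_waveLen_le N).toFinset.erase 0

lemma mem_ballModes {N : ℝ} {k : K3} : k ∈ ballModes N ↔ k ≠ 0 ∧ waveLen k ≤ N := by
  simp [ballModes]

/-- The condition on the Fourier coefficients that characterises `H`. -/
def IsDivFree (u : L2) : Prop := ∀ k, projCoef k (fourierCoef u k) = fourierCoef u k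

lemma IsDivFree.coef_zero {u : L2} (hu : IsDivFree u) : fourierCoef u 0 = 0 := by
  simpa using (hu 0).symm

lemma scalarCoef_sum_expMode (S : Finset K3) (c : K3 → ℂ) (k : K3) [Decidable (k ∈ S)] :
    scalarCoef (fun x => ∑ l ∈ S, c l * expMode l x) k = if k ∈ S then c k else 0 := by
  have hint : ∀ l, Integrable (fun x : Torus => c l * expMode l x * expMode (-k) x) := fun l =>
    (((continuous_expMode l).const_mul _).mul (continuous_expMode (-k))).integrable_of_hasCompactSupport
      (HasCompactSupport.of_compactSpace _)
  unfold scalarCoef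
  simp_rw [Finset.sum_mul]
  rw [integral_finsetSum _ fun l _ => hint l]
  have h1 : ∀ l, ∫ x : Torus, c l * expMode l x * expMode (-k) x
      = if l = k then c k * torusVol else 0 := by
    intro l
    simp_rw [mul_assoc, ← expMode_add]
    rw [integral_const_mul, integral_expMode]
    by_cases h : l = k
    · simp [h]
    · rw [if_neg h, if_neg (by rwa [add_neg_eq_zero])]
      simp
  simp_rw [h1]
  rw [Finset.sum_ite_eq' S k]
  have : (torusVol : ℂ) ≠ 0 := by exact_mod_cast torusVol_pos.ne'
  split_ifs
  · field_simp
  · simp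

lemma isDivFree_of_mem_trigFields {u : L2} (hu : u ∈ trigFields) : IsDivFree u := by
  classical
  obtain ⟨S, c, h0, hdiv, hae⟩ := hu
  have hc : ∀ k, fourierCoef u k = if k ∈ S then c k else 0 := by
    intro k
    ext i
    have h2 : fourierCoef u k i = scalarCoef (fun x => ∑ l ∈ S, c l i * expMode l x) k :=
      scalarCoef_congr (hae.mono fun x hx => hx i) k
    rw [h2, scalarCoef_sum_expMode S (fun l => c l i) k]
    split_ifs <;> rfl
  intro k
  rw [hc k]
  split_ifs with h
  · have hk : k ≠ 0 := fun e => h0 (e ▸ h)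
    exact (projCoef_eq_self_iff hk _).2 (hdiv k h)
  · simp

/-- For each `k` the condition defines the kernel of a continuous linear map, so it survives spans
and closure. -/
lemma isDivFree_of_mem_H {u : L2} (hu : u ∈ H) : IsDivFree u := by
  intro k
  let D : Submodule ℝ L2 :=
    LinearMap.ker (((projCoef k).restrictScalars ℝ ∘L fourierCLM k - fourierCLM k : L2 →L[ℝ] C3) : L2 →ₗ[ℝ] C3)
  have hD : IsClosed (D : Set L2) :=
    ContinuousLinearMap.isClosed_ker ((projCoef k).restrictScalars ℝ ∘L fourierCLM k - fourierCLM k)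
  have h1 : H ≤ D := by
    refine Submodule.topologicalClosure_minimal _ ?_ hD
    rw [Submodule.span_le]
    intro v hv
    simpa [D, sub_eq_zero] using isDivFree_of_mem_trigFields hv k
  simpa [D, sub_eq_zero] using h1 hu

lemma exists_truncation (u : L2) (N : ℝ) :
    ∃ w : L2, ∀ k, fourierCoef w k = (cutoff N k : ℂ) • fourierCoef u k := by
  refine exists_fourierCoef_eq
    ((isHermSymbol_ofReal (cutoff_neg N)).smul (isRealSeq_fourierCoef u)) ?_
  refine Summable.of_nonneg_of_le (fun k => by positivity) (fun k => ?_) (summable_norm_sq u)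
  unfold cutoff
  split_ifs <;> simp

/-- The frequency truncations of `u` are themselves in `trigFields`, and they converge to `u` in
`L²`. -/
lemma mem_H_of_isDivFree {u : L2} (hu : IsDivFree u) : u ∈ H := by
  choose w hw using fun N : ℕ => exists_truncation u N
  have hlim : Tendsto w atTop (𝓝 u) := by
    refine tendsto_of_fourierCoef (summable_norm_sq u) (fun k => ?_)
      (Eventually.of_forall fun N k => ?_)
    · apply tendsto_const_nhds.congr'
      filter_upwards [eventually_ge_atTop ⌈waveLen k⌉₊] with N hN
      rw [hw, cutoff, if_pos (Nat.ceil_le.1 hN)]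
      simp
    · rw [hw]
      unfold cutoff
      split_ifs <;> simp
  refine (Submodule.isClosed_topologicalClosure _).mem_of_tendsto hlim
    (Eventually.of_forall fun N => ?_)
  refine Submodule.le_topologicalClosure _ (Submodule.subset_span ?_)
  refine ⟨ballModes N, fourierCoef u, by simp [ballModes], fun k hk => ?_, ?_⟩
  · exact (projCoef_eq_self_iff (mem_ballModes.1 hk).1 _).1 (hu k)
  · rw [ae_all_iff]
    intro i
    have hcont : Continuous fun x : Torus => ∑ k ∈ ballModes N, fourierCoef u k i * expMode k x :=
      continuous_finsetSum _ fun k _ => (continuous_expMode k).const_mul _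
    have hm : MemLp (fun x : Torus => ∑ k ∈ ballModes N, fourierCoef u k i * expMode k x) 2 volume :=
      hcont.memLp_of_hasCompactSupport (HasCompactSupport.of_compactSpace _)
    have h : component i (w N) = hm.toLp _ := by
      classical
      apply scalarCoef_injective
      intro k
      rw [scalarCoef_congr hm.coeFn_toLp, ← fourierCoef_apply, hw,
        scalarCoef_sum_expMode _ (fun l => fourierCoef u l i)]
      by_cases hk : k = 0
      · subst hk
        simp [hu.coef_zero]
      · simp only [cutoff, mem_ballModes, hk, ne_eq, not_false_eq_true, true_and]
        split_ifs <;> simp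
    filter_upwards [component_ae i (w N), hm.coeFn_toLp] with x hx hx'
    rw [← hx, h, hx']

/-- The field `w` with the projected coefficients lies in `H`. Each `projCoef k` is self-adjoint and
idempotent, so `u - w` is orthogonal to `H`. These two properties characterise the orthogonal
projection. -/
lemma fourierCoef_leray (u : L2) (k : K3) :
    fourierCoef (leray u) k = projCoef k (fourierCoef u k) := by
  obtain ⟨w, hw⟩ := exists_fourierCoef_eq (isRealSeq_fourierCoef u).projCoef
    (Summable.of_nonneg_of_le (fun k => by positivity)
      (fun k => by gcongr; exact norm_projCoef_le k _) (summable_norm_sq u))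
  have h : leray u = w := by
    refine Submodule.eq_starProjection_of_mem_of_inner_eq_zero
      (mem_H_of_isDivFree fun k => by rw [hw, projCoef_idem]) fun v hv => ?_
    have h1 := hasSum_inner (u - w) v
    have h2 : ∀ k, torusVol * inner ℝ (fourierCoef (u - w) k) (fourierCoef v k) = 0 := by
      intro k
      rw [fourierCoef_sub, hw, ← isDivFree_of_mem_H hv k, ← inner_projCoef, map_sub, projCoef_idem]
      simp
    simp_rw [h2] at h1
    exact h1.unique hasSum_zero
  rw [h, hw]

lemma leray_mem (u : L2) : leray u ∈ H := Submodule.starProjection_apply_mem _ _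

/-! ### Fourier multipliers and Gevrey norms as weighted sums. -/

lemma exists_isMultiplierImage {m : K3 → ℂ} (hm : IsHermSymbol m) {u : L2}
    (h : Summable fun k => ‖m k‖ ^ 2 * ‖fourierCoef u k‖ ^ 2) : ∃ w, IsMultiplierImage m u w :=
  exists_fourierCoef_eq (hm.smul (isRealSeq_fourierCoef u)) (by simpa [norm_smul, mul_pow] using h)

lemma summable_of_isMultiplierImage {m : K3 → ℂ} {u w : L2} (h : IsMultiplierImage m u w) :
    Summable fun k => ‖m k‖ ^ 2 * ‖fourierCoef u k‖ ^ 2 := by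
  have := summable_norm_sq w
  simpa [h _, norm_smul, mul_pow] using this

lemma fourierCoef_multiplier {m : K3 → ℂ} {u : L2} (h : ∃ w, IsMultiplierImage m u w) (k : K3) :
    fourierCoef (multiplier m u) k = m k • fourierCoef u k := by
  rw [multiplier, dif_pos h]
  exact h.choose_spec k

/-- The weight `|k|^{2α} e^{σ|k|}`. -/
def gw (α σ : ℝ) (k : K3) : ℝ := waveLen k ^ (2 * α) * Real.exp (σ * waveLen k)

lemma gw_nonneg (α σ : ℝ) (k : K3) : 0 ≤ gw α σ k :=
  mul_nonneg (Real.rpow_nonneg (waveLen_nonneg k) _) (Real.exp_pos _).le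

lemma gevreySymbol_eq (α σ : ℝ) (k : K3) : gevreySymbol α σ k = (gw α σ k : ℂ) := rfl

lemma isHermSymbol_gevreySymbol (α σ : ℝ) : IsHermSymbol (gevreySymbol α σ) :=
  isHermSymbol_ofReal fun k => by simp

lemma mem_gevrey_iff {α σ : ℝ} {u : L2} :
    u ∈ gevrey α σ ↔ u ∈ H ∧ Summable fun k => gw α σ k ^ 2 * ‖fourierCoef u k‖ ^ 2 := by
  have h : (∃ w, IsMultiplierImage (gevreySymbol α σ) u w) ↔
      Summable fun k => gw α σ k ^ 2 * ‖fourierCoef u k‖ ^ 2 := by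
    constructor
    · rintro ⟨w, hw⟩
      simpa [gevreySymbol_eq] using summable_of_isMultiplierImage hw
    · intro hs
      exact exists_isMultiplierImage (isHermSymbol_gevreySymbol α σ)
        (by simpa [gevreySymbol_eq] using hs)
  exact and_congr_right fun _ => h

lemma fourierCoef_gevrey {α σ : ℝ} {u : L2} (hu : u ∈ gevrey α σ) (k : K3) :
    fourierCoef (multiplier (gevreySymbol α σ) u) k = (gw α σ k : ℂ) • fourierCoef u k :=
  fourierCoef_multiplier hu.2 k

lemma gevreyNorm_sq {α σ : ℝ} {u : L2} (hu : u ∈ gevrey α σ) :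
    gevreyNorm α σ u ^ 2 = torusVol * ∑' k, gw α σ k ^ 2 * ‖fourierCoef u k‖ ^ 2 := by
  rw [gevreyNorm, norm_sq_eq]
  simp [fourierCoef_gevrey hu, norm_smul, mul_pow]

lemma gevreyNorm_nonneg (α σ : ℝ) (u : L2) : 0 ≤ gevreyNorm α σ u := norm_nonneg _

/-! ### Lattice sums, Fourier coefficients of products, and the coefficients of `B(u, v)`. -/

/-- The wave vectors embed injectively and isometrically into the lattice spanned by the standard
basis, whose rank `3` sets the threshold. -/
lemma summable_waveLen_rpow {r : ℝ} (hr : r < -3) : Summable fun k : K3 => waveLen k ^ r := by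
  let b := (EuclideanSpace.basisFun (Fin 3) ℝ).toBasis
  let L := Submodule.span ℤ (Set.range b)
  have hfr : Module.finrank ℤ L = 3 := by
    rw [ZLattice.rank ℝ L]
    simp
  have h := ZLattice.summable_norm_rpow L r (by rw [hfr]; exact_mod_cast hr)
  let φ : K3 → L := fun k => ⟨∑ j, k j • b j,
    Submodule.sum_mem _ fun j _ => Submodule.smul_mem _ _ (Submodule.subset_span ⟨j, rfl⟩)⟩
  have hφ : ∀ k, ((φ k : L) : EuclideanSpace ℝ (Fin 3)) = WithLp.toLp 2 fun j => (k j : ℝ) := by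
    intro k
    ext i
    simp [φ, b, Fin.sum_univ_three]
    fin_cases i <;> simp
  have hinj : Function.Injective φ := by
    intro k l hkl
    have := congrArg (fun x : L => (x : EuclideanSpace ℝ (Fin 3))) hkl
    simp only [hφ] at this
    funext i
    have h2 := congrFun (congrArg WithLp.ofLp this) i
    simpa using h2
  refine (h.comp_injective hinj).congr fun k => ?_
  have : ‖φ k‖ = waveLen k := by
    change ‖((φ k : L) : EuclideanSpace ℝ (Fin 3))‖ = _
    rw [hφ, EuclideanSpace.norm_eq, waveLen]
    simp
  change ‖φ k‖ ^ r = _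
  rw [this]

lemma summable_mul_of_summable_sq {ι : Type*} {f g : ι → ℝ} (hf : Summable fun i => f i ^ 2)
    (hg : Summable fun i => g i ^ 2) : Summable fun i => f i * g i :=
  Summable.of_norm_bounded (hf.add hg) fun i => by
    rw [Real.norm_eq_abs, abs_le]
    constructor <;> nlinarith [sq_nonneg (f i + g i), sq_nonneg (f i - g i), sq_nonneg (f i), sq_nonneg (g i)]

/-- Termwise integration is legitimate because `∑ |a_j| ∫ |g|` is finite. Multiplication by `e^{i j
· x}` shifts the index of the coefficient by `j`. With `g = 1` this reconstructs a function from its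
series, and for general `g` it gives the convolution formula. -/
lemma hasSum_integral_series_mul {a : K3 → ℂ} (ha : Summable fun j => ‖a j‖) {g : Torus → ℂ}
    (hg : Integrable g) (k : K3) :
    HasSum (fun j => a j * scalarCoef g (k - j))
      (scalarCoef (fun x => (∑' j, a j * expMode j x) * g x) k) := by
  have hmeas : ∀ j, AEStronglyMeasurable (fun x : Torus => a j * expMode j x * expMode (-k) x) volume :=
    fun j => (((continuous_expMode j).const_mul _).mul (continuous_expMode (-k))).aestronglyMeasurable
  have hint : ∀ j, Integrable (fun x : Torus => a j * expMode j x * expMode (-k) x * g x) := fun j =>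
    hg.bdd_mul (hmeas j) (c := ‖a j‖)
      (Eventually.of_forall fun x => by simp [norm_expMode])
  have h := hasSum_integral_of_summable_integral_norm hint (by
    have : ∀ j, ∫ x : Torus, ‖a j * expMode j x * expMode (-k) x * g x‖
        = ‖a j‖ * ∫ x : Torus, ‖g x‖ := by
      intro j
      rw [← integral_const_mul]
      congr 1
      ext x
      simp [norm_expMode]
    simp_rw [this]
    exact ha.mul_right _)
  have h2 := h.mul_left ((torusVol : ℂ)⁻¹)
  have e : (torusVol : ℂ)⁻¹ * ∫ x : Torus, ∑' j, a j * expMode j x * expMode (-k) x * g x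
      = scalarCoef (fun x => (∑' j, a j * expMode j x) * g x) k := by
    unfold scalarCoef
    congr 2
    ext x
    dsimp only
    rw [← tsum_mul_right, ← tsum_mul_right]
    congr 1
    ext j
    ring
  rw [e] at h2
  refine h2.congr_fun fun j => ?_
  unfold scalarCoef
  rw [mul_left_comm, ← integral_const_mul]
  congr 2
  ext x
  rw [neg_sub, sub_eq_add_neg, expMode_add]
  ring

lemma continuous_expSeries {a : K3 → ℂ} (ha : Summable fun j => ‖a j‖) :
    Continuous fun x : Torus => ∑' j, a j * expMode j x :=
  continuous_tsum (fun j => (continuous_expMode j).const_mul _) ha fun j x => by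
    simp [norm_expMode]

lemma norm_expSeries_le {a : K3 → ℂ} (ha : Summable fun j => ‖a j‖) (x : Torus) :
    ‖∑' j, a j * expMode j x‖ ≤ ∑' j, ‖a j‖ := by
  refine tsum_of_norm_bounded ha.hasSum fun j => ?_
  simp [norm_expMode]

lemma scalarCoef_one (k : K3) : scalarCoef (fun _ => 1) k = if k = 0 then 1 else 0 := by
  have : (torusVol : ℂ) ≠ 0 := by exact_mod_cast torusVol_pos.ne'
  unfold scalarCoef
  simp only [one_mul]
  rw [integral_expMode]
  simp only [neg_eq_zero]
  split_ifs
  · field_simp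
  · simp

lemma ae_eq_expSeries {f : L2c} (ha : Summable fun j => ‖scalarCoef f j‖) :
    f =ᵐ[volume] fun x => ∑' j, scalarCoef f j * expMode j x := by
  have hm : MemLp (fun x : Torus => ∑' j, scalarCoef f j * expMode j x) 2 volume :=
    MemLp.of_bound (continuous_expSeries ha).aestronglyMeasurable _
      (Eventually.of_forall fun x => norm_expSeries_le ha x)
  have h : f = hm.toLp _ := by
    apply scalarCoef_injective
    intro k
    rw [scalarCoef_congr hm.coeFn_toLp]
    have h1 := hasSum_integral_series_mul ha (integrable_const (1 : ℂ)) k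
    simp only [scalarCoef_one, mul_one] at h1
    have h2 := hasSum_single (f := fun j => scalarCoef f j * (if k - j = 0 then 1 else 0)) k
      (fun j hj => by simp [sub_eq_zero, Ne.symm hj])
    simpa using h2.unique h1
  filter_upwards [hm.coeFn_toLp] with x hx
  rw [← hx, ← h]

/-- Summable coefficients make `f` essentially bounded, so only one factor needs regularity. -/
lemma memLp_mul_of_summable {f g : L2c} (ha : Summable fun j => ‖scalarCoef f j‖) :
    MemLp (fun x => f x * g x) 2 (volume : Measure Torus) := by
  refine MemLp.of_le_mul (c := ∑' j, ‖scalarCoef f j‖) (Lp.memLp g)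
    ((Lp.aestronglyMeasurable f).mul (Lp.aestronglyMeasurable g)) ?_
  filter_upwards [ae_eq_expSeries ha] with x hx
  rw [norm_mul]
  gcongr
  rw [hx]
  exact norm_expSeries_le ha x

/-- Fourier coefficients of a product. -/
lemma hasSum_scalarCoef_mul {f g : L2c} (ha : Summable fun j => ‖scalarCoef f j‖) (k : K3) :
    HasSum (fun j => scalarCoef f j * scalarCoef g (k - j)) (scalarCoef (fun x => f x * g x) k) := by
  have h := hasSum_integral_series_mul ha ((Lp.memLp g).integrable (by norm_num)) k
  rwa [← scalarCoef_congr (f := fun x => f x * g x)] at h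
  filter_upwards [ae_eq_expSeries ha] with x hx
  rw [hx]

/-- The Fourier coefficients of `(u · ∇) v` in terms of those of `u` and `v`. -/
def convTerm (a c : K3 → C3) (k j : K3) : C3 :=
  (Complex.I * ∑ l, a j l * (((k - j) l : ℤ) : ℂ)) • c (k - j)

/-- The Fourier coefficients of `B(u, v)` in terms of those of `u` and `v`. -/
def bCoef (a c : K3 → C3) (k : K3) : C3 := projCoef k (∑' j, convTerm a c k j)

lemma norm_sum_mul_le (a : C3) (m : K3) : ‖∑ l, a l * ((m l : ℤ) : ℂ)‖ ≤ ‖a‖ * waveLen m := by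
  have h := norm_inner_le_norm (𝕜 := ℂ) (waveVec m) a
  rw [inner_waveVec, norm_waveVec] at h
  rw [mul_comm]
  refine le_trans (le_of_eq ?_) h
  congr 1
  exact Finset.sum_congr rfl fun _ _ => mul_comm _ _

lemma norm_convTerm_le (a c : K3 → C3) (k j : K3) :
    ‖convTerm a c k j‖ ≤ ‖a j‖ * (waveLen (k - j) * ‖c (k - j)‖) := by
  rw [convTerm, norm_smul, norm_mul, Complex.norm_I, one_mul, ← mul_assoc]
  gcongr
  exact norm_sum_mul_le _ _

lemma summable_comp_sub {f : K3 → ℝ} (hf : Summable f) (k : K3) : Summable fun j => f (k - j) :=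
  (Equiv.subLeft k).summable_iff.2 hf

lemma summable_convTerm {a c : K3 → C3} (ha : Summable fun k => ‖a k‖ ^ 2)
    (hc : Summable fun k => waveLen k ^ 2 * ‖c k‖ ^ 2) (k : K3) : Summable (convTerm a c k) := by
  refine Summable.of_norm_bounded (summable_mul_of_summable_sq ha
    (summable_comp_sub (f := fun k => (waveLen k * ‖c k‖) ^ 2) (by simpa [mul_pow] using hc) k))
    (norm_convTerm_le a c k)

lemma gw_half (k : K3) : gw (1 / 2) 0 k = waveLen k := by simp [gw]

lemma gw_one (k : K3) : gw 1 0 k = waveLen k ^ 2 := by simp [gw]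

lemma coef_zero_of_mem_H {u : L2} (hu : u ∈ H) : fourierCoef u 0 = 0 :=
  (isDivFree_of_mem_H hu).coef_zero

/-- Comparison of Gevrey classes. -/
lemma gevrey_mono {α σ α' σ' C : ℝ} (h : ∀ k : K3, k ≠ 0 → gw α' σ' k ≤ C * gw α σ k) {u : L2}
    (hu : u ∈ gevrey α σ) : u ∈ gevrey α' σ' ∧ gevreyNorm α' σ' u ≤ |C| * gevreyNorm α σ u := by
  rw [mem_gevrey_iff] at hu
  have hle : ∀ k, gw α' σ' k ^ 2 * ‖fourierCoef u k‖ ^ 2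
      ≤ |C| ^ 2 * (gw α σ k ^ 2 * ‖fourierCoef u k‖ ^ 2) := by
    intro k
    -- The weights are compared only for `k ≠ 0`; at `k = 0` the zero average of fields in `H` is
    -- used instead.
    by_cases hk : k = 0
    · simp [hk, coef_zero_of_mem_H hu.1]
    · have h1 := (h k hk).trans (mul_le_mul_of_nonneg_right (le_abs_self C) (gw_nonneg α σ k))
      calc gw α' σ' k ^ 2 * ‖fourierCoef u k‖ ^ 2
          ≤ (|C| * gw α σ k) ^ 2 * ‖fourierCoef u k‖ ^ 2 :=
            mul_le_mul_of_nonneg_right (pow_le_pow_left₀ (gw_nonneg α' σ' k) h1 2) (sq_nonneg _)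
        _ = _ := by ring
  have hs := Summable.of_nonneg_of_le (fun k => by positivity) hle (hu.2.mul_left _)
  have hmem : u ∈ gevrey α' σ' := mem_gevrey_iff.2 ⟨hu.1, hs⟩
  refine ⟨hmem, ?_⟩
  rw [← sq_le_sq₀ (gevreyNorm_nonneg _ _ _) (by have := gevreyNorm_nonneg α σ u; positivity),
    mul_pow, gevreyNorm_sq hmem, gevreyNorm_sq (mem_gevrey_iff.2 hu), mul_left_comm (|C| ^ 2),
    ← tsum_mul_left (a := |C| ^ 2)]
  exact mul_le_mul_of_nonneg_left (Summable.tsum_le_tsum hle hs (hu.2.mul_left _)) torusVol_pos.le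

lemma gw_le_gw {α α' σ σ' : ℝ} (hα : α' ≤ α) (hσ : σ' ≤ σ) {k : K3} (hk : k ≠ 0) :
    gw α' σ' k ≤ 1 * gw α σ k := by
  have h1 := one_le_waveLen hk
  rw [one_mul, gw, gw]
  gcongr

lemma gevrey_anti {α σ α' σ' : ℝ} (hα : α' ≤ α) (hσ : σ' ≤ σ) {u : L2}
    (hu : u ∈ gevrey α σ) : u ∈ gevrey α' σ' ∧ gevreyNorm α' σ' u ≤ gevreyNorm α σ u := by
  simpa using gevrey_mono (C := 1) (fun k hk => gw_le_gw hα hσ hk) hu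

lemma summable_of_mem_V {u : L2} (hu : u ∈ gevrey (1 / 2) 0) :
    Summable fun k => waveLen k ^ 2 * ‖fourierCoef u k‖ ^ 2 := by
  simpa only [gw_half] using (mem_gevrey_iff.1 hu).2

/-- Cauchy–Schwarz against `|k|⁻²`, which is square summable because `4 > 3`. This is how fields in
`D(A)` become bounded functions. -/
lemma summable_norm_of_mem_domain {u : L2} (hu : u ∈ gevrey 1 0) :
    Summable fun k => ‖fourierCoef u k‖ := by
  have h1 : Summable fun k : K3 => (waveLen k ^ (-2 : ℝ)) ^ 2 := by
    refine (summable_waveLen_rpow (r := -4) (by norm_num)).congr fun k => ?_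
    rw [← Real.rpow_natCast, ← Real.rpow_mul (waveLen_nonneg k)]
    norm_num
  have h2 : Summable fun k => (waveLen k ^ 2 * ‖fourierCoef u k‖) ^ 2 := by
    simpa [gw_one, mul_pow] using (mem_gevrey_iff.1 hu).2
  refine (summable_mul_of_summable_sq h1 h2).congr fun k => ?_
  by_cases hk : k = 0
  · simp [hk, coef_zero_of_mem_H hu.1]
  · have := waveLen_pos hk
    rw [← mul_assoc, Real.rpow_neg this.le, Real.rpow_two, inv_mul_cancel₀ (by positivity), one_mul]

lemma fourierCoef_partialDeriv {v : L2} (hv : v ∈ gevrey (1 / 2) 0) (l : Fin 3) (k : K3) :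
    fourierCoef (partialDeriv l v) k = (Complex.I * (k l : ℂ)) • fourierCoef v k := by
  refine fourierCoef_multiplier (exists_isMultiplierImage (fun k => ?_) ?_) k
  · simp
  · refine Summable.of_nonneg_of_le (fun k => by positivity) (fun k => ?_) (summable_of_mem_V hv)
    gcongr
    simpa using abs_apply_le_waveLen k l

/-- Bounded times square integrable. `partialDeriv j v` is an element of `L²` for every `v`, by its
default value outside the natural domain, so only `u` has to be regular. -/
lemma memLp_advection {u v : L2} (hu : u ∈ gevrey 1 0) :
    MemLp (fun x : Torus => ∑ j, (u x j) • (partialDeriv j v x)) 2 volume := by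
  refine memLp_finsetSum _ fun j _ => MemLp.of_eval_piLp fun i => ?_
  have ha : Summable fun k => ‖scalarCoef (component j u) k‖ := by
    refine Summable.of_nonneg_of_le (fun k => norm_nonneg _) (fun k => ?_)
      (summable_norm_of_mem_domain hu)
    rw [← fourierCoef_apply]
    exact PiLp.norm_apply_le _ _
  have h := (memLp_mul_of_summable (g := component i (partialDeriv j v)) ha).re
  refine h.ae_eq ?_
  filter_upwards [component_ae j u, component_ae i (partialDeriv j v)] with x h1 h2
  rw [h1, h2, ← Complex.ofReal_mul]
  simp

lemma fourierCoef_advection {u v : L2} (hu : u ∈ gevrey 1 0) (hv : v ∈ gevrey (1 / 2) 0) (k : K3) :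
    fourierCoef (advection u v) k = ∑' j, convTerm (fourierCoef u) (fourierCoef v) k j := by
  have hm := memLp_advection (v := v) hu
  have hadv : advection u v = hm.toLp _ := dif_pos hm
  have hs := summable_convTerm (summable_norm_sq u) (summable_of_mem_V hv) k
  ext i
  have e1 : (∑' j, convTerm (fourierCoef u) (fourierCoef v) k j) i
      = ∑' j, convTerm (fourierCoef u) (fourierCoef v) k j i :=
    (EuclideanSpace.proj (𝕜 := ℂ) i : C3 →L[ℂ] ℂ).map_tsum hs
  rw [e1]
  have ha : ∀ l, Summable fun k => ‖scalarCoef (component l u) k‖ := fun l => by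
    refine Summable.of_nonneg_of_le (fun k => norm_nonneg _) (fun k => ?_)
      (summable_norm_of_mem_domain hu)
    rw [← fourierCoef_apply]
    exact PiLp.norm_apply_le _ _
  have h2 := hasSum_sum (s := Finset.univ) fun l (_ : l ∈ Finset.univ) =>
    hasSum_scalarCoef_mul (g := component i (partialDeriv l v)) (ha l) k
  have h3 : fourierCoef (advection u v) k i
      = ∑ l, scalarCoef (fun x => component l u x * component i (partialDeriv l v) x) k := by
    rw [hadv]
    change scalarCoef (fun x => (((hm.toLp _ : L2) x i : ℝ) : ℂ)) k = _
    have hcongr : (fun x => (((hm.toLp _ : L2) x i : ℝ) : ℂ)) =ᵐ[volume]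
        fun x => ∑ l, component l u x * component i (partialDeriv l v) x := by
      filter_upwards [hm.coeFn_toLp, ae_all_iff.2 fun l => component_ae l u,
        ae_all_iff.2 fun l => component_ae i (partialDeriv l v)] with x h1 h2 h3
      rw [h1]
      simp_rw [h2, h3]
      simp
    rw [scalarCoef_congr hcongr]
    unfold scalarCoef
    simp_rw [Finset.sum_mul]
    rw [integral_finsetSum, Finset.mul_sum]
    intro l _
    exact ((memLp_mul_of_summable (ha l)).integrable (by norm_num)).mul_bdd (c := 1)
      (continuous_expMode (-k)).aestronglyMeasurable
      (Eventually.of_forall fun x => (norm_expMode _ _).le)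
  rw [h3, ← h2.tsum_eq]
  congr 1
  ext j
  simp only [convTerm, PiLp.smul_apply, smul_eq_mul, ← fourierCoef_apply,
    fourierCoef_partialDeriv hv, Finset.mul_sum, Finset.sum_mul]
  exact Finset.sum_congr rfl fun l _ => by ring

/-- The Fourier coefficients of `B(u, v)`. -/
lemma fourierCoef_B {u v : L2} (hu : u ∈ gevrey 1 0) (hv : v ∈ gevrey (1 / 2) 0) (k : K3) :
    fourierCoef (B u v) k = bCoef (fourierCoef u) (fourierCoef v) k := by
  rw [B, fourierCoef_leray, fourierCoef_advection hu hv, bCoef]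

/-! ### Existence of a constant in the bilinear estimate (2). -/

/-- Hölder for the counting measure. Working in `ENNReal` allows double sums to be rearranged
freely; `summable_and_tsum_le_of_ennreal` returns to real sums once a finite bound is available. -/
lemma tsum_mul_sq_le {ι : Type*} (f g : ι → ENNReal) :
    (∑' i, f i * g i) ^ 2 ≤ (∑' i, f i ^ 2) * ∑' i, g i ^ 2 := by
  let _ : MeasurableSpace ι := ⊤
  have h := ENNReal.lintegral_mul_le_Lp_mul_Lq (Measure.count : Measure ι) Real.HolderConjugate.two_two
    (f := f) (g := g) measurable_from_top.aemeasurable measurable_from_top.aemeasurable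
  rw [lintegral_count, lintegral_count, lintegral_count] at h
  simp only [Pi.mul_apply, ENNReal.rpow_two] at h
  calc (∑' i, f i * g i) ^ 2
      ≤ ((∑' i, f i ^ 2) ^ (1 / 2 : ℝ) * (∑' i, g i ^ 2) ^ (1 / 2 : ℝ)) ^ 2 := by gcongr
    _ = _ := by
      rw [← ENNReal.mul_rpow_of_nonneg _ _ (by norm_num), ← ENNReal.rpow_natCast, ← ENNReal.rpow_mul]
      norm_num

lemma summable_and_tsum_le_of_ennreal {ι : Type*} {f : ι → ℝ} (hf : ∀ i, 0 ≤ f i) {C : ℝ}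
    (hC : 0 ≤ C) (h : ∑' i, ENNReal.ofReal (f i) ≤ ENNReal.ofReal C) :
    Summable f ∧ ∑' i, f i ≤ C := by
  have hs : ∀ s : Finset ι, ∑ i ∈ s, f i ≤ C := fun s => by
    rw [← ENNReal.ofReal_le_ofReal_iff hC, ENNReal.ofReal_sum_of_nonneg fun i _ => hf i]
    exact (ENNReal.sum_le_tsum s).trans h
  have hsum := summable_of_sum_le hf hs
  exact ⟨hsum, hsum.tsum_le_of_sum_le hs⟩

lemma tsum_comp_sub (f : K3 → ENNReal) (k : K3) : ∑' j, f (k - j) = ∑' j, f j :=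
  (Equiv.subLeft k).tsum_eq f

lemma tsum_comp_sub_right (f : K3 → ENNReal) (j : K3) : ∑' k, f (k - j) = ∑' k, f k :=
  (Equiv.subRight j).tsum_eq f

/-- A weighted convolution estimate. -/
lemma tsum_conv_sq_le {w : K3 → K3 → ENNReal} {C : ENNReal} (hw : ∀ k, ∑' j, w k j ^ 2 ≤ C)
    (a b : K3 → ENNReal) :
    ∑' k, (∑' j, w k j * (a j * b (k - j))) ^ 2 ≤ C * ((∑' j, a j ^ 2) * ∑' j, b j ^ 2) := by
  calc ∑' k, (∑' j, w k j * (a j * b (k - j))) ^ 2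
      ≤ ∑' k, C * ∑' j, (a j * b (k - j)) ^ 2 := by
        refine ENNReal.tsum_le_tsum fun k => (tsum_mul_sq_le _ _).trans ?_
        gcongr
        exact hw k
    _ = C * ∑' j, ∑' k, a j ^ 2 * b (k - j) ^ 2 := by
        rw [ENNReal.tsum_mul_left, ENNReal.tsum_comm]
        simp_rw [mul_pow]
    _ = C * ((∑' j, a j ^ 2) * ∑' j, b j ^ 2) := by
        simp_rw [ENNReal.tsum_mul_left, tsum_comp_sub_right (fun k => b k ^ 2), ENNReal.tsum_mul_right]

/-- `|k|⁻²`, with value `0` at `k = 0`. -/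
def invSq (k : K3) : ℝ := (waveLen k ^ 2)⁻¹

lemma invSq_nonneg (k : K3) : 0 ≤ invSq k := inv_nonneg.2 (sq_nonneg _)

lemma summable_invSq_sq : Summable fun k => invSq k ^ 2 := by
  refine (summable_waveLen_rpow (r := -4) (by norm_num)).congr fun k => ?_
  rw [Real.rpow_neg (waveLen_nonneg k), invSq, inv_pow, ← pow_mul]
  norm_cast

/-- The exponential weight is submultiplicative by the triangle inequality, and `|j+m| ≤ 2 max(|j|,
|m|)` gives the factor `4^α`. With `x = |j|`, `y = |m|`, what remains is `(x^{2α} + y^{2α}) y`.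
Divided by `x^{2α+1} y^{2α+1}` it is at most `x⁻¹y⁻¹ + x⁻²`, because `α ≥ 1/2` gives `x ≤ x^{2α}`
and `y ≤ y^{2α}`. -/
lemma gw_add_mul_le {α σ : ℝ} (hα : 1 / 2 ≤ α) (hσ : 0 ≤ σ) {j m : K3} (hj : j ≠ 0) (hm : m ≠ 0) :
    gw α σ (j + m) * waveLen m ≤
      2 * 4 ^ α * (invSq j + invSq m) * (gw (α + 1 / 2) σ j * gw (α + 1 / 2) σ m) := by
  set x := waveLen j with hx
  set y := waveLen m with hy
  have hx1 : 1 ≤ x := one_le_waveLen hj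
  have hy1 : 1 ≤ y := one_le_waveLen hm
  have hx0 : 0 < x := by linarith
  have hy0 : 0 < y := by linarith
  have h1 : waveLen (j + m) ^ (2 * α) ≤ 4 ^ α * (x ^ (2 * α) + y ^ (2 * α)) := by
    have h4 : (4 : ℝ) ^ α = 2 ^ (2 * α) := by
      rw [Real.rpow_mul (by norm_num)]
      norm_num
    have hmax : waveLen (j + m) ≤ 2 * max x y := by
      have := waveLen_add_le j m
      have := le_max_left x y
      have := le_max_right x y
      linarith
    calc waveLen (j + m) ^ (2 * α) ≤ (2 * max x y) ^ (2 * α) :=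
          Real.rpow_le_rpow (waveLen_nonneg _) hmax (by linarith)
      _ = 4 ^ α * max x y ^ (2 * α) := by
          rw [Real.mul_rpow (by norm_num) (by positivity), h4]
      _ ≤ _ := by
          gcongr
          rcases max_choice x y with h | h <;> rw [h]
          · linarith [Real.rpow_nonneg hy0.le (2 * α)]
          · linarith [Real.rpow_nonneg hx0.le (2 * α)]
  have h2 : Real.exp (σ * waveLen (j + m)) ≤ Real.exp (σ * x) * Real.exp (σ * y) := by
    rw [← Real.exp_add, ← mul_add]
    gcongr
    exact waveLen_add_le j m
  have h3 : (x ^ (2 * α) + y ^ (2 * α)) * y ≤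
      2 * ((x ^ 2)⁻¹ + (y ^ 2)⁻¹) * (x ^ (2 * (α + 1 / 2)) * y ^ (2 * (α + 1 / 2))) := by
    have ex : x ^ (2 * (α + 1 / 2)) = x ^ (2 * α) * x := by
      rw [mul_add, Real.rpow_add hx0]
      norm_num
    have ey : y ^ (2 * (α + 1 / 2)) = y ^ (2 * α) * y := by
      rw [mul_add, Real.rpow_add hy0]
      norm_num
    have gx : x ≤ x ^ (2 * α) := by
      conv_lhs => rw [← Real.rpow_one x]
      exact Real.rpow_le_rpow_of_exponent_le hx1 (by linarith)
    have gy : y ≤ y ^ (2 * α) := by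
      conv_lhs => rw [← Real.rpow_one y]
      exact Real.rpow_le_rpow_of_exponent_le hy1 (by linarith)
    rw [ex, ey]
    set p := x ^ (2 * α)
    set q := y ^ (2 * α)
    have hp : 0 < p := by linarith
    have hq : 0 < q := by linarith
    have e : 2 * ((x ^ 2)⁻¹ + (y ^ 2)⁻¹) * (p * x * (q * y))
        = 2 * (y * x⁻¹ + x * y⁻¹) * (p * q) := by
      field_simp
    rw [e]
    have i1 : p * y ≤ (y * x⁻¹ + x * y⁻¹) * (p * q) := by
      have : y ≤ (y * x⁻¹ + x * y⁻¹) * q := by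
        have h5 : 1 ≤ y * x⁻¹ + x * y⁻¹ := by
          rw [← div_eq_mul_inv, ← div_eq_mul_inv, div_add_div _ _ hx0.ne' hy0.ne', le_div_iff₀ (by positivity)]
          nlinarith [sq_nonneg (x - y)]
        nlinarith
      nlinarith
    have i2 : q * y ≤ (y * x⁻¹ + x * y⁻¹) * (p * q) := by
      have : y ≤ (y * x⁻¹ + x * y⁻¹) * p := by
        have h6 : y = y * x⁻¹ * x := by field_simp
        have h7 : 0 ≤ x * y⁻¹ := by positivity
        have h8 : 0 ≤ y * x⁻¹ := by positivity
        calc y = y * x⁻¹ * x := h6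
          _ ≤ y * x⁻¹ * p := by gcongr
          _ ≤ _ := by nlinarith
      nlinarith
    nlinarith
  unfold gw
  rw [← hx, ← hy]
  have h4 : (0 : ℝ) < 4 ^ α := by positivity
  calc waveLen (j + m) ^ (2 * α) * Real.exp (σ * waveLen (j + m)) * y
      ≤ (4 ^ α * (x ^ (2 * α) + y ^ (2 * α))) * (Real.exp (σ * x) * Real.exp (σ * y)) * y := by
        gcongr
    _ = 4 ^ α * (Real.exp (σ * x) * Real.exp (σ * y)) * ((x ^ (2 * α) + y ^ (2 * α)) * y) := by ring
    _ ≤ 4 ^ α * (Real.exp (σ * x) * Real.exp (σ * y)) * (2 * ((x ^ 2)⁻¹ + (y ^ 2)⁻¹) *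
          (x ^ (2 * (α + 1 / 2)) * y ^ (2 * (α + 1 / 2)))) := by
        gcongr
    _ = _ := by
        unfold invSq
        rw [← hx, ← hy]
        ring

lemma enorm_bCoef_le (a c : K3 → C3) (k : K3) :
    ‖bCoef a c k‖ₑ ≤ ∑' j, ENNReal.ofReal (‖a j‖ * (waveLen (k - j) * ‖c (k - j)‖)) := by
  have h1 : ‖bCoef a c k‖ₑ ≤ ‖∑' j, convTerm a c k j‖ₑ := by
    rw [← ofReal_norm, ← ofReal_norm]
    exact ENNReal.ofReal_le_ofReal (norm_projCoef_le k _)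
  refine h1.trans (enorm_tsum_le_tsum_enorm.trans (ENNReal.tsum_le_tsum fun j => ?_))
  rw [← ofReal_norm]
  exact ENNReal.ofReal_le_ofReal (norm_convTerm_le a c k j)

lemma B_mem_H (u v : L2) : B u v ∈ H := leray_mem _

theorem exists_isBilinearConst : ∃ K : ℝ, 1 ≤ K ∧ IsBilinearConst K := by
  set S := ∑' k, invSq k ^ 2
  have hS : 0 ≤ S := tsum_nonneg fun k => sq_nonneg _
  have hT := torusVol_pos
  set c₀ := max 1 (Real.sqrt (16 * S / torusVol)) with hc₀
  have hc1 : 1 ≤ c₀ := le_max_left _ _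
  -- The factor `4` supplies `4^α`. The square of `c₀ ≥ 1` lets `K^α` absorb a constant independent
  -- of `α`: as `2α ≥ 1`, `c₀ ≤ (c₀²)^α`. One factor of the volume is divided out because the
  -- squared estimate carries it once on the left and twice on the right.
  refine ⟨4 * c₀ ^ 2, by nlinarith, fun α σ hα hσ u hu v hv => ?_⟩
  have hu1 : u ∈ gevrey 1 0 := (gevrey_anti (by linarith) hσ hu).1
  have hv1 : v ∈ gevrey (1 / 2) 0 := (gevrey_anti (by linarith) hσ hv).1
  have hus := (mem_gevrey_iff.1 hu).2
  have hvs := (mem_gevrey_iff.1 hv).2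
  set U := ∑' k, gw (α + 1 / 2) σ k ^ 2 * ‖fourierCoef u k‖ ^ 2 with hU
  set V := ∑' k, gw (α + 1 / 2) σ k ^ 2 * ‖fourierCoef v k‖ ^ 2 with hV
  have hU0 : 0 ≤ U := tsum_nonneg fun k => by positivity
  have hV0 : 0 ≤ V := tsum_nonneg fun k => by positivity
  let w : K3 → K3 → ENNReal := fun k j => ENNReal.ofReal (2 * 4 ^ α * (invSq j + invSq (k - j)))
  have h4 : (0 : ℝ) < 4 ^ α := by positivity
  -- The bound is uniform in `k` because `∑_j |k-j|⁻⁴` does not depend on `k`.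
  have hw : ∀ k, ∑' j, w k j ^ 2 ≤ ENNReal.ofReal (16 * (4 ^ α) ^ 2 * S) := by
    intro k
    have hs2 := summable_comp_sub summable_invSq_sq k
    have e2 : ∑' j, invSq (k - j) ^ 2 = S := (Equiv.subLeft k).tsum_eq fun j => invSq j ^ 2
    have hs3 := (summable_invSq_sq.add hs2).mul_left (8 * ((4 : ℝ) ^ α) ^ 2)
    have e3 : ∑' j, (8 * ((4 : ℝ) ^ α) ^ 2 * (invSq j ^ 2 + invSq (k - j) ^ 2))
        = 16 * (4 ^ α) ^ 2 * S := by
      rw [tsum_mul_left, summable_invSq_sq.tsum_add hs2, e2]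
      ring
    rw [← e3, ENNReal.ofReal_tsum_of_nonneg (fun j => by positivity) hs3]
    refine ENNReal.tsum_le_tsum fun j => ?_
    have := invSq_nonneg j
    have := invSq_nonneg (k - j)
    rw [← ENNReal.ofReal_pow (by positivity)]
    refine ENNReal.ofReal_le_ofReal ?_
    have : (invSq j + invSq (k - j)) ^ 2 ≤ 2 * (invSq j ^ 2 + invSq (k - j) ^ 2) := by
      nlinarith [sq_nonneg (invSq j - invSq (k - j))]
    calc _ = 4 * ((4 : ℝ) ^ α) ^ 2 * (invSq j + invSq (k - j)) ^ 2 := by ring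
      _ ≤ 4 * ((4 : ℝ) ^ α) ^ 2 * (2 * (invSq j ^ 2 + invSq (k - j) ^ 2)) := by gcongr
      _ = _ := by ring
  let a : L2 → K3 → ENNReal := fun u j => ENNReal.ofReal (gw (α + 1 / 2) σ j * ‖fourierCoef u j‖)
  have ha : ∀ u : L2, (Summable fun k => gw (α + 1 / 2) σ k ^ 2 * ‖fourierCoef u k‖ ^ 2) →
      ∑' j, a u j ^ 2 = ENNReal.ofReal (∑' k, gw (α + 1 / 2) σ k ^ 2 * ‖fourierCoef u k‖ ^ 2) := by
    intro u hs
    rw [ENNReal.ofReal_tsum_of_nonneg (fun j => by positivity) hs]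
    congr 1
    ext j
    have := gw_nonneg (α + 1 / 2) σ j
    rw [← ENNReal.ofReal_pow (by positivity), mul_pow]
  have hB : ∀ k, ENNReal.ofReal (gw α σ k ^ 2 * ‖fourierCoef (B u v) k‖ ^ 2)
      ≤ (∑' j, w k j * (a u j * a v (k - j))) ^ 2 := by
    intro k
    have g0 := gw_nonneg α σ k
    rw [← mul_pow, ENNReal.ofReal_pow (by positivity), ENNReal.ofReal_mul g0, ofReal_norm,
      fourierCoef_B hu1 hv1]
    gcongr
    refine (mul_le_mul_right (enorm_bCoef_le _ _ k) _).trans ?_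
    rw [← ENNReal.tsum_mul_left]
    refine ENNReal.tsum_le_tsum fun j => ?_
    have g1 := gw_nonneg (α + 1 / 2) σ j
    have g2 := gw_nonneg (α + 1 / 2) σ (k - j)
    have := invSq_nonneg j
    have := invSq_nonneg (k - j)
    rw [← ENNReal.ofReal_mul g0, ← ENNReal.ofReal_mul (by positivity), ← ENNReal.ofReal_mul (by positivity)]
    refine ENNReal.ofReal_le_ofReal ?_
    by_cases hj : j = 0
    · simp [hj, coef_zero_of_mem_H hu.1]
    by_cases hm : k - j = 0
    · simp [hm, coef_zero_of_mem_H hv.1]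
    have h := gw_add_mul_le hα hσ hj hm
    rw [add_sub_cancel] at h
    calc gw α σ k * (‖fourierCoef u j‖ * (waveLen (k - j) * ‖fourierCoef v (k - j)‖))
        = (gw α σ k * waveLen (k - j)) * (‖fourierCoef u j‖ * ‖fourierCoef v (k - j)‖) := by ring
      _ ≤ (2 * 4 ^ α * (invSq j + invSq (k - j)) *
          (gw (α + 1 / 2) σ j * gw (α + 1 / 2) σ (k - j))) *
          (‖fourierCoef u j‖ * ‖fourierCoef v (k - j)‖) := by gcongr
      _ = _ := by ring
  have hfin := (ENNReal.tsum_le_tsum hB).trans (tsum_conv_sq_le hw (a u) (a v))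
  rw [ha u hus, ha v hvs, ← ENNReal.ofReal_mul hU0, ← ENNReal.ofReal_mul (by positivity)] at hfin
  obtain ⟨hs, hle⟩ := summable_and_tsum_le_of_ennreal (fun k => by positivity) (by positivity) hfin
  have hmem : B u v ∈ gevrey α σ := mem_gevrey_iff.2 ⟨B_mem_H u v, hs⟩
  refine ⟨hmem, ?_⟩
  have n1 := gevreyNorm_nonneg (α + 1 / 2) σ u
  have n2 := gevreyNorm_nonneg (α + 1 / 2) σ v
  have hKpos : (0 : ℝ) ≤ (4 * c₀ ^ 2) ^ α := by positivity
  rw [← sq_le_sq₀ (gevreyNorm_nonneg _ _ _) (by positivity), mul_pow, mul_pow, gevreyNorm_sq hmem,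
    gevreyNorm_sq hu, gevreyNorm_sq hv, ← hU, ← hV]
  have hK : 16 * S / torusVol * (4 ^ α) ^ 2 ≤ ((4 * c₀ ^ 2) ^ α) ^ 2 := by
    rw [Real.mul_rpow (by norm_num) (by positivity), mul_pow, mul_comm]
    gcongr
    have e1 : 16 * S / torusVol ≤ c₀ ^ 2 := by
      rw [← Real.sq_sqrt (show 0 ≤ 16 * S / torusVol by positivity)]
      gcongr
      exact le_max_right _ _
    refine e1.trans ?_
    gcongr
    rw [← Real.rpow_natCast c₀ 2, ← Real.rpow_mul (by positivity)]
    conv_lhs => rw [← Real.rpow_one c₀]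
    exact Real.rpow_le_rpow_of_exponent_le hc1 (by push_cast; linarith)
  calc torusVol * ∑' k, gw α σ k ^ 2 * ‖fourierCoef (B u v) k‖ ^ 2
      ≤ torusVol * (16 * (4 ^ α) ^ 2 * S * (U * V)) := by gcongr
    _ = 16 * S / torusVol * (4 ^ α) ^ 2 * (torusVol * U) * (torusVol * V) := by
        field_simp
    _ ≤ _ := by gcongr

/-! ### Trilinear estimates and the energy inequality for differences. -/

/-- The `ℓ²` norm of an extended nonnegative sequence. -/
def elTwo {ι : Type*} (f : ι → ENNReal) : ENNReal := (∑' i, f i ^ 2) ^ (1 / 2 : ℝ)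

lemma tsum_mul_le_elTwo {ι : Type*} (f g : ι → ENNReal) :
    ∑' i, f i * g i ≤ elTwo f * elTwo g := by
  rw [elTwo, elTwo, ← ENNReal.mul_rpow_of_nonneg _ _ (by norm_num), one_div,
    ENNReal.le_rpow_inv_iff (by norm_num), ENNReal.rpow_two]
  exact tsum_mul_sq_le f g

lemma elTwo_comp_sub (f : K3 → ENNReal) (k : K3) : elTwo (fun j => f (k - j)) = elTwo f := by
  rw [elTwo, elTwo, tsum_comp_sub (fun j => f j ^ 2)]

lemma elTwo_comp_sub_right (f : K3 → ENNReal) (j : K3) : elTwo (fun k => f (k - j)) = elTwo f := by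
  rw [elTwo, elTwo, tsum_comp_sub_right (fun j => f j ^ 2)]

lemma elTwo_ofReal {ι : Type*} {f : ι → ℝ} (hf : ∀ i, 0 ≤ f i) (hs : Summable fun i => f i ^ 2) :
    elTwo (fun i => ENNReal.ofReal (f i)) = ENNReal.ofReal (Real.sqrt (∑' i, f i ^ 2)) := by
  rw [elTwo, Real.sqrt_eq_rpow,
    ← ENNReal.ofReal_rpow_of_nonneg (tsum_nonneg fun i => sq_nonneg _) (by norm_num),
    ENNReal.ofReal_tsum_of_nonneg (fun i => sq_nonneg _) hs]
  simp_rw [ENNReal.ofReal_pow (hf _)]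

/-- Negative powers grow when the larger length is replaced by the smaller one. At a zero wave
vector the left side vanishes, since `0 ^ (-p) = 0` for `p ≠ 0`. -/
lemma waveLen_rpow_mul_le {p q : ℝ} (hp : 0 < p) (hq : 0 < q) (j k : K3) :
    waveLen j ^ (-p) * waveLen k ^ (-q) ≤ waveLen j ^ (-(p + q)) + waveLen k ^ (-(p + q)) := by
  have n1 := Real.rpow_nonneg (waveLen_nonneg j) (-(p + q))
  have n2 := Real.rpow_nonneg (waveLen_nonneg k) (-(p + q))
  by_cases hj : j = 0
  · rw [hj, waveLen_zero, Real.zero_rpow (by linarith), zero_mul]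
    rw [hj] at n1
    simpa using add_nonneg n1 n2
  by_cases hk : k = 0
  · rw [hk, waveLen_zero, Real.zero_rpow (x := -q) (by linarith), mul_zero]
    rw [hk] at n2
    simpa using add_nonneg n1 n2
  have hx := waveLen_pos hj
  have hy := waveLen_pos hk
  rcases le_total (waveLen j) (waveLen k) with h | h
  · calc waveLen j ^ (-p) * waveLen k ^ (-q) ≤ waveLen j ^ (-p) * waveLen j ^ (-q) := by
          gcongr ?_ * ?_
          exact Real.rpow_le_rpow_of_nonpos hx h (by linarith)
      _ = waveLen j ^ (-(p + q)) := by rw [← Real.rpow_add hx]; ring_nf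
      _ ≤ _ := by linarith
  · calc waveLen j ^ (-p) * waveLen k ^ (-q) ≤ waveLen k ^ (-p) * waveLen k ^ (-q) := by
          gcongr ?_ * ?_
          exact Real.rpow_le_rpow_of_nonpos hy h (by linarith)
      _ = waveLen k ^ (-(p + q)) := by rw [← Real.rpow_add hy]; ring_nf
      _ ≤ _ := by linarith

/-- `∑ |k|^{-7/2}`. -/
def latticeSum : ℝ := ∑' k : K3, (waveLen k ^ (-(7 / 4) : ℝ)) ^ 2

lemma elTwo_waveLen :
    elTwo (fun k : K3 => ENNReal.ofReal (waveLen k ^ (-(7 / 4) : ℝ)))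
      = ENNReal.ofReal (Real.sqrt latticeSum) := by
  refine elTwo_ofReal (fun k => Real.rpow_nonneg (waveLen_nonneg k) _) ?_
  refine (summable_waveLen_rpow (r := -(7 / 2)) (by norm_num)).congr fun k => ?_
  rw [← Real.rpow_natCast, ← Real.rpow_mul (waveLen_nonneg k)]
  norm_num

/-- The weight splits into a function of `j` alone and one of `k` alone, each in `ℓ²` since `7/2 >
3`. It is grouped with `f` or with `h` accordingly, and Cauchy–Schwarz is applied twice. Any
exponent above `3/2` would sum; `7/4` stays below `2`, which leaves a quarter of a power to spare.
-/
lemma tsum_trilinear_le {p q : ℝ} (hp : 0 < p) (hq : 0 < q) (hpq : p + q = 7 / 4)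
    (f g h : K3 → ENNReal) :
    ∑' k, ∑' j, ENNReal.ofReal (waveLen j ^ (-p) * waveLen k ^ (-q)) * (f j * g (k - j) * h k) ≤
      2 * ENNReal.ofReal (Real.sqrt latticeSum) * (elTwo f * elTwo g * elTwo h) := by
  let r : K3 → ENNReal := fun k => ENNReal.ofReal (waveLen k ^ (-(7 / 4) : ℝ))
  have hr : elTwo r = ENNReal.ofReal (Real.sqrt latticeSum) := elTwo_waveLen
  have h1 : ∑' k, ∑' j, r j * (f j * g (k - j) * h k)
      ≤ elTwo r * (elTwo f * elTwo g * elTwo h) := by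
    rw [ENNReal.tsum_comm]
    calc ∑' j, ∑' k, r j * (f j * g (k - j) * h k)
        = ∑' j, r j * f j * ∑' k, g (k - j) * h k := by
          congr 1; ext j
          rw [← ENNReal.tsum_mul_left]
          congr 1; ext k; ring
      _ ≤ ∑' j, r j * f j * (elTwo g * elTwo h) := by
          refine ENNReal.tsum_le_tsum fun j => ?_
          gcongr
          refine (tsum_mul_le_elTwo (fun k => g (k - j)) h).trans ?_
          rw [elTwo_comp_sub_right]
      _ ≤ (elTwo r * elTwo f) * (elTwo g * elTwo h) := by
          rw [ENNReal.tsum_mul_right]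
          gcongr
          exact tsum_mul_le_elTwo r f
      _ = _ := by ring
  have h2 : ∑' k, ∑' j, r k * (f j * g (k - j) * h k)
      ≤ elTwo r * (elTwo f * elTwo g * elTwo h) := by
    calc ∑' k, ∑' j, r k * (f j * g (k - j) * h k)
        = ∑' k, r k * h k * ∑' j, f j * g (k - j) := by
          congr 1; ext k
          rw [← ENNReal.tsum_mul_left]
          congr 1; ext j; ring
      _ ≤ ∑' k, r k * h k * (elTwo f * elTwo g) := by
          refine ENNReal.tsum_le_tsum fun k => ?_
          gcongr
          refine (tsum_mul_le_elTwo f (fun j => g (k - j))).trans ?_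
          rw [elTwo_comp_sub]
      _ ≤ (elTwo r * elTwo h) * (elTwo f * elTwo g) := by
          rw [ENNReal.tsum_mul_right]
          gcongr
          exact tsum_mul_le_elTwo r h
      _ = _ := by ring
  calc _ ≤ ∑' k, ∑' j, (r j * (f j * g (k - j) * h k) + r k * (f j * g (k - j) * h k)) := by
        refine ENNReal.tsum_le_tsum fun k => ENNReal.tsum_le_tsum fun j => ?_
        rw [← add_mul]
        gcongr
        rw [← ENNReal.ofReal_add (Real.rpow_nonneg (waveLen_nonneg j) _)
          (Real.rpow_nonneg (waveLen_nonneg k) _), ← hpq]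
        exact ENNReal.ofReal_le_ofReal (waveLen_rpow_mul_le hp hq j k)
    _ = ∑' k, ∑' j, r j * (f j * g (k - j) * h k) + ∑' k, ∑' j, r k * (f j * g (k - j) * h k) := by
        simp_rw [ENNReal.tsum_add]
    _ ≤ _ := by
        rw [← hr, mul_assoc, two_mul]
        exact add_le_add h1 h2

lemma waveLen_rpow_neg_mul {p : ℝ} {k : K3} {x : ℝ} (hx : k = 0 → x = 0) :
    waveLen k ^ (-p) * (waveLen k ^ p * x) = x := by
  by_cases hk : k = 0
  · simp [hx hk]
  · rw [← mul_assoc, ← Real.rpow_add (waveLen_pos hk)]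
    simp

/-- The trilinear estimate for `∑ |B(a,c)^(k)| |z(k)|`. -/
lemma tsum_bCoef_mul_le {p q : ℝ} (hp : 0 < p) (hq : 0 < q) (hpq : p + q = 7 / 4)
    {a c z : K3 → C3} (ha0 : a 0 = 0) (hz0 : z 0 = 0)
    (ha : Summable fun k => (waveLen k ^ p * ‖a k‖) ^ 2)
    (hc : Summable fun k => (waveLen k * ‖c k‖) ^ 2)
    (hz : Summable fun k => (waveLen k ^ q * ‖z k‖) ^ 2) :
    (Summable fun k => ‖bCoef a c k‖ * ‖z k‖) ∧
    ∑' k, ‖bCoef a c k‖ * ‖z k‖ ≤ 2 * Real.sqrt latticeSum *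
      (Real.sqrt (∑' k, (waveLen k ^ p * ‖a k‖) ^ 2) * Real.sqrt (∑' k, (waveLen k * ‖c k‖) ^ 2) *
        Real.sqrt (∑' k, (waveLen k ^ q * ‖z k‖) ^ 2)) := by
  have hn : ∀ (s : ℝ) (k : K3) (x : C3), 0 ≤ waveLen k ^ s * ‖x‖ := fun s k x =>
    mul_nonneg (Real.rpow_nonneg (waveLen_nonneg k) _) (norm_nonneg _)
  have hn1 : ∀ (k : K3) (x : C3), 0 ≤ waveLen k * ‖x‖ := fun k x =>
    mul_nonneg (waveLen_nonneg k) (norm_nonneg _)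
  apply summable_and_tsum_le_of_ennreal (fun k => by positivity) (by positivity)
  have key := tsum_trilinear_le hp hq hpq (fun k => ENNReal.ofReal (waveLen k ^ p * ‖a k‖))
    (fun k => ENNReal.ofReal (waveLen k * ‖c k‖)) (fun k => ENNReal.ofReal (waveLen k ^ q * ‖z k‖))
  rw [elTwo_ofReal (fun k => hn p k _) ha, elTwo_ofReal (fun k => hn1 k _) hc,
    elTwo_ofReal (fun k => hn q k _) hz] at key
  rw [ENNReal.ofReal_mul (by positivity), ENNReal.ofReal_mul (by norm_num),
    ENNReal.ofReal_mul (by positivity), ENNReal.ofReal_mul (by positivity)]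
  simp only [ENNReal.ofReal_ofNat]
  refine le_trans (ENNReal.tsum_le_tsum fun k => ?_) key
  rw [ENNReal.ofReal_mul (norm_nonneg _), ofReal_norm]
  refine (mul_le_mul_left (enorm_bCoef_le a c k) _).trans ?_
  rw [← ENNReal.tsum_mul_right]
  refine ENNReal.tsum_le_tsum fun j => ?_
  rw [← ENNReal.ofReal_mul (mul_nonneg (norm_nonneg _) (hn1 _ _)), ← ENNReal.ofReal_mul (hn p j _),
    ← ENNReal.ofReal_mul (mul_nonneg (hn p j _) (hn1 _ _)),
    ← ENNReal.ofReal_mul (mul_nonneg (Real.rpow_nonneg (waveLen_nonneg _) _)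
      (Real.rpow_nonneg (waveLen_nonneg _) _))]
  refine ENNReal.ofReal_le_ofReal (le_of_eq ?_)
  have e1 := waveLen_rpow_neg_mul (p := p) (k := j) (x := ‖a j‖) (fun h => by simp [h, ha0])
  have e2 := waveLen_rpow_neg_mul (p := q) (k := k) (x := ‖z k‖) (fun h => by simp [h, hz0])
  conv_lhs => rw [← e1, ← e2]
  ring

lemma tsum_mul_le_sqrt {ι : Type*} {f g : ι → ℝ} (hf : ∀ i, 0 ≤ f i) (hg : ∀ i, 0 ≤ g i)
    (hfs : Summable fun i => f i ^ 2) (hgs : Summable fun i => g i ^ 2) :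
    ∑' i, f i * g i ≤ Real.sqrt (∑' i, f i ^ 2) * Real.sqrt (∑' i, g i ^ 2) := by
  refine (summable_and_tsum_le_of_ennreal (fun i => mul_nonneg (hf i) (hg i)) (by positivity) ?_).2
  rw [ENNReal.ofReal_mul (by positivity), ← elTwo_ofReal hf hfs, ← elTwo_ofReal hg hgs]
  simp_rw [ENNReal.ofReal_mul (hf _)]
  exact tsum_mul_le_elTwo _ _

/-- Bilinearity on the level of coefficients, with summability justifying the termwise manipulation.
The difference is a separate sequence `w` so that `fourierCoef (u - v)` can be inserted directly. -/
lemma bCoef_sub_sub {a c : K3 → C3} (ha : Summable fun k => ‖a k‖ ^ 2)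
    (hc : Summable fun k => ‖c k‖ ^ 2) (ha1 : Summable fun k => waveLen k ^ 2 * ‖a k‖ ^ 2)
    (hc1 : Summable fun k => waveLen k ^ 2 * ‖c k‖ ^ 2) {w : K3 → C3} (hw : ∀ k, w k = a k - c k)
    (hws : Summable fun k => ‖w k‖ ^ 2) (hw1 : Summable fun k => waveLen k ^ 2 * ‖w k‖ ^ 2) (k : K3) :
    bCoef a a k - bCoef c c k = bCoef w a k + bCoef c w k := by
  rw [bCoef, bCoef, bCoef, bCoef, ← map_sub, ← map_add,
    ← (summable_convTerm ha ha1 k).tsum_sub (summable_convTerm hc hc1 k),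
    ← (summable_convTerm hws ha1 k).tsum_add (summable_convTerm hc hw1 k)]
  congr 2
  ext1 j
  have e : (Complex.I * ∑ l, w j l * (((k - j) l : ℤ) : ℂ)) = (Complex.I * ∑ l, a j l * (((k - j) l : ℤ) : ℂ))
      - (Complex.I * ∑ l, c j l * (((k - j) l : ℤ) : ℂ)) := by
    rw [← mul_sub, ← Finset.sum_sub_distrib, hw]
    simp [sub_mul]
  rw [convTerm, convTerm, convTerm, convTerm, e, hw (k - j)]
  module

/-- The `V`-norm in terms of Fourier coefficients. -/
lemma gevreyNorm_V_sq {u : L2} (hu : u ∈ gevrey (1 / 2) 0) :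
    gevreyNorm (1 / 2) 0 u ^ 2 = torusVol * ∑' k, (waveLen k * ‖fourierCoef u k‖) ^ 2 := by
  simp only [gevreyNorm_sq hu, gw_half, mul_pow]

lemma gevrey_sub {α σ : ℝ} {u v : L2} (hu : u ∈ gevrey α σ) (hv : v ∈ gevrey α σ) :
    u - v ∈ gevrey α σ := by
  refine ⟨H.sub_mem hu.1 hv.1, ?_⟩
  obtain ⟨w, hw⟩ := hu.2
  obtain ⟨w', hw'⟩ := hv.2
  exact ⟨w - w', fun k => by rw [fourierCoef_sub, fourierCoef_sub, hw, hw', smul_sub]⟩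

lemma multiplier_sub {α σ : ℝ} {u v : L2} (hu : u ∈ gevrey α σ) (hv : v ∈ gevrey α σ) :
    multiplier (gevreySymbol α σ) (u - v)
      = multiplier (gevreySymbol α σ) u - multiplier (gevreySymbol α σ) v := by
  apply fourierCoef_ext
  intro k
  rw [fourierCoef_sub, fourierCoef_gevrey hu, fourierCoef_gevrey hv,
    fourierCoef_gevrey (gevrey_sub hu hv), fourierCoef_sub, smul_sub]

lemma gevreyNorm_sub_le {α σ : ℝ} {u v : L2} (hu : u ∈ gevrey α σ) (hv : v ∈ gevrey α σ) :
    gevreyNorm α σ (u - v) ≤ gevreyNorm α σ u + gevreyNorm α σ v := by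
  rw [gevreyNorm, multiplier_sub hu hv]
  exact norm_sub_le _ _

lemma summable_V {u : L2} (hu : u ∈ gevrey (1 / 2) 0) :
    Summable fun k => (waveLen k * ‖fourierCoef u k‖) ^ 2 := by
  simpa only [mul_pow] using summable_of_mem_V hu

lemma sqrt_tsum_V_le {u : L2} (hu : u ∈ gevrey (1 / 2) 0) {R : ℝ} (hR : gevreyNorm (1 / 2) 0 u ≤ R) :
    Real.sqrt (∑' k, (waveLen k * ‖fourierCoef u k‖) ^ 2) ≤ R := by
  have h0 := gevreyNorm_nonneg (1 / 2) 0 u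
  have h1 := gevreyNorm_V_sq hu
  have h2 := one_le_torusVol
  have h3 : 0 ≤ ∑' k, (waveLen k * ‖fourierCoef u k‖) ^ 2 := tsum_nonneg fun k => sq_nonneg _
  rw [Real.sqrt_le_left (h0.trans hR)]
  nlinarith

lemma norm_bCoef_le (a c : K3 → C3) (ha : Summable fun k => ‖a k‖ ^ 2)
    (hc : Summable fun k => waveLen k ^ 2 * ‖c k‖ ^ 2) (k : K3) :
    ‖bCoef a c k‖ ≤ ∑' j, ‖a j‖ * (waveLen (k - j) * ‖c (k - j)‖) := by
  have hs : Summable fun j => ‖a j‖ * (waveLen (k - j) * ‖c (k - j)‖) :=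
    summable_mul_of_summable_sq ha
      (summable_comp_sub (f := fun k => (waveLen k * ‖c k‖) ^ 2) (by simpa [mul_pow] using hc) k)
  exact (norm_projCoef_le k _).trans (tsum_of_norm_bounded hs.hasSum (norm_convTerm_le a c k))

lemma tsum_norm_sq_le (u : L2) : Real.sqrt (∑' k, ‖fourierCoef u k‖ ^ 2) ≤ ‖u‖ := by
  rw [Real.sqrt_le_left (norm_nonneg _), norm_sq_eq]
  have h3 : 0 ≤ ∑' k, ‖fourierCoef u k‖ ^ 2 := tsum_nonneg fun k => sq_nonneg _
  nlinarith [one_le_torusVol]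

lemma norm_le_gevreyNorm_V {u : L2} (hu : u ∈ gevrey (1 / 2) 0) : ‖u‖ ≤ gevreyNorm (1 / 2) 0 u := by
  rw [← sq_le_sq₀ (norm_nonneg _) (gevreyNorm_nonneg _ _ _), gevreyNorm_V_sq hu, norm_sq_eq]
  refine mul_le_mul_of_nonneg_left ((summable_norm_sq u).tsum_le_tsum (fun k => ?_) (summable_V hu))
    torusVol_pos.le
  by_cases hk : k = 0
  · simp [hk, coef_zero_of_mem_H hu.1]
  · rw [mul_pow]
    have := one_le_waveLen hk
    exact le_mul_of_one_le_left (sq_nonneg _) (one_le_pow₀ this)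

/-- The coefficients of the nonlinearity depend on the field in a Lipschitz way with respect to the
`L²` norm, on bounded subsets of `V`. -/
lemma norm_bCoef_sub_le {u v : L2} (hu : u ∈ gevrey (1 / 2) 0) (hv : v ∈ gevrey (1 / 2) 0) {R : ℝ}
    (hRu : gevreyNorm (1 / 2) 0 u ≤ R) (hRv : gevreyNorm (1 / 2) 0 v ≤ R) (k : K3) :
    ‖bCoef (fourierCoef u) (fourierCoef u) k - bCoef (fourierCoef v) (fourierCoef v) k‖
      ≤ (2 + waveLen k) * R * ‖u - v‖ := by
  set w := u - v with hw
  have hwV : w ∈ gevrey (1 / 2) 0 := gevrey_sub hu hv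
  have hk := waveLen_nonneg k
  have hR : 0 ≤ R := (gevreyNorm_nonneg _ _ _).trans hRu
  rw [bCoef_sub_sub (w := fourierCoef w) (summable_norm_sq u) (summable_norm_sq v)
    (summable_of_mem_V hu) (summable_of_mem_V hv) (fun k => by simp [hw]) (summable_norm_sq w)
    (summable_of_mem_V hwV)]
  have h1 : ‖bCoef (fourierCoef w) (fourierCoef u) k‖ ≤ ‖w‖ * R := by
    refine (norm_bCoef_le _ _ (summable_norm_sq w) (summable_of_mem_V hu) k).trans ?_
    have h := tsum_mul_le_sqrt (f := fun j => ‖fourierCoef w j‖)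
      (g := fun j => waveLen (k - j) * ‖fourierCoef u (k - j)‖) (fun j => norm_nonneg _)
      (fun j => mul_nonneg (waveLen_nonneg _) (norm_nonneg _)) (summable_norm_sq w)
      (summable_comp_sub (summable_V hu) k)
    refine h.trans ?_
    have e : ∑' j, (waveLen (k - j) * ‖fourierCoef u (k - j)‖) ^ 2
        = ∑' j, (waveLen j * ‖fourierCoef u j‖) ^ 2 :=
      (Equiv.subLeft k).tsum_eq fun j => (waveLen j * ‖fourierCoef u j‖) ^ 2
    rw [e]
    gcongr
    · exact tsum_norm_sq_le w
    · exact sqrt_tsum_V_le hu hRu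
  have h2 : ‖bCoef (fourierCoef v) (fourierCoef w) k‖ ≤ (waveLen k * R + R) * ‖w‖ := by
    refine (norm_bCoef_le _ _ (summable_norm_sq v) (summable_of_mem_V hwV) k).trans ?_
    have hg := summable_comp_sub (summable_norm_sq w) k
    have e : ∑' j, ‖fourierCoef w (k - j)‖ ^ 2 = ∑' j, ‖fourierCoef w j‖ ^ 2 :=
      (Equiv.subLeft k).tsum_eq fun j => ‖fourierCoef w j‖ ^ 2
    have s1 := (summable_mul_of_summable_sq (summable_norm_sq v) hg).mul_left (waveLen k)
    have s2 := summable_mul_of_summable_sq (summable_V hv) hg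
    have t1 := tsum_mul_le_sqrt (fun j => norm_nonneg _) (fun j => norm_nonneg _)
      (summable_norm_sq v) hg
    have t2 := tsum_mul_le_sqrt (fun j => mul_nonneg (waveLen_nonneg _) (norm_nonneg _))
      (fun j => norm_nonneg _) (summable_V hv) hg
    rw [e] at t1 t2
    have hs : Summable fun j => ‖fourierCoef v j‖ * (waveLen (k - j) * ‖fourierCoef w (k - j)‖) :=
      summable_mul_of_summable_sq (summable_norm_sq v) (summable_comp_sub (summable_V hwV) k)
    calc _ ≤ ∑' j, (waveLen k * (‖fourierCoef v j‖ * ‖fourierCoef w (k - j)‖) +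
            waveLen j * ‖fourierCoef v j‖ * ‖fourierCoef w (k - j)‖) := by
          refine hs.tsum_le_tsum (fun j => ?_) (s1.add s2)
          have : waveLen (k - j) ≤ waveLen k + waveLen j := by
            rw [sub_eq_add_neg]
            exact (waveLen_add_le _ _).trans (by simp)
          calc _ ≤ ‖fourierCoef v j‖ * ((waveLen k + waveLen j) * ‖fourierCoef w (k - j)‖) := by
                gcongr
            _ = _ := by ring
      _ = waveLen k * ∑' j, ‖fourierCoef v j‖ * ‖fourierCoef w (k - j)‖ +
            ∑' j, waveLen j * ‖fourierCoef v j‖ * ‖fourierCoef w (k - j)‖ := by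
          rw [s1.tsum_add s2, tsum_mul_left]
      _ ≤ waveLen k * (R * ‖w‖) + R * ‖w‖ := by
          have b1 : Real.sqrt (∑' k, ‖fourierCoef v k‖ ^ 2) ≤ R :=
            (tsum_norm_sq_le v).trans ((norm_le_gevreyNorm_V hv).trans hRv)
          have b2 := tsum_norm_sq_le w
          have b3 := sqrt_tsum_V_le hv hRv
          gcongr
          · exact t1.trans (by gcongr)
          · exact t2.trans (by gcongr)
      _ = _ := by ring
  calc _ ≤ ‖w‖ * R + (waveLen k * R + R) * ‖w‖ := (norm_add_le _ _).trans (add_le_add h1 h2)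
    _ = _ := by ring

/-- With `x = |k|^{1/2}` this is `x³ ≤ θ x⁴ + θ⁻³`: the first term suffices when `θ x ≥ 1`, the
second when `θ x ≤ 1`. -/
lemma waveLen_rpow_interp {θ : ℝ} (hθ : 0 < θ) (k : K3) :
    (waveLen k ^ (3 / 4 : ℝ)) ^ 2 ≤ θ * waveLen k ^ 2 + (θ ^ 3)⁻¹ := by
  set x := waveLen k ^ (1 / 2 : ℝ) with hx
  have hx0 : 0 ≤ x := Real.rpow_nonneg (waveLen_nonneg k) _
  have e1 : (waveLen k ^ (3 / 4 : ℝ)) ^ 2 = x ^ 3 := by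
    rw [hx, ← Real.rpow_natCast, ← Real.rpow_natCast, ← Real.rpow_mul (waveLen_nonneg k),
      ← Real.rpow_mul (waveLen_nonneg k)]
    norm_num
  have e2 : waveLen k ^ 2 = x ^ 4 := by
    rw [hx, ← Real.rpow_natCast, ← Real.rpow_natCast, ← Real.rpow_mul (waveLen_nonneg k)]
    norm_num
  rw [e1, e2]
  rcases le_total (θ * x) 1 with h | h
  · have h3 : (θ * x) ^ 3 ≤ 1 := pow_le_one₀ (by positivity) h
    rw [mul_pow] at h3
    have : x ^ 3 ≤ (θ ^ 3)⁻¹ := by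
      rw [← one_div, le_div_iff₀ (by positivity)]
      linarith
    have : 0 ≤ θ * x ^ 4 := by positivity
    linarith
  · have : 0 ≤ (θ ^ 3)⁻¹ := by positivity
    have : x ^ 3 ≤ θ * x ^ 4 := by
      calc x ^ 3 = 1 * x ^ 3 := by ring
        _ ≤ θ * x * x ^ 3 := by gcongr
        _ = _ := by ring
    linarith

/-- Here `s`, `m` and `√n` stand for the `ℓ²` norms of `|k| ŵ`, `|k|^{3/4} ŵ` and `ŵ`. Young's
inequality turns the two cross terms into `s²/2` plus a multiple of `m²`, and interpolation turns
the latter into `s²/2` plus a multiple of `n`. The two halves together use up the dissipation `s²`.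
-/
lemma energy_absorb {L R s m n ε T : ℝ} (hL : 0 ≤ L) (hR : 0 ≤ R) (hε : 0 ≤ ε)
    (hs2 : s ≤ 2 * R) (hm : ∀ θ > 0, m ^ 2 ≤ θ * s ^ 2 + (θ ^ 3)⁻¹ * n)
    (hT : T ≤ -s ^ 2 + L * (m * R * s) + L * (R * s * m) + ε * (L * (R * R * s))) :
    T ≤ (2 * L ^ 2 * R ^ 2 + 1) * (2 * (2 * L ^ 2 * R ^ 2 + 1)) ^ 3 * n + ε * (2 * L * R ^ 3) := by
  set P := 2 * L ^ 2 * R ^ 2 + 1 with hP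
  have hP0 : 1 ≤ P := by nlinarith [sq_nonneg (L * R)]
  -- This `θ` makes `P m²` cost exactly the second half of `s²`.
  have h1 := hm (1 / (2 * P)) (by positivity)
  have e : ((1 / (2 * P)) ^ 3)⁻¹ = (2 * P) ^ 3 := by
    rw [one_div, inv_pow, inv_inv]
  rw [e] at h1
  have h2 : P * m ^ 2 ≤ s ^ 2 / 2 + P * (2 * P) ^ 3 * n := by
    calc P * m ^ 2 ≤ P * (1 / (2 * P) * s ^ 2 + (2 * P) ^ 3 * n) := by gcongr
      _ = _ := by field_simp
  have h3 : 2 * (L * R * m) * s ≤ s ^ 2 / 2 + 2 * (L * R * m) ^ 2 := by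
    nlinarith [sq_nonneg (s - 2 * (L * R * m))]
  have h4 : 2 * (L * R * m) ^ 2 ≤ P * m ^ 2 := by
    rw [hP]
    nlinarith [sq_nonneg m]
  have h5 : ε * (L * (R * R * s)) ≤ ε * (2 * L * R ^ 3) := by
    have : L * (R * R * s) ≤ L * (R * R * (2 * R)) := by gcongr
    calc _ ≤ ε * (L * (R * R * (2 * R))) := by gcongr
      _ = _ := by ring
  nlinarith

/-- The energy estimate for the difference of two solutions of (possibly truncated) Navier–Stokes
equations. -/
lemma exists_inner_difference_le (R : ℝ) (hR : 0 ≤ R) : ∃ C : ℝ, 0 ≤ C ∧ ∀ u ∈ gevrey (1 / 2) 0,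
    ∀ v ∈ gevrey (1 / 2) 0, gevreyNorm (1 / 2) 0 u ≤ R → gevreyNorm (1 / 2) 0 v ≤ R →
    ∀ (g : L2) (χ η : K3 → ℝ) (ε : ℝ), 0 ≤ ε → (∀ k, |χ k| ≤ 1) →
    (∀ k, |η k| ≤ ε * waveLen k ^ (1 / 4 : ℝ)) →
    (∀ k, fourierCoef g k = -(waveLen k ^ 2 • fourierCoef (u - v) k)
      - χ k • (bCoef (fourierCoef u) (fourierCoef u) k - bCoef (fourierCoef v) (fourierCoef v) k)
      - η k • bCoef (fourierCoef v) (fourierCoef v) k) →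
    inner ℝ (u - v) g ≤ C * (‖u - v‖ ^ 2 + ε) := by
  set L := 2 * Real.sqrt latticeSum with hL
  have hL0 : 0 ≤ L := by positivity
  set P := (2 * L ^ 2 * R ^ 2 + 1) * (2 * (2 * L ^ 2 * R ^ 2 + 1)) ^ 3 with hP
  have hP0 : 0 ≤ P := by positivity
  have hT := torusVol_pos
  refine ⟨P + torusVol * (2 * L * R ^ 3), by positivity, ?_⟩
  intro u hu v hv hRu hRv g χ η ε hε hχ hη hg
  set w := u - v with hw
  have hwV : w ∈ gevrey (1 / 2) 0 := gevrey_sub hu hv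
  have hu0 := coef_zero_of_mem_H hu.1
  have hv0 := coef_zero_of_mem_H hv.1
  have hw0 := coef_zero_of_mem_H hwV.1
  have hsu := summable_V hu
  have hsv := summable_V hv
  have hsw := summable_V hwV
  have hsw34 : Summable fun k => (waveLen k ^ (3 / 4 : ℝ) * ‖fourierCoef w k‖) ^ 2 := by
    refine Summable.of_nonneg_of_le (fun k => sq_nonneg _) (fun k => ?_)
      (hsw.add (summable_norm_sq w))
    have := waveLen_rpow_interp one_pos k
    norm_num at this
    rw [mul_pow, mul_pow, ← add_one_mul]
    gcongr
  have hsu1 : Summable fun k => (waveLen k ^ (1 : ℝ) * ‖fourierCoef v k‖) ^ 2 := by simpa using hsv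
  have hsw1 : Summable fun k => (waveLen k ^ (1 : ℝ) * ‖fourierCoef w k‖) ^ 2 := by simpa using hsw
  -- The truncation error carries a factor `|k|^{1/4}`. It is given to the test field, which then
  -- needs weight `3/4` instead of `1`, so the total is still one power of `|k|` on `w`.
  let z : K3 → C3 := fun k => waveLen k ^ (1 / 4 : ℝ) • fourierCoef w k
  have hzn : ∀ k, waveLen k ^ (3 / 4 : ℝ) * ‖z k‖ = waveLen k * ‖fourierCoef w k‖ := by
    intro k
    rw [norm_smul, Real.norm_of_nonneg (Real.rpow_nonneg (waveLen_nonneg k) _), ← mul_assoc,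
      ← Real.rpow_add_of_nonneg (waveLen_nonneg k) (by norm_num) (by norm_num)]
    norm_num
  have hz0 : z 0 = 0 := by simp [z, hw0]
  have hsz : Summable fun k => (waveLen k ^ (3 / 4 : ℝ) * ‖z k‖) ^ 2 := by simpa only [hzn] using hsw
  -- In each term containing `w` twice, one copy carries a full power of `|k|` and the other only
  -- `3/4`. In `B(w, u)` the weaker copy is the advecting field; in `B(v, w)` it is the test field,
  -- since the derivative already falls on `w`.
  obtain ⟨s1, t1⟩ := tsum_bCoef_mul_le (p := 3 / 4) (q := 1) (by norm_num) (by norm_num) (by norm_num)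
    hw0 hw0 hsw34 hsu hsw1
  obtain ⟨s2, t2⟩ := tsum_bCoef_mul_le (p := 1) (q := 3 / 4) (by norm_num) (by norm_num) (by norm_num)
    hv0 hw0 hsu1 hsw hsw34
  obtain ⟨s3, t3⟩ := tsum_bCoef_mul_le (p := 1) (q := 3 / 4) (by norm_num) (by norm_num) (by norm_num)
    hv0 hz0 hsu1 hsv hsz
  simp only [hzn, Real.rpow_one] at t1 t2 t3
  have ru := sqrt_tsum_V_le hu hRu
  have rv := sqrt_tsum_V_le hv hRv
  have rw2 : Real.sqrt (∑' k, (waveLen k * ‖fourierCoef w k‖) ^ 2) ≤ 2 * R :=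
    sqrt_tsum_V_le hwV ((gevreyNorm_sub_le hu hv).trans (by linarith))
  set s := Real.sqrt (∑' k, (waveLen k * ‖fourierCoef w k‖) ^ 2) with hs
  set m := Real.sqrt (∑' k, (waveLen k ^ (3 / 4 : ℝ) * ‖fourierCoef w k‖) ^ 2) with hm
  have hs0 : 0 ≤ s := Real.sqrt_nonneg _
  have hm0 : 0 ≤ m := Real.sqrt_nonneg _
  have hssq : s ^ 2 = ∑' k, (waveLen k * ‖fourierCoef w k‖) ^ 2 :=
    Real.sq_sqrt (tsum_nonneg fun k => sq_nonneg _)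
  have hmsq : m ^ 2 = ∑' k, (waveLen k ^ (3 / 4 : ℝ) * ‖fourierCoef w k‖) ^ 2 :=
    Real.sq_sqrt (tsum_nonneg fun k => sq_nonneg _)
  have hinterp : ∀ θ > 0, m ^ 2 ≤ θ * s ^ 2 + (θ ^ 3)⁻¹ * ∑' k, ‖fourierCoef w k‖ ^ 2 := by
    intro θ hθ
    rw [hmsq, hssq, ← tsum_mul_left, ← tsum_mul_left,
      ← (hsw.mul_left θ).tsum_add ((summable_norm_sq w).mul_left _)]
    refine hsw34.tsum_le_tsum (fun k => ?_) ((hsw.mul_left θ).add ((summable_norm_sq w).mul_left _))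
    rw [mul_pow, mul_pow, ← mul_assoc, ← add_mul]
    gcongr
    exact waveLen_rpow_interp hθ k
  have hdiff := bCoef_sub_sub (w := fourierCoef w) (summable_norm_sq u) (summable_norm_sq v)
    (summable_of_mem_V hu) (summable_of_mem_V hv) (fun k => by simp [hw]) (summable_norm_sq w)
    (summable_of_mem_V hwV)
  have hterm : ∀ k, torusVol * inner ℝ (fourierCoef w k) (fourierCoef g k) ≤
      torusVol * (-(waveLen k * ‖fourierCoef w k‖) ^ 2
        + ‖bCoef (fourierCoef w) (fourierCoef u) k‖ * ‖fourierCoef w k‖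
        + ‖bCoef (fourierCoef v) (fourierCoef w) k‖ * ‖fourierCoef w k‖
        + ε * (‖bCoef (fourierCoef v) (fourierCoef v) k‖ * ‖z k‖)) := by
    intro k
    refine mul_le_mul_of_nonneg_left ?_ hT.le
    rw [hg k, hdiff k, inner_sub_right, inner_sub_right, inner_neg_right, inner_smul_right,
      inner_smul_right, inner_smul_right, real_inner_self_eq_norm_sq]
    have i1 : |χ k * inner ℝ (fourierCoef w k) (bCoef (fourierCoef w) (fourierCoef u) k +
        bCoef (fourierCoef v) (fourierCoef w) k)| ≤ ‖fourierCoef w k‖ *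
        (‖bCoef (fourierCoef w) (fourierCoef u) k‖ + ‖bCoef (fourierCoef v) (fourierCoef w) k‖) := by
      rw [abs_mul]
      refine (mul_le_of_le_one_left (abs_nonneg _) (hχ k)).trans
        ((abs_real_inner_le_norm _ _).trans ?_)
      gcongr
      exact norm_add_le _ _
    have i2 : |η k * inner ℝ (fourierCoef w k) (bCoef (fourierCoef v) (fourierCoef v) k)| ≤
        ε * (‖bCoef (fourierCoef v) (fourierCoef v) k‖ * ‖z k‖) := by
      rw [abs_mul, norm_smul, Real.norm_of_nonneg (Real.rpow_nonneg (waveLen_nonneg k) _)]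
      calc _ ≤ ε * waveLen k ^ (1 / 4 : ℝ) *
            (‖fourierCoef w k‖ * ‖bCoef (fourierCoef v) (fourierCoef v) k‖) :=
            mul_le_mul (hη k) (abs_real_inner_le_norm _ _) (abs_nonneg _)
              ((abs_nonneg _).trans (hη k))
        _ = _ := by ring
    have := abs_le.1 i1
    have := abs_le.1 i2
    nlinarith
  have hsum : HasSum (fun k => torusVol * (-(waveLen k * ‖fourierCoef w k‖) ^ 2
        + ‖bCoef (fourierCoef w) (fourierCoef u) k‖ * ‖fourierCoef w k‖
        + ‖bCoef (fourierCoef v) (fourierCoef w) k‖ * ‖fourierCoef w k‖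
        + ε * (‖bCoef (fourierCoef v) (fourierCoef v) k‖ * ‖z k‖))) _ :=
    (((hsw.hasSum.neg.add s1.hasSum).add s2.hasSum).add (s3.hasSum.mul_left ε)).mul_left torusVol
  have hle := hasSum_le hterm (hasSum_inner w g) hsum
  refine hle.trans ?_
  have hfin := energy_absorb (n := ∑' k, ‖fourierCoef w k‖ ^ 2) hL0 hR hε rw2 hinterp
    (T := -∑' k, (waveLen k * ‖fourierCoef w k‖) ^ 2
        + ∑' k, ‖bCoef (fourierCoef w) (fourierCoef u) k‖ * ‖fourierCoef w k‖
        + ∑' k, ‖bCoef (fourierCoef v) (fourierCoef w) k‖ * ‖fourierCoef w k‖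
        + ε * ∑' k, ‖bCoef (fourierCoef v) (fourierCoef v) k‖ * ‖z k‖) (by
      rw [hssq]
      refine add_le_add (add_le_add (add_le_add le_rfl (t1.trans ?_)) (t2.trans ?_))
        (mul_le_mul_of_nonneg_left (t3.trans ?_) hε)
      · gcongr
      · gcongr
      · gcongr)
  calc _ ≤ torusVol * (P * ∑' k, ‖fourierCoef w k‖ ^ 2 + ε * (2 * L * R ^ 3)) := by gcongr
    _ = P * ‖w‖ ^ 2 + torusVol * (2 * L * R ^ 3) * ε := by rw [norm_sq_eq]; ring
    _ ≤ _ := by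
      have h1 : 0 ≤ P * ε := by positivity
      have h2 : 0 ≤ torusVol * (2 * L * R ^ 3) * ‖w‖ ^ 2 := by positivity
      nlinarith

/-! ### Quadratic differential equations with an invariant ball. -/

section ODE
variable {E : Type*} [NormedAddCommGroup E] [InnerProductSpace ℝ E]

/-- The radial retraction onto the ball of radius `R`. -/
def radialRetract (R : ℝ) (z : E) : E := (R / max R ‖z‖) • z

lemma radialRetract_of_le {R : ℝ} (hR : 0 < R) {z : E} (hz : ‖z‖ ≤ R) : radialRetract R z = z := by
  rw [radialRetract, max_eq_left hz, div_self hR.ne', one_smul]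

lemma norm_radialRetract_le {R : ℝ} (hR : 0 < R) (z : E) : ‖radialRetract R z‖ ≤ R := by
  have h : 0 < max R ‖z‖ := lt_max_of_lt_left hR
  rw [radialRetract, norm_smul, Real.norm_of_nonneg (by positivity), div_mul_eq_mul_div,
    div_le_iff₀ h]
  gcongr
  exact le_max_right _ _

/-- The difference splits into a contraction of `x - y` and a change of the scalar factor acting on
`y`, each bounded by `‖x - y‖`. -/
lemma norm_radialRetract_sub_le {R : ℝ} (hR : 0 < R) (x y : E) :
    ‖radialRetract R x - radialRetract R y‖ ≤ 2 * ‖x - y‖ := by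
  set X := max R ‖x‖ with hX
  set Y := max R ‖y‖ with hY
  have hX0 : 0 < X := lt_max_of_lt_left hR
  have hY0 : 0 < Y := lt_max_of_lt_left hR
  have e : radialRetract R x - radialRetract R y
      = (R / X) • (x - y) + ((R / X) * ((Y - X) / Y)) • y := by
    have : R / X * ((Y - X) / Y) = R / X - R / Y := by field_simp
    rw [this, radialRetract, radialRetract]
    module
  have hRX : R / X ≤ 1 := (div_le_one hX0).2 (le_max_left _ _)
  have h1 : |Y - X| ≤ ‖x - y‖ := by
    rw [abs_sub_comm, hX, hY, max_comm R, max_comm R]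
    exact (abs_max_sub_max_le_abs _ _ _).trans (abs_norm_sub_norm_le x y)
  rw [e]
  refine (norm_add_le _ _).trans ?_
  rw [norm_smul, norm_smul, norm_mul, norm_div (Y - X), Real.norm_of_nonneg (by positivity : 0 ≤ R / X),
    Real.norm_of_nonneg hY0.le, Real.norm_eq_abs]
  have h2 : R / X * ‖x - y‖ ≤ ‖x - y‖ := mul_le_of_le_one_left (norm_nonneg _) hRX
  have h3 : R / X * (|Y - X| / Y) * ‖y‖ ≤ ‖x - y‖ := by
    have h4 : ‖y‖ / Y ≤ 1 := (div_le_one hY0).2 (le_max_right _ _)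
    calc R / X * (|Y - X| / Y) * ‖y‖ = R / X * |Y - X| * (‖y‖ / Y) := by ring
      _ ≤ 1 * ‖x - y‖ * 1 := by gcongr
      _ = _ := by ring
  linarith

variable [CompleteSpace E]

/-- A quadratic differential equation whose vector field does not point out of a ball is solvable
in that ball on any time interval. -/
lemma exists_solution_quadratic (L : E →L[ℝ] E) (Q : E →L[ℝ] E →L[ℝ] E) {R : ℝ} (hR : 0 < R)
    (hneg : ∀ z : E, ‖z‖ ≤ R → inner ℝ z (L z - Q z z) ≤ 0) {z₀ : E} (hz₀ : ‖z₀‖ ≤ R)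
    {T : ℝ} (hT : 0 < T) :
    ∃ z : ℝ → E, z 0 = z₀ ∧ ∀ t, 0 ≤ t → t < T →
      ‖z t‖ ≤ R ∧ HasDerivAt z (L (z t) - Q (z t) (z t)) t := by
  set F : E → E := fun z => L z - Q z z with hF
  set ρ : E → E := radialRetract R with hρ
  have hFlip : ∀ x y : E, ‖x‖ ≤ R → ‖y‖ ≤ R → ‖F x - F y‖ ≤ (‖L‖ + 2 * ‖Q‖ * R) * ‖x - y‖ := by
    intro x y hx hy
    have e : F x - F y = L (x - y) - (Q (x - y) x + Q y (x - y)) := by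
      simp only [hF, map_sub, sub_apply]
      abel
    rw [e]
    calc _ ≤ ‖L (x - y)‖ + (‖Q (x - y) x‖ + ‖Q y (x - y)‖) :=
          (norm_sub_le _ _).trans (by gcongr; exact norm_add_le _ _)
      _ ≤ ‖L‖ * ‖x - y‖ + (‖Q‖ * ‖x - y‖ * R + ‖Q‖ * R * ‖x - y‖) := by
          gcongr
          · exact L.le_opNorm _
          · exact (Q.le_opNorm₂ _ _).trans (by gcongr)
          · exact (Q.le_opNorm₂ _ _).trans (by gcongr)
      _ = _ := by ring
  have hFb : ∀ x : E, ‖x‖ ≤ R → ‖F x‖ ≤ ‖L‖ * R + ‖Q‖ * R * R := by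
    intro x hx
    calc _ ≤ ‖L x‖ + ‖Q x x‖ := norm_sub_le _ _
      _ ≤ _ := by
          gcongr
          · exact (L.le_opNorm _).trans (by gcongr)
          · exact (Q.le_opNorm₂ _ _).trans (by gcongr)
  set M : NNReal := ⟨‖L‖ * R + ‖Q‖ * R * R, by positivity⟩ with hM
  set K : NNReal := ⟨2 * (‖L‖ + 2 * ‖Q‖ * R), by positivity⟩ with hK
  -- Composed with the retraction, the field is globally Lipschitz and bounded by `M`, so the ball
  -- of radius `M T` is never left and the solution lives on the whole interval. Taking `[-T, T]`
  -- makes `0` an interior point, so the derivative there is two-sided.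
  have hPL : IsPicardLindelof (fun _ z => F (ρ z)) (tmin := -T) (tmax := T) ⟨0, by simp [hT.le]⟩ z₀
      (M * ⟨T, hT.le⟩) 0 M K := by
    refine ⟨fun t _ => ?_, fun x _ => continuousOn_const, fun t _ x _ => ?_, ?_⟩
    · refine (LipschitzWith.of_dist_le_mul fun x y => ?_).lipschitzOnWith
      rw [dist_eq_norm, dist_eq_norm]
      calc _ ≤ (‖L‖ + 2 * ‖Q‖ * R) * ‖ρ x - ρ y‖ :=
            hFlip _ _ (norm_radialRetract_le hR x) (norm_radialRetract_le hR y)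
        _ ≤ (‖L‖ + 2 * ‖Q‖ * R) * (2 * ‖x - y‖) := by
            gcongr
            exact norm_radialRetract_sub_le hR x y
        _ = 2 * (‖L‖ + 2 * ‖Q‖ * R) * ‖x - y‖ := by ring
    · exact hFb _ (norm_radialRetract_le hR x)
    · simp only [sub_zero, zero_sub, neg_neg, max_self, NNReal.coe_zero]
      exact le_rfl
  obtain ⟨z, hz0, hz⟩ := hPL.exists_eq_forall_mem_Icc_hasDerivWithinAt₀
  have hder : ∀ t, 0 ≤ t → t < T → HasDerivAt z (F (ρ (z t))) t := fun t h0 h1 =>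
    (hz t ⟨by linarith, h1.le⟩).hasDerivAt (Icc_mem_nhds (by linarith) h1)
  have hbound : ∀ t, 0 ≤ t → t < T → ‖z t‖ ≤ R := by
    intro t h0 h1
    have hd : ∀ s ∈ Set.Icc 0 t, HasDerivAt (fun s => ‖z s‖ ^ 2) (2 * inner ℝ (z s) (F (ρ (z s)))) s :=
      fun s hs => (hder s hs.1 (hs.2.trans_lt h1)).norm_sq
    have hanti : AntitoneOn (fun s => ‖z s‖ ^ 2) (Set.Icc 0 t) := by
      refine antitoneOn_of_deriv_nonpos (convex_Icc 0 t)
        (fun s hs => (hd s hs).continuousAt.continuousWithinAt)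
        (fun s hs => (hd s (interior_subset hs)).differentiableAt.differentiableWithinAt) ?_
      intro s hs
      rw [(hd s (interior_subset hs)).deriv]
      have hmax : 0 < max R ‖z s‖ := lt_max_of_lt_left hR
      -- `z s` is a positive multiple of its retraction, so the sign condition on the ball of radius
      -- `R` holds everywhere for the retracted field. The norm cannot increase, and the retraction
      -- turns out to be inactive along the solution.
      have e : z s = (max R ‖z s‖ / R) • ρ (z s) := by
        rw [hρ, radialRetract, smul_smul, div_mul_div_cancel₀ hR.ne', div_self hmax.ne', one_smul]
      have h2 := hneg (ρ (z s)) (norm_radialRetract_le hR (z s))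
      have h3 : inner ℝ (z s) (F (ρ (z s))) = (max R ‖z s‖ / R) * inner ℝ (ρ (z s)) (F (ρ (z s))) := by
        conv_lhs => enter [2]; rw [e]
        rw [inner_smul_left]
        rfl
      rw [h3]
      have : 0 ≤ max R ‖z s‖ / R := by positivity
      nlinarith
    have h2 := hanti ⟨le_rfl, h0⟩ ⟨h0, le_rfl⟩ h0
    simp only [hz0] at h2
    exact ((sq_le_sq₀ (norm_nonneg _) (norm_nonneg _)).1 h2).trans hz₀
  refine ⟨z, hz0, fun t h0 h1 => ⟨hbound t h0 h1, ?_⟩⟩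
  have := hder t h0 h1
  rwa [hρ, radialRetract_of_le hR (hbound t h0 h1)] at this

end ODE

/-! ### The Galerkin system and its solvability. -/

lemma projCoef_smul (k : K3) (r : ℝ) (c : C3) : projCoef k (r • c) = r • projCoef k c :=
  ((projCoef k).restrictScalars ℝ).map_smul r c

/-- Bounded even Fourier multipliers, composed with the Leray projection. -/
lemma exists_multiplierCLM {m : K3 → ℝ} (he : ∀ k, m (-k) = m k) {C : ℝ} (hb : ∀ k, |m k| ≤ C) :
    ∃ T : L2 →L[ℝ] L2, ∀ u k, fourierCoef (T u) k = m k • projCoef k (fourierCoef u k) := by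
  have hC : 0 ≤ C := (abs_nonneg _).trans (hb 0)
  have hbd : ∀ (u : L2) k, ‖m k • projCoef k (fourierCoef u k)‖ ^ 2 ≤ C ^ 2 * ‖fourierCoef u k‖ ^ 2 := by
    intro u k
    rw [norm_smul, mul_pow]
    gcongr
    · exact hb k
    · exact norm_projCoef_le k _
  have hex : ∀ u : L2, ∃ w : L2, ∀ k, fourierCoef w k = m k • projCoef k (fourierCoef u k) := by
    intro u
    refine exists_fourierCoef_eq ?_ (Summable.of_nonneg_of_le (fun k => by positivity) (hbd u)
      ((summable_norm_sq u).mul_left _))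
    have := (isHermSymbol_ofReal he).smul (isRealSeq_fourierCoef u).projCoef
    simpa only [Complex.coe_smul] using this
  choose f hf using hex
  refine ⟨LinearMap.mkContinuous
    { toFun := f
      map_add' := fun u v => fourierCoef_ext fun k => by
        rw [fourierCoef_add, hf, hf, hf, fourierCoef_add, map_add, smul_add]
      map_smul' := fun r u => fourierCoef_ext fun k => by
        rw [RingHom.id_apply, fourierCoef_smul, hf, hf, fourierCoef_smul, projCoef_smul,
          smul_comm] } C ?_, fun u k => hf u k⟩
  intro u
  change ‖f u‖ ≤ C * ‖u‖
  rw [← sq_le_sq₀ (norm_nonneg _) (by positivity), mul_pow, norm_sq_eq, norm_sq_eq,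
    mul_left_comm (C ^ 2), ← tsum_mul_left (a := C ^ 2)]
  refine mul_le_mul_of_nonneg_left (Summable.tsum_le_tsum (fun k => ?_) (summable_norm_sq _)
    ((summable_norm_sq u).mul_left _)) torusVol_pos.le
  rw [hf]
  exact hbd u k

lemma mem_H_of_coef_proj {u w : L2} {m : K3 → ℝ}
    (h : ∀ k, fourierCoef w k = m k • projCoef k (fourierCoef u k)) : w ∈ H :=
  mem_H_of_isDivFree fun k => by rw [h, projCoef_smul, projCoef_idem]

lemma mem_gevrey_of_support {u : L2} (hu : u ∈ H) {N : ℝ}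
    (h : ∀ k, N < waveLen k → fourierCoef u k = 0) (α σ : ℝ) : u ∈ gevrey α σ := by
  refine mem_gevrey_iff.2 ⟨hu, summable_of_ne_finset_zero (s := (finite_waveLen_le N).toFinset)
    fun k hk => ?_⟩
  have : N < waveLen k := by simpa using hk
  simp [h k this]

lemma bCoef_add_left {a a' c : K3 → C3} {k : K3} (h : Summable (convTerm a c k))
    (h' : Summable (convTerm a' c k)) {s : K3 → C3} (hs : ∀ k, s k = a k + a' k) :
    bCoef s c k = bCoef a c k + bCoef a' c k := by
  rw [bCoef, bCoef, bCoef, ← map_add, ← h.tsum_add h']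
  congr 2
  ext1 j
  rw [convTerm, convTerm, convTerm, ← add_smul, ← mul_add, ← Finset.sum_add_distrib]
  simp [hs, add_mul]

lemma bCoef_add_right {a c c' : K3 → C3} {k : K3} (h : Summable (convTerm a c k))
    (h' : Summable (convTerm a c' k)) {s : K3 → C3} (hs : ∀ k, s k = c k + c' k) :
    bCoef a s k = bCoef a c k + bCoef a c' k := by
  rw [bCoef, bCoef, bCoef, ← map_add, ← h.tsum_add h']
  congr 2
  ext1 j
  rw [convTerm, convTerm, convTerm, hs, smul_add]

lemma bCoef_smul_left {a c : K3 → C3} {k : K3} (r : ℝ) {s : K3 → C3} (hs : ∀ k, s k = r • a k) :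
    bCoef s c k = r • bCoef a c k := by
  rw [bCoef, bCoef, ← projCoef_smul, ← tsum_const_smul'']
  congr 2
  ext1 j
  rw [convTerm, convTerm, ← smul_assoc]
  congr 1
  simp only [hs, PiLp.smul_apply, Complex.real_smul, Finset.mul_sum]
  exact Finset.sum_congr rfl fun l _ => by ring

lemma bCoef_smul_right {a c : K3 → C3} {k : K3} (r : ℝ) {s : K3 → C3} (hs : ∀ k, s k = r • c k) :
    bCoef a s k = r • bCoef a c k := by
  rw [bCoef, bCoef, ← projCoef_smul, ← tsum_const_smul'']
  congr 2
  ext1 j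
  rw [convTerm, convTerm, hs, smul_comm]

lemma projCoef_bCoef (a c : K3 → C3) (k : K3) : projCoef k (bCoef a c k) = bCoef a c k :=
  projCoef_idem k _

lemma norm_le_gevreyNorm_of_coef {u w : L2} {α σ : ℝ} (hu : u ∈ gevrey α σ)
    (h : ∀ k, ‖fourierCoef w k‖ ≤ gw α σ k * ‖fourierCoef u k‖) : ‖w‖ ≤ gevreyNorm α σ u := by
  rw [← sq_le_sq₀ (norm_nonneg _) (gevreyNorm_nonneg _ _ _), gevreyNorm_sq hu, norm_sq_eq]
  refine mul_le_mul_of_nonneg_left ((summable_norm_sq w).tsum_le_tsum (fun k => ?_)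
    (mem_gevrey_iff.1 hu).2) torusVol_pos.le
  rw [← mul_pow]
  gcongr
  exact h k

lemma gevreyNorm_le_of_coef {u w : L2} {α σ C : ℝ} (hC : 0 ≤ C) (hu : u ∈ gevrey α σ)
    (h : ∀ k, gw α σ k * ‖fourierCoef u k‖ ≤ C * ‖fourierCoef w k‖) :
    gevreyNorm α σ u ≤ C * ‖w‖ := by
  rw [← sq_le_sq₀ (gevreyNorm_nonneg _ _ _) (by positivity), gevreyNorm_sq hu, mul_pow, norm_sq_eq,
    mul_left_comm (C ^ 2), ← tsum_mul_left (a := C ^ 2)]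
  refine mul_le_mul_of_nonneg_left ((mem_gevrey_iff.1 hu).2.tsum_le_tsum (fun k => ?_)
    ((summable_norm_sq w).mul_left _)) torusVol_pos.le
  rw [← mul_pow, ← mul_pow]
  exact pow_le_pow_left₀ (mul_nonneg (gw_nonneg α σ k) (norm_nonneg _)) (h k) 2

/-- The truncated nonlinearity as a continuous bilinear map. -/
lemma exists_truncated_bilinear {K : ℝ} (hK : IsBilinearConst K) {N : ℝ} {X Y : L2 →L[ℝ] L2}
    (hXH : ∀ z, X z ∈ H) (hX : ∀ z k, N < waveLen k → fourierCoef (X z) k = 0) :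
    ∃ Q : L2 →L[ℝ] L2 →L[ℝ] L2, ∀ z z', Q z z' = Y (B (X z) (X z')) := by
  have hg : ∀ z α σ, X z ∈ gevrey α σ := fun z => mem_gevrey_of_support (hXH z) (hX z)
  have hB : ∀ z z' k, fourierCoef (B (X z) (X z')) k
      = bCoef (fourierCoef (X z)) (fourierCoef (X z')) k := fun z z' k =>
    fourierCoef_B (hg z _ _) (hg z' _ _) k
  have hsum : ∀ z z' k, Summable (convTerm (fourierCoef (X z)) (fourierCoef (X z')) k) :=
    fun z z' k => summable_convTerm (summable_norm_sq _) (summable_of_mem_V (hg z' _ _)) k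
  have hX1 : ∀ z, gevreyNorm 1 0 (X z) ≤ (N ^ 2 * ‖X‖) * ‖z‖ := by
    intro z
    refine (gevreyNorm_le_of_coef (w := X z) (sq_nonneg N) (hg z 1 0) fun k => ?_).trans ?_
    · rw [gw_one]
      by_cases hk : N < waveLen k
      · simp [hX z k hk]
      · have := waveLen_nonneg k
        gcongr
        exact not_lt.1 hk
    · rw [mul_assoc]
      gcongr
      exact X.le_opNorm z
  refine ⟨LinearMap.mkContinuous₂ (LinearMap.mk₂ ℝ (fun z z' => Y (B (X z) (X z'))) ?_ ?_ ?_ ?_)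
    (‖Y‖ * |K ^ (1 / 2 : ℝ)| * (N ^ 2 * ‖X‖) * (N ^ 2 * ‖X‖)) ?_, fun z z' => rfl⟩
  · intro z₁ z₂ z'
    rw [← map_add]
    congr 1
    refine fourierCoef_ext fun k => ?_
    rw [fourierCoef_add, hB, hB, hB]
    exact bCoef_add_left (hsum _ _ k) (hsum _ _ k) fun k => by rw [map_add, fourierCoef_add]
  · intro r z z'
    rw [← map_smul]
    congr 1
    refine fourierCoef_ext fun k => ?_
    rw [fourierCoef_smul, hB, hB]
    exact bCoef_smul_left r fun k => by rw [map_smul, fourierCoef_smul]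
  · intro z z₁ z₂
    rw [← map_add]
    congr 1
    refine fourierCoef_ext fun k => ?_
    rw [fourierCoef_add, hB, hB, hB]
    exact bCoef_add_right (hsum _ _ k) (hsum _ _ k) fun k => by rw [map_add, fourierCoef_add]
  · intro r z z'
    rw [← map_smul]
    congr 1
    refine fourierCoef_ext fun k => ?_
    rw [fourierCoef_smul, hB, hB]
    exact bCoef_smul_right r fun k => by rw [map_smul, fourierCoef_smul]
  · intro z z'
    -- Continuity comes from (2) at its lowest level; the truncation makes the `D(A)` norms on the
    -- right bounded in `L²`.
    have h := hK (1 / 2) 0 le_rfl le_rfl (X z) (hg z _ _) (X z') (hg z' _ _)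
    norm_num at h
    have h1 : ‖B (X z) (X z')‖ ≤ gevreyNorm (1 / 2) 0 (B (X z) (X z')) :=
      norm_le_gevreyNorm_V (by norm_num; exact h.1)
    norm_num at h1
    have n1 := gevreyNorm_nonneg 1 0 (X z)
    have n2 := gevreyNorm_nonneg 1 0 (X z')
    change ‖Y (B (X z) (X z'))‖ ≤ _
    calc ‖Y (B (X z) (X z'))‖ ≤ ‖Y‖ * ‖B (X z) (X z')‖ := Y.le_opNorm _
      _ ≤ ‖Y‖ * (K ^ (1 / 2 : ℝ) * gevreyNorm 1 0 (X z) * gevreyNorm 1 0 (X z')) := by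
          gcongr
          exact h1.trans h.2
      _ ≤ ‖Y‖ * (|K ^ (1 / 2 : ℝ)| * ((N ^ 2 * ‖X‖) * ‖z‖) * ((N ^ 2 * ‖X‖) * ‖z'‖)) := by
          gcongr
          · exact le_abs_self _
          · exact hX1 z
          · exact hX1 z'
      _ = _ := by ring

lemma cutoff_of_lt {N : ℝ} {k : K3} (h : N < waveLen k) : cutoff N k = 0 := if_neg (not_le.2 h)

lemma cutoff_of_le {N : ℝ} {k : K3} (h : waveLen k ≤ N) : cutoff N k = 1 := if_pos h

lemma cutoff_nonneg (N : ℝ) (k : K3) : 0 ≤ cutoff N k := by unfold cutoff; split_ifs <;> norm_num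

lemma cutoff_le_one (N : ℝ) (k : K3) : cutoff N k ≤ 1 := by unfold cutoff; split_ifs <;> norm_num

lemma cutoff_mul_self (N : ℝ) (k : K3) : cutoff N k * cutoff N k = cutoff N k := by
  unfold cutoff; split_ifs <;> norm_num

lemma exists_bound_cutoff_mul (N : ℝ) (f : K3 → ℝ) : ∃ C, ∀ k, |cutoff N k * f k| ≤ C := by
  have hfin := finite_waveLen_le N
  obtain ⟨C, hC⟩ := (hfin.image fun k => |f k|).bddAbove
  refine ⟨max C 0, fun k => ?_⟩
  rcases le_or_gt (waveLen k) N with h | h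
  · rw [cutoff_of_le h, one_mul]
    exact (hC ⟨k, h, rfl⟩).trans (le_max_left _ _)
  · simp [cutoff_of_lt h]

/-- A solution on `[0, T)` of the Galerkin system with modes `|k| ≤ N`. -/
structure IsGalerkin (N T : ℝ) (u₀ : L2) (u : ℝ → L2) : Prop where
  mem_H : ∀ t, u t ∈ H
  support : ∀ t k, N < waveLen k → fourierCoef (u t) k = 0
  initial : ∀ k, fourierCoef (u 0) k = cutoff N k • fourierCoef u₀ k
  deriv : ∀ t, 0 ≤ t → t < T → ∃ g, HasDerivAt u g t ∧ ∀ k, fourierCoef g k =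
    -(waveLen k ^ 2 • fourierCoef (u t) k)
      - cutoff N k • bCoef (fourierCoef (u t)) (fourierCoef (u t)) k

/-- The equation is solved for `z = A^α u`, so that the `L²` norm of `z` is the norm in which
smallness is assumed. `X`, `Y`, `D` are the truncations of `A^{-α}`, `A^α`, `A`, and the system
reads `z' = -D z - Y B(X z, X z)`. For `‖z‖ ≤ R` the nonlinear term in the energy balance is at most
`K^α R |X z|²_{α+1/2,0}`. Since `K^α R ≤ 1`, it is dominated by the dissipation. -/
lemma exists_galerkin {K : ℝ} (hK : IsBilinearConst K) {α : ℝ} (hα : 1 / 2 ≤ α) {R : ℝ} (hR : 0 < R)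
    (hKR : K ^ α * R ≤ 1) {u₀ : L2} (hu₀ : u₀ ∈ gevrey α 0) (hn : gevreyNorm α 0 u₀ ≤ R) (N : ℝ)
    {T : ℝ} (hT : 0 < T) : ∃ u, IsGalerkin N T u₀ u := by
  obtain ⟨C₁, hC₁⟩ := exists_bound_cutoff_mul N fun k => waveLen k ^ (-(2 * α))
  obtain ⟨C₂, hC₂⟩ := exists_bound_cutoff_mul N fun k => waveLen k ^ (2 * α)
  obtain ⟨C₃, hC₃⟩ := exists_bound_cutoff_mul N fun k => waveLen k ^ 2
  obtain ⟨X, hX⟩ := exists_multiplierCLM (fun k => by simp [cutoff_neg]) hC₁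
  obtain ⟨Y, hY⟩ := exists_multiplierCLM (fun k => by simp [cutoff_neg]) hC₂
  obtain ⟨D, hD⟩ := exists_multiplierCLM (fun k => by simp [cutoff_neg]) hC₃
  have hXH : ∀ z, X z ∈ H := fun z => mem_H_of_coef_proj (hX z)
  have hXs : ∀ z k, N < waveLen k → fourierCoef (X z) k = 0 := fun z k hk => by
    simp [hX, cutoff_of_lt hk]
  have hXg : ∀ z β σ, X z ∈ gevrey β σ := fun z => mem_gevrey_of_support (hXH z) (hXs z)
  obtain ⟨Q, hQ⟩ := exists_truncated_bilinear hK (Y := Y) hXH hXs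
  have hab : ∀ k : K3, k ≠ 0 → waveLen k ^ (-(2 * α)) * waveLen k ^ (2 * α) = 1 := fun k hk => by
    rw [← Real.rpow_add (waveLen_pos hk)]
    simp
  have hneg : ∀ z : L2, ‖z‖ ≤ R → inner ℝ z ((-D) z - Q z z) ≤ 0 := by
    intro z hz
    set n := gevreyNorm (α + 1 / 2) 0 (X z) with hn
    -- The dissipation is exactly the square of the norm in which (2) measures both arguments.
    have hn2 : n ^ 2 = inner ℝ z (D z) := by
      rw [hn, gevreyNorm_sq (hXg z _ _), ← (hasSum_inner z (D z)).tsum_eq, tsum_mul_left]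
      congr 2
      ext k
      rw [hX, hD, inner_smul_right]
      have hself : inner ℝ (fourierCoef z k) (projCoef k (fourierCoef z k))
          = ‖projCoef k (fourierCoef z k)‖ ^ 2 := by
        rw [← real_inner_self_eq_norm_sq, inner_projCoef, projCoef_idem]
      rw [hself, norm_smul, mul_pow, Real.norm_eq_abs, sq_abs, gw, zero_mul, Real.exp_zero, mul_one,
        ← mul_assoc]
      by_cases hk : k = 0
      · simp [hk]
      have e : waveLen k ^ (2 * (α + 1 / 2)) = waveLen k ^ (2 * α) * waveLen k := by
        rw [mul_add, Real.rpow_add (waveLen_pos hk)]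
        norm_num
      congr 1
      rw [e]
      calc _ = (waveLen k ^ (-(2 * α)) * waveLen k ^ (2 * α)) ^ 2 * (cutoff N k * cutoff N k) * waveLen k ^ 2 := by ring
        _ = _ := by rw [hab k hk, cutoff_mul_self]; ring
    have hB := hK α 0 hα le_rfl (X z) (hXg z _ _) (X z) (hXg z _ _)
    rw [← hn] at hB
    have hQn : ‖Q z z‖ ≤ K ^ α * n * n := by
      refine le_trans ?_ hB.2
      rw [hQ]
      refine norm_le_gevreyNorm_of_coef hB.1 fun k => ?_
      rw [hY, norm_smul, gw, zero_mul, Real.exp_zero, mul_one, norm_mul,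
        Real.norm_of_nonneg (cutoff_nonneg _ _),
        Real.norm_of_nonneg (Real.rpow_nonneg (waveLen_nonneg k) _)]
      have h1 := cutoff_le_one N k
      have h2 := cutoff_nonneg N k
      have h3 := Real.rpow_nonneg (waveLen_nonneg k) (2 * α)
      gcongr
      · exact mul_le_of_le_one_left h3 h1
      · exact norm_projCoef_le k _
    rw [inner_sub_right, neg_apply, inner_neg_right, ← hn2]
    have h1 : -inner ℝ z (Q z z) ≤ ‖z‖ * ‖Q z z‖ :=
      (neg_le_abs _).trans (abs_real_inner_le_norm z (Q z z))
    have hKn : 0 ≤ K ^ α * n * n := (norm_nonneg _).trans hQn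
    have h2 : ‖z‖ * ‖Q z z‖ ≤ R * (K ^ α * n * n) := by gcongr
    have h3 : R * (K ^ α * n * n) ≤ n ^ 2 := by
      calc _ = K ^ α * R * n ^ 2 := by ring
        _ ≤ 1 * n ^ 2 := by gcongr
        _ = _ := one_mul _
    linarith
  have hz₀ : ‖Y u₀‖ ≤ R := by
    refine le_trans (norm_le_gevreyNorm_of_coef hu₀ fun k => ?_) hn
    rw [hY, norm_smul, gw, zero_mul, Real.exp_zero, mul_one, norm_mul,
      Real.norm_of_nonneg (cutoff_nonneg _ _),
      Real.norm_of_nonneg (Real.rpow_nonneg (waveLen_nonneg k) _)]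
    have h3 := Real.rpow_nonneg (waveLen_nonneg k) (2 * α)
    gcongr
    · exact mul_le_of_le_one_left h3 (cutoff_le_one N k)
    · exact norm_projCoef_le k _
  obtain ⟨z, hz0, hz⟩ := exists_solution_quadratic (-D) Q hR hneg hz₀ hT
  refine ⟨fun t => X (z t), fun t => hXH _, fun t => hXs _, fun k => ?_, fun t h0 h1 => ?_⟩
  · rw [hz0, hX, hY, projCoef_smul, projCoef_idem, isDivFree_of_mem_H hu₀.1, smul_smul]
    by_cases hk : k = 0
    · simp [hk, coef_zero_of_mem_H hu₀.1]
    · congr 1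
      calc _ = (waveLen k ^ (-(2 * α)) * waveLen k ^ (2 * α)) * (cutoff N k * cutoff N k) := by ring
        _ = _ := by rw [hab k hk, cutoff_mul_self, one_mul]
  · refine ⟨_, X.hasFDerivAt.comp_hasDerivAt t (hz t h0 h1).2, fun k => ?_⟩
    rw [hX, fourierCoef_sub, neg_apply, fourierCoef_neg, hD, hQ, hY, hX,
      fourierCoef_B (hXg _ _ _) (hXg _ _ _)]
    by_cases hk : k = 0
    · subst hk
      simp [bCoef]
    simp only [map_sub, map_neg, projCoef_smul, projCoef_idem, projCoef_bCoef, smul_sub, smul_neg,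
      smul_smul]
    congr 2
    · congr 1
      calc _ = waveLen k ^ (-(2 * α)) * (cutoff N k * cutoff N k) * waveLen k ^ 2 := by ring
        _ = _ := by rw [cutoff_mul_self]; ring
    · calc _ = (waveLen k ^ (-(2 * α)) * waveLen k ^ (2 * α)) * (cutoff N k * cutoff N k) := by ring
        _ = _ := by rw [hab k hk, cutoff_mul_self, one_mul]

/-! ### The a priori Gevrey bound with growing radius. -/

/-- The moving radius costs one factor `|k|`, against the `|k|²` gained from dissipation. -/
lemma hasDerivAt_gw_sq (α c t : ℝ) (k : K3) :
    HasDerivAt (fun t => gw α (c * t) k ^ 2) (2 * c * waveLen k * gw α (c * t) k ^ 2) t := by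
  have h1 : HasDerivAt (fun t => c * t * waveLen k) (c * waveLen k) t := by
    simpa using ((hasDerivAt_id t).const_mul c).mul_const (waveLen k)
  have h2 := (h1.exp.const_mul (waveLen k ^ (2 * α))).pow 2
  refine h2.congr_deriv ?_
  unfold gw
  push_cast
  ring

lemma gw_add_half_sq (α σ : ℝ) {k : K3} (hk : k ≠ 0) :
    gw (α + 1 / 2) σ k ^ 2 = waveLen k ^ 2 * gw α σ k ^ 2 := by
  have e : waveLen k ^ (2 * (α + 1 / 2)) = waveLen k ^ (2 * α) * waveLen k := by
    rw [mul_add, Real.rpow_add (waveLen_pos hk)]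
    norm_num
  rw [gw, gw, e]
  ring

lemma IsGalerkin.mem_gevrey {N T : ℝ} {u₀ : L2} {u : ℝ → L2} (hu : IsGalerkin N T u₀ u)
    (t α σ : ℝ) : u t ∈ gevrey α σ :=
  mem_gevrey_of_support (hu.mem_H t) (hu.support t) α σ

lemma gevreyNorm_sq_eq_sum {u : L2} (hu : u ∈ H) {N : ℝ} (h : ∀ k, N < waveLen k → fourierCoef u k = 0)
    (α σ : ℝ) : gevreyNorm α σ u ^ 2 =
      torusVol * ∑ k ∈ ballModes N, gw α σ k ^ 2 * ‖fourierCoef u k‖ ^ 2 := by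
  rw [gevreyNorm_sq (mem_gevrey_of_support hu h α σ), tsum_eq_sum]
  intro k hk
  rw [mem_ballModes, not_and_or, not_not, not_le] at hk
  rcases hk with hk | hk
  · simp [hk, coef_zero_of_mem_H hu]
  · simp [h k hk]

/-- As `u` has no modes outside the ball, the finite sum is the full Gevrey inner product. The
second field need not be truncated, so (2) can be applied to `B(u, u)` itself. -/
lemma abs_sum_gw_inner_le {u f : L2} {N : ℝ} (h : ∀ k, N < waveLen k → fourierCoef u k = 0)
    {α σ : ℝ} (hu : u ∈ gevrey α σ) (hf : f ∈ gevrey α σ) :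
    |torusVol * ∑ k ∈ ballModes N, gw α σ k ^ 2 * inner ℝ (fourierCoef u k) (fourierCoef f k)|
      ≤ gevreyNorm α σ u * gevreyNorm α σ f := by
  have e : torusVol * ∑ k ∈ ballModes N, gw α σ k ^ 2 * inner ℝ (fourierCoef u k) (fourierCoef f k)
      = inner ℝ (multiplier (gevreySymbol α σ) u) (multiplier (gevreySymbol α σ) f) := by
    rw [← (hasSum_inner _ _).tsum_eq, tsum_mul_left, tsum_eq_sum (s := ballModes N)]
    · congr 1
      refine Finset.sum_congr rfl fun k _ => ?_
      rw [fourierCoef_gevrey hu, fourierCoef_gevrey hf, Complex.coe_smul, Complex.coe_smul,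
        real_inner_smul_left, real_inner_smul_right]
      ring
    · intro k hk
      rw [mem_ballModes, not_and_or, not_not, not_le] at hk
      rw [fourierCoef_gevrey hu]
      rcases hk with hk | hk
      · simp [hk, coef_zero_of_mem_H hu.1]
      · simp [h k hk]
  rw [e]
  exact abs_real_inner_le_norm _ _

/-- The Gevrey norm of a Galerkin solution has the expected derivative bound. -/
lemma IsGalerkin.hasDerivAt_gevreyNorm_sq {N T : ℝ} {u₀ : L2} {u : ℝ → L2} (hu : IsGalerkin N T u₀ u)
    {K : ℝ} (hK : IsBilinearConst K) {α c : ℝ} (hα : 1 / 2 ≤ α) (hc : 0 ≤ c) {t : ℝ} (h0 : 0 ≤ t)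
    (h1 : t < T) : ∃ y', HasDerivAt (fun t => gevreyNorm α (c * t) (u t) ^ 2) y' t ∧
      y' ≤ 2 * (c - 1 + K ^ α * gevreyNorm α (c * t) (u t)) *
        gevreyNorm (α + 1 / 2) (c * t) (u t) ^ 2 := by
  obtain ⟨g, hg, hgk⟩ := hu.deriv t h0 h1
  have hT := torusVol_pos
  set σ := c * t with hσ
  have hσ0 : 0 ≤ σ := by positivity
  set Y := gevreyNorm α σ (u t)
  set D := gevreyNorm (α + 1 / 2) σ (u t)
  have hd : HasDerivAt (fun t => gevreyNorm α (c * t) (u t) ^ 2)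
      (torusVol * ∑ k ∈ ballModes N, (2 * c * waveLen k * gw α σ k ^ 2 * ‖fourierCoef (u t) k‖ ^ 2
        + gw α σ k ^ 2 * (2 * inner ℝ (fourierCoef (u t) k) (fourierCoef g k)))) t := by
    have e : (fun t => gevreyNorm α (c * t) (u t) ^ 2) = fun t => torusVol *
        ∑ k ∈ ballModes N, gw α (c * t) k ^ 2 * ‖fourierCoef (u t) k‖ ^ 2 :=
      funext fun t => gevreyNorm_sq_eq_sum (hu.mem_H t) (hu.support t) _ _
    rw [e]
    refine HasDerivAt.const_mul _ (HasDerivAt.fun_sum fun k _ => ?_)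
    have hk : HasDerivAt (fun t => fourierCoef (u t) k) (fourierCoef g k) t :=
      (fourierCLM k).hasFDerivAt.comp_hasDerivAt t hg
    exact (hasDerivAt_gw_sq α c t k).mul hk.norm_sq
  refine ⟨_, hd, ?_⟩
  have hB := hK α σ hα hσ0 (u t) (hu.mem_gevrey t _ _) (u t) (hu.mem_gevrey t _ _)
  have hBk : ∀ k, fourierCoef (B (u t) (u t)) k = bCoef (fourierCoef (u t)) (fourierCoef (u t)) k :=
    fourierCoef_B (hu.mem_gevrey t _ _) (hu.mem_gevrey t _ _)
  have hcs := (neg_le_abs _).trans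
    (abs_sum_gw_inner_le (hu.support t) (hu.mem_gevrey t α σ) hB.1)
  have hD : D ^ 2 = torusVol * ∑ k ∈ ballModes N, gw (α + 1 / 2) σ k ^ 2 * ‖fourierCoef (u t) k‖ ^ 2 :=
    gevreyNorm_sq_eq_sum (hu.mem_H t) (hu.support t) _ _
  have hY0 : 0 ≤ Y := gevreyNorm_nonneg _ _ _
  have hcs2 : -(torusVol * ∑ k ∈ ballModes N, gw α σ k ^ 2 *
      inner ℝ (fourierCoef (u t) k) (fourierCoef (B (u t) (u t)) k)) ≤ K ^ α * Y * D ^ 2 := by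
    refine hcs.trans ?_
    calc Y * gevreyNorm α σ (B (u t) (u t)) ≤ Y * (K ^ α * D * D) := by gcongr; exact hB.2
      _ = _ := by ring
  have hterm : ∀ k ∈ ballModes N, 2 * c * waveLen k * gw α σ k ^ 2 * ‖fourierCoef (u t) k‖ ^ 2
        + gw α σ k ^ 2 * (2 * inner ℝ (fourierCoef (u t) k) (fourierCoef g k)) ≤
      2 * (c - 1) * (gw (α + 1 / 2) σ k ^ 2 * ‖fourierCoef (u t) k‖ ^ 2)
        - 2 * (gw α σ k ^ 2 * inner ℝ (fourierCoef (u t) k) (fourierCoef (B (u t) (u t)) k)) := by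
    intro k hk
    obtain ⟨hk0, hkN⟩ := mem_ballModes.1 hk
    have hw := one_le_waveLen hk0
    rw [gw_add_half_sq α σ hk0, hgk k, cutoff_of_le hkN, one_smul, inner_sub_right, inner_neg_right,
      real_inner_smul_right, real_inner_self_eq_norm_sq, ← hBk]
    -- The cost of the moving radius is charged to the dissipation, since `|k| ≤ |k|²` for nonzero
    -- modes.
    have : 2 * c * waveLen k * gw α σ k ^ 2 * ‖fourierCoef (u t) k‖ ^ 2 ≤
        2 * c * waveLen k ^ 2 * gw α σ k ^ 2 * ‖fourierCoef (u t) k‖ ^ 2 := by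
      gcongr
      nlinarith
    linarith
  calc _ ≤ torusVol * ∑ k ∈ ballModes N, (2 * (c - 1) * (gw (α + 1 / 2) σ k ^ 2 * ‖fourierCoef (u t) k‖ ^ 2)
        - 2 * (gw α σ k ^ 2 * inner ℝ (fourierCoef (u t) k) (fourierCoef (B (u t) (u t)) k))) :=
        mul_le_mul_of_nonneg_left (Finset.sum_le_sum hterm) hT.le
    _ = 2 * (c - 1) * D ^ 2 + 2 * (-(torusVol * ∑ k ∈ ballModes N, gw α σ k ^ 2 *
      inner ℝ (fourierCoef (u t) k) (fourierCoef (B (u t) (u t)) k))) := by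
        rw [Finset.sum_sub_distrib, ← Finset.mul_sum, ← Finset.mul_sum, hD]
        ring
    _ ≤ 2 * (c - 1) * D ^ 2 + 2 * (K ^ α * Y * D ^ 2) := by gcongr
    _ = _ := by ring

lemma IsGalerkin.gevreyNorm_initial_le {N T : ℝ} {u₀ : L2} {u : ℝ → L2} (hu : IsGalerkin N T u₀ u)
    {α : ℝ} (hu₀ : u₀ ∈ gevrey α 0) : gevreyNorm α 0 (u 0) ≤ gevreyNorm α 0 u₀ := by
  refine norm_le_gevreyNorm_of_coef hu₀ fun k => ?_
  rw [fourierCoef_gevrey (hu.mem_gevrey 0 α 0), hu.initial, norm_smul, norm_smul, Complex.norm_real,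
    Real.norm_of_nonneg (gw_nonneg _ _ _), Real.norm_of_nonneg (cutoff_nonneg _ _)]
  have := gw_nonneg α 0 k
  gcongr
  exact mul_le_of_le_one_left (norm_nonneg _) (cutoff_le_one N k)

/-- The squared norm is compared with the barrier `(e^{-(1-δ)t} r)²`. Where they touch, the norm is
at most `r < δ/(2K^α)`, so the coefficient in the differential inequality is at most `2(3δ/4 - 1)`.
This is strictly below the barrier's rate `-2(1-δ)`, so no crossing is possible and no continuation
argument is needed. -/
lemma IsGalerkin.gevreyNorm_le {N T : ℝ} {u₀ : L2} {u : ℝ → L2} (hu : IsGalerkin N T u₀ u)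
    {K : ℝ} (hK1 : 1 ≤ K) (hK : IsBilinearConst K) {α δ : ℝ} (hα : 1 / 2 ≤ α) (hδ : 0 < δ)
    (hδ1 : δ < 1) (hu₀ : u₀ ∈ gevrey α 0) (hn : gevreyNorm α 0 u₀ < δ / (2 * K ^ α)) {t : ℝ}
    (h0 : 0 ≤ t) (h1 : t < T) :
    gevreyNorm α (δ / 4 * t) (u t) ≤ Real.exp (-(1 - δ) * t) * gevreyNorm α 0 u₀ := by
  have hKα : 0 < K ^ α := by positivity
  have key : ∀ r, 0 < r → gevreyNorm α 0 u₀ ≤ r → r < δ / (2 * K ^ α) →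
      gevreyNorm α (δ / 4 * t) (u t) ≤ Real.exp (-(1 - δ) * t) * r := by
    intro r hr hur hrδ
    have hd := fun s (hs : s ∈ Set.Icc 0 t) =>
      hu.hasDerivAt_gevreyNorm_sq hK hα (c := δ / 4) (by positivity) hs.1 (hs.2.trans_lt h1)
    choose! y' hy' hyle using hd
    have hBd : ∀ s : ℝ, HasDerivAt (fun s => (Real.exp (-(1 - δ) * s) * r) ^ 2)
        (-2 * (1 - δ) * (Real.exp (-(1 - δ) * s) * r) ^ 2) s := by
      intro s
      have h := (((((hasDerivAt_id s).const_mul (-(1 - δ))).exp).mul_const r).pow 2)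
      refine h.congr_deriv ?_
      simp only [id, Nat.cast_ofNat]
      ring
    have hle := image_le_of_deriv_right_lt_deriv_boundary
      (f := fun s => gevreyNorm α (δ / 4 * s) (u s) ^ 2) (f' := y') (a := 0) (b := t)
      (B := fun s => (Real.exp (-(1 - δ) * s) * r) ^ 2)
      (fun s hs => (hy' s hs).continuousAt.continuousWithinAt)
      (fun s hs => (hy' s ⟨hs.1, hs.2.le⟩).hasDerivWithinAt) (by
        simp only [mul_zero, Real.exp_zero, one_mul]
        exact pow_le_pow_left₀ (gevreyNorm_nonneg _ _ _)
          ((hu.gevreyNorm_initial_le hu₀).trans hur) 2) hBd (by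
        intro s hs heq
        have hyl := hyle s ⟨hs.1, hs.2.le⟩
        set Y := gevreyNorm α (δ / 4 * s) (u s)
        set D := gevreyNorm (α + 1 / 2) (δ / 4 * s) (u s)
        have hYD : Y ≤ D := (gevrey_anti (by linarith) le_rfl (hu.mem_gevrey s _ _)).2
        have hY0 : 0 ≤ Y := gevreyNorm_nonneg _ _ _
        have hYeq : Y = Real.exp (-(1 - δ) * s) * r :=
          (pow_left_inj₀ hY0 (by positivity) two_ne_zero).1 heq
        have hYpos : 0 < Y := by rw [hYeq]; positivity
        have hYr : Y ≤ r := by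
          rw [hYeq]
          refine mul_le_of_le_one_left hr.le (Real.exp_le_one_iff.2 ?_)
          nlinarith [hs.1]
        have hKY : K ^ α * Y ≤ δ / 2 := by
          calc K ^ α * Y ≤ K ^ α * (δ / (2 * K ^ α)) := by gcongr; exact hYr.trans hrδ.le
            _ = δ / 2 := by field_simp
        rw [← hYeq]
        have hD2 : Y ^ 2 ≤ D ^ 2 := by gcongr
        have hY2 : 0 < Y ^ 2 := by positivity
        nlinarith) ⟨h0, le_rfl⟩
    exact (sq_le_sq₀ (gevreyNorm_nonneg _ _ _) (by positivity)).1 hle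
  rcases (gevreyNorm_nonneg α 0 u₀).eq_or_lt with hz | hpos
  -- Strictness at a contact point requires a positive barrier, so vanishing data are treated with
  -- arbitrarily small `r`.
  · rw [← hz, mul_zero]
    refine le_of_forall_pos_le_add fun ε hε => ?_
    set r := min ε (δ / (2 * K ^ α) / 2) with hr
    have hδK : 0 < δ / (2 * K ^ α) := by positivity
    have hr0 : 0 < r := by positivity
    have h2 := key r hr0 (by rw [← hz]; exact hr0.le)
      ((min_le_right _ _).trans_lt (half_lt_self hδK))
    have h3 : Real.exp (-(1 - δ) * t) ≤ 1 := Real.exp_le_one_iff.2 (by nlinarith)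
    have h4 : r ≤ ε := min_le_left _ _
    nlinarith
  · exact key _ hpos le_rfl hn

/-! ### The Cauchy property of the Galerkin solutions. -/

/-- A Gronwall inequality for curves in a Hilbert space. -/
lemma norm_sq_le_of_inner_deriv_le {E : Type*} [NormedAddCommGroup E] [InnerProductSpace ℝ E]
    {f f' : ℝ → E} {C ε t : ℝ} (h0 : 0 ≤ t) (hcont : ContinuousOn f (Set.Icc 0 t))
    (hd : ∀ s ∈ Set.Ioo 0 t, HasDerivAt f (f' s) s)
    (hle : ∀ s ∈ Set.Ioo 0 t, inner ℝ (f s) (f' s) ≤ C * (‖f s‖ ^ 2 + ε)) :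
    ‖f t‖ ^ 2 + ε ≤ (‖f 0‖ ^ 2 + ε) * Real.exp (2 * C * t) := by
  have hder : ∀ s ∈ Set.Ioo 0 t, HasDerivAt (fun s => (‖f s‖ ^ 2 + ε) * Real.exp (-(2 * C) * s))
      (2 * inner ℝ (f s) (f' s) * Real.exp (-(2 * C) * s)
        + (‖f s‖ ^ 2 + ε) * (Real.exp (-(2 * C) * s) * (-(2 * C)))) s := by
    intro s hs
    have h1 := ((hd s hs).norm_sq).add_const ε
    have h2 : HasDerivAt (fun s => -(2 * C) * s) (-(2 * C)) s := by
      simpa using (hasDerivAt_id s).const_mul (-(2 * C))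
    exact h1.mul h2.exp
  have hanti : AntitoneOn (fun s => (‖f s‖ ^ 2 + ε) * Real.exp (-(2 * C) * s)) (Set.Icc 0 t) := by
    refine antitoneOn_of_deriv_nonpos (convex_Icc 0 t) ?_ ?_ ?_
    · exact ((hcont.norm.pow 2).add continuousOn_const).mul (by fun_prop)
    · intro s hs
      rw [interior_Icc] at hs
      exact (hder s hs).differentiableAt.differentiableWithinAt
    · intro s hs
      rw [interior_Icc] at hs
      rw [(hder s hs).deriv]
      have h1 := hle s hs
      have h2 := Real.exp_pos (-(2 * C) * s)
      nlinarith
  have h := hanti ⟨le_rfl, h0⟩ ⟨h0, le_rfl⟩ h0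
  simp only [mul_zero, Real.exp_zero, mul_one] at h
  have e : Real.exp (-(2 * C) * t) * Real.exp (2 * C * t) = 1 := by
    rw [← Real.exp_add]
    simp
  calc ‖f t‖ ^ 2 + ε = (‖f t‖ ^ 2 + ε) * Real.exp (-(2 * C) * t) * Real.exp (2 * C * t) := by
        rw [mul_assoc, e, mul_one]
    _ ≤ _ := by gcongr

/-- The difference lives on `|k| > M`, where `(|k|/M)^{1/4} ≥ 1`. The quarter power left over in the
trilinear estimate thus buys the small factor `M^{-1/4}`. -/
lemma abs_cutoff_sub_le {M N : ℝ} (hM : 0 < M) (hMN : M ≤ N) (k : K3) :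
    |cutoff N k - cutoff M k| ≤ M ^ (-(1 / 4) : ℝ) * waveLen k ^ (1 / 4 : ℝ) := by
  have hk := waveLen_nonneg k
  rcases le_or_gt (waveLen k) M with h | h
  · rw [cutoff_of_le h, cutoff_of_le (h.trans hMN)]
    simp only [sub_self, abs_zero]
    positivity
  · rw [cutoff_of_lt h, sub_zero, abs_of_nonneg (cutoff_nonneg _ _)]
    refine (cutoff_le_one _ _).trans ?_
    rw [Real.rpow_neg hM.le, ← div_eq_inv_mul, one_le_div (by positivity)]
    gcongr

/-- Galerkin solutions form a Cauchy family. -/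
lemma exists_galerkin_sub_le (R : ℝ) (hR : 0 ≤ R) : ∃ C : ℝ, ∀ (u₀ : L2) (M N T T' : ℝ)
    (u v : ℝ → L2), 0 < M → M ≤ N → u₀ ∈ gevrey (1 / 2) 0 → gevreyNorm (1 / 2) 0 u₀ ≤ R →
    IsGalerkin N T u₀ u → IsGalerkin M T' u₀ v →
    ∀ t, 0 ≤ t → t < T → t < T' → (∀ s, 0 ≤ s → s ≤ t → gevreyNorm (1 / 2) 0 (u s) ≤ R) →
    (∀ s, 0 ≤ s → s ≤ t → gevreyNorm (1 / 2) 0 (v s) ≤ R) →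
    ‖u t - v t‖ ^ 2 ≤ ((M ^ (-(1 / 4) : ℝ) * R) ^ 2 + M ^ (-(1 / 4) : ℝ)) * Real.exp (2 * C * t) := by
  obtain ⟨C, hC0, hC⟩ := exists_inner_difference_le R hR
  refine ⟨C, fun u₀ M N T T' u v hM hMN hu₀ hu₀R hu hv t h0 hT hT' hbu hbv => ?_⟩
  set ε := M ^ (-(1 / 4) : ℝ) with hε
  have hε0 : 0 ≤ ε := by positivity
  have hdu : ∀ s ∈ Set.Icc 0 t, ∃ g, HasDerivAt u g s ∧ ∀ k, fourierCoef g k =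
    -(waveLen k ^ 2 • fourierCoef (u s) k)
      - cutoff N k • bCoef (fourierCoef (u s)) (fourierCoef (u s)) k :=
    fun s hs => hu.deriv s hs.1 (hs.2.trans_lt hT)
  have hdv : ∀ s ∈ Set.Icc 0 t, ∃ g, HasDerivAt v g s ∧ ∀ k, fourierCoef g k =
    -(waveLen k ^ 2 • fourierCoef (v s) k)
      - cutoff M k • bCoef (fourierCoef (v s)) (fourierCoef (v s)) k :=
    fun s hs => hv.deriv s hs.1 (hs.2.trans_lt hT')
  choose! gu hgu hguk using hdu
  choose! gv hgv hgvk using hdv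
  have key := norm_sq_le_of_inner_deriv_le (f := fun s => u s - v s) (f' := fun s => gu s - gv s)
    (C := C) (ε := ε) h0
    (fun s hs => ((hgu s hs).sub (hgv s hs)).continuousAt.continuousWithinAt)
    (fun s hs => (hgu s ⟨hs.1.le, hs.2.le⟩).sub (hgv s ⟨hs.1.le, hs.2.le⟩)) (fun s hs => by
      have hs' : s ∈ Set.Icc 0 t := ⟨hs.1.le, hs.2.le⟩
      refine hC (u s) (hu.mem_gevrey _ _ _) (v s) (hv.mem_gevrey _ _ _) (hbu s hs'.1 hs'.2)
        (hbv s hs'.1 hs'.2) _ (cutoff N) (fun k => cutoff N k - cutoff M k) ε hε0 (fun k => ?_)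
        (abs_cutoff_sub_le hM hMN) (fun k => ?_)
      · rw [abs_of_nonneg (cutoff_nonneg _ _)]
        exact cutoff_le_one _ _
      · rw [fourierCoef_sub, fourierCoef_sub, hguk s hs', hgvk s hs']
        module)
  -- The initial data differ only by truncation of `u₀`; here `|k|^{1/4} ≤ |k|` and the `V` bound on
  -- `u₀` suffice.
  have hw0 : ‖u 0 - v 0‖ ≤ ε * R := by
    have h := gevreyNorm_V_sq hu₀
    refine le_trans ?_ (mul_le_mul_of_nonneg_left hu₀R hε0)
    rw [← sq_le_sq₀ (norm_nonneg _) (by have := gevreyNorm_nonneg (1 / 2) 0 u₀; positivity), mul_pow,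
      h, norm_sq_eq, mul_left_comm (ε ^ 2), ← tsum_mul_left (a := ε ^ 2)]
    refine mul_le_mul_of_nonneg_left ((summable_norm_sq _).tsum_le_tsum (fun k => ?_)
      ((summable_V hu₀).mul_left _)) torusVol_pos.le
    rw [fourierCoef_sub, hu.initial, hv.initial, ← sub_smul, norm_smul, ← mul_pow, ← mul_assoc]
    by_cases hk : k = 0
    · simp [hk, coef_zero_of_mem_H hu₀.1]
    gcongr
    refine (abs_cutoff_sub_le hM hMN k).trans ?_
    gcongr
    conv_rhs => rw [← Real.rpow_one (waveLen k)]
    exact Real.rpow_le_rpow_of_exponent_le (one_le_waveLen hk) (by norm_num)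
  have h2 : ‖u 0 - v 0‖ ^ 2 ≤ (ε * R) ^ 2 := by gcongr
  calc ‖u t - v t‖ ^ 2 ≤ ‖u t - v t‖ ^ 2 + ε := by linarith
    _ ≤ (‖u 0 - v 0‖ ^ 2 + ε) * Real.exp (2 * C * t) := key
    _ ≤ _ := by gcongr

/-! ### Limits in Gevrey classes and comparison of weights. -/

/-- Closedness of balls of Gevrey classes under `L²` limits. -/
lemma gevrey_of_tendsto {ι : Type*} {l : Filter ι} [l.NeBot] {f : ι → L2} {g : L2}
    (hf : Tendsto f l (𝓝 g)) {α σ C : ℝ} (hC : 0 ≤ C)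
    (hb : ∀ᶠ i in l, f i ∈ gevrey α σ ∧ gevreyNorm α σ (f i) ≤ C) :
    g ∈ gevrey α σ ∧ gevreyNorm α σ g ≤ C := by
  have hgH : g ∈ H := (Submodule.isClosed_topologicalClosure _).mem_of_tendsto hf
    (hb.mono fun i hi => hi.1.1)
  have hT := torusVol_pos
  have hsum : ∀ s : Finset K3, ∑ k ∈ s, gw α σ k ^ 2 * ‖fourierCoef g k‖ ^ 2 ≤ C ^ 2 / torusVol := by
    intro s
    have hlim : Tendsto (fun i => ∑ k ∈ s, gw α σ k ^ 2 * ‖fourierCoef (f i) k‖ ^ 2) l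
        (𝓝 (∑ k ∈ s, gw α σ k ^ 2 * ‖fourierCoef g k‖ ^ 2)) :=
      tendsto_finsetSum _ fun k _ =>
        ((((fourierCLM k).continuous.tendsto g).comp hf).norm.pow 2).const_mul _
    refine le_of_tendsto hlim (hb.mono fun i hi => ?_)
    rw [le_div_iff₀ hT, mul_comm]
    refine le_trans ?_ (pow_le_pow_left₀ (gevreyNorm_nonneg _ _ _) hi.2 2)
    rw [gevreyNorm_sq hi.1]
    exact mul_le_mul_of_nonneg_left ((mem_gevrey_iff.1 hi.1).2.sum_le_tsum s
      fun k _ => by positivity) hT.le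
  have hs := summable_of_sum_le (fun k => by positivity) hsum
  have hmem : g ∈ gevrey α σ := mem_gevrey_iff.2 ⟨hgH, hs⟩
  refine ⟨hmem, ?_⟩
  rw [← sq_le_sq₀ (gevreyNorm_nonneg _ _ _) hC, gevreyNorm_sq hmem]
  have := hs.tsum_le_of_sum_le hsum
  rw [le_div_iff₀ hT] at this
  linarith

/-- Weak convergence together with a bound by the norm of the limit gives strong convergence. -/
lemma tendsto_of_fourierCoef_of_norm_le {ι : Type*} {l : Filter ι} {f : ι → L2} {g : L2}
    (hf : ∀ k, Tendsto (fun i => fourierCoef (f i) k) l (𝓝 (fourierCoef g k)))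
    (hb : ∀ᶠ i in l, ‖f i‖ ≤ ‖g‖) : Tendsto f l (𝓝 g) := by
  choose w hw using fun N : ℕ => exists_truncation g N
  have hwlim : Tendsto w atTop (𝓝 g) := by
    refine tendsto_of_fourierCoef (summable_norm_sq g) (fun k => ?_)
      (Eventually.of_forall fun N k => ?_)
    · apply tendsto_const_nhds.congr'
      filter_upwards [eventually_ge_atTop ⌈waveLen k⌉₊] with N hN
      rw [hw, cutoff_of_le (Nat.ceil_le.1 hN)]
      simp
    · rw [hw]
      unfold cutoff
      split_ifs <;> simp
  have hweak : ∀ N, Tendsto (fun i => inner ℝ (f i) (w N)) l (𝓝 (inner ℝ g (w N))) := by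
    intro N
    have e : ∀ h : L2, inner ℝ h (w N) = ∑ k ∈ (finite_waveLen_le N).toFinset,
        torusVol * inner ℝ (fourierCoef h k) (fourierCoef (w N) k) := by
      intro h
      rw [← (hasSum_inner h (w N)).tsum_eq]
      refine tsum_eq_sum fun k hk => ?_
      have hk' : (N : ℝ) < waveLen k := by simpa using hk
      simp [hw, cutoff_of_lt hk']
    simp_rw [e]
    exact tendsto_finsetSum _ fun k _ => ((hf k).inner tendsto_const_nhds).const_mul _
  rw [Metric.tendsto_nhds]
  intro ε hε
  have hN : ∀ᶠ N in atTop, 4 * ‖g‖ * ‖w N - g‖ < ε ^ 2 := by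
    have h1 : Tendsto (fun N => 4 * ‖g‖ * ‖w N - g‖) atTop (𝓝 (4 * ‖g‖ * 0)) :=
      (tendsto_iff_norm_sub_tendsto_zero.1 hwlim).const_mul _
    rw [mul_zero] at h1
    exact h1.eventually_lt_const (by positivity)
  obtain ⟨N, hN⟩ := hN.exists
  -- The norm bound gives `‖f i - g‖² ≤ 2‖g‖² - 2⟨f i, g⟩`. Replacing `g` by its truncation in the
  -- inner product costs `2‖g‖‖w N - g‖` before the limit and as much again after it, which is the
  -- `4` in `hN`.
  have h2 : Tendsto (fun i => 2 * ‖g‖ ^ 2 - 2 * inner ℝ (f i) (w N) + 2 * (‖g‖ * ‖w N - g‖)) l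
      (𝓝 (2 * ‖g‖ ^ 2 - 2 * inner ℝ g (w N) + 2 * (‖g‖ * ‖w N - g‖))) :=
    (tendsto_const_nhds.sub ((hweak N).const_mul 2)).add_const _
  have hgw : ∀ h : L2, ‖h‖ ≤ ‖g‖ → -(‖g‖ * ‖w N - g‖) ≤ inner ℝ h g - inner ℝ h (w N) := by
    intro h hh
    rw [← inner_sub_right, ← neg_sub (w N) g, inner_neg_right, neg_le_neg_iff]
    exact (real_inner_le_norm _ _).trans (by gcongr)
  have hlt : 2 * ‖g‖ ^ 2 - 2 * inner ℝ g (w N) + 2 * (‖g‖ * ‖w N - g‖) < ε ^ 2 := by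
    have h3 : ‖g‖ ^ 2 - inner ℝ g (w N) ≤ ‖g‖ * ‖w N - g‖ := by
      rw [← real_inner_self_eq_norm_sq, ← inner_sub_right, norm_sub_rev]
      exact real_inner_le_norm _ _
    linarith
  filter_upwards [hb, h2.eventually_lt_const hlt] with i hi hi2
  rw [dist_eq_norm, ← sq_lt_sq₀ (norm_nonneg _) hε.le, norm_sub_sq_real]
  have h4 := hgw (f i) hi
  have h5 : ‖f i‖ ^ 2 ≤ ‖g‖ ^ 2 := by gcongr
  linarith

/-- A single term of the exponential series, of degree at least `|p|`, already dominates. -/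
lemma exists_rpow_le_exp (p : ℝ) {c : ℝ} (hc : 0 < c) :
    ∃ C : ℝ, 0 < C ∧ ∀ x : ℝ, 1 ≤ x → x ^ p ≤ C * Real.exp (c * x) := by
  set n := ⌈|p|⌉₊ with hn
  refine ⟨n.factorial / c ^ n, by positivity, fun x hx => ?_⟩
  have hx0 : 0 < x := by linarith
  have h1 : x ^ p ≤ x ^ n := by
    rw [← Real.rpow_natCast]
    exact Real.rpow_le_rpow_of_exponent_le hx ((le_abs_self p).trans (Nat.le_ceil _))
  have h2 := Real.pow_div_factorial_le_exp (c * x) (by positivity) n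
  rw [div_le_iff₀ (by positivity), mul_pow] at h2
  refine h1.trans ?_
  rw [div_mul_eq_mul_div, le_div_iff₀ (by positivity)]
  linarith

lemma exists_gw_le (α α' : ℝ) {σ σ' : ℝ} (h : σ' < σ) :
    ∃ C : ℝ, 0 < C ∧ ∀ k : K3, k ≠ 0 → gw α' σ' k ≤ C * gw α σ k := by
  obtain ⟨C, hC, hle⟩ := exists_rpow_le_exp (2 * (α' - α)) (sub_pos.2 h)
  refine ⟨C, hC, fun k hk => ?_⟩
  have h0 := waveLen_pos hk
  have h1 := hle _ (one_le_waveLen hk)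
  unfold gw
  calc waveLen k ^ (2 * α') * Real.exp (σ' * waveLen k)
      = waveLen k ^ (2 * (α' - α)) * (waveLen k ^ (2 * α) * Real.exp (σ' * waveLen k)) := by
        rw [← mul_assoc, ← Real.rpow_add h0]
        ring_nf
    _ ≤ C * Real.exp ((σ - σ') * waveLen k) * (waveLen k ^ (2 * α) * Real.exp (σ' * waveLen k)) := by
        gcongr
    _ = C * (waveLen k ^ (2 * α) * (Real.exp ((σ - σ') * waveLen k) * Real.exp (σ' * waveLen k))) := by
        ring
    _ = _ := by
        rw [← Real.exp_add]
        ring_nf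

/-- Positive analyticity radius dominates any number of derivatives. -/
lemma exists_gevrey_le (α α' : ℝ) {σ σ' : ℝ} (h : σ' < σ) :
    ∃ C : ℝ, 0 < C ∧ ∀ u ∈ gevrey α σ, u ∈ gevrey α' σ' ∧ gevreyNorm α' σ' u ≤ C * gevreyNorm α σ u := by
  obtain ⟨C, hC, hle⟩ := exists_gw_le α α' h
  refine ⟨C, hC, fun u hu => ?_⟩
  have := gevrey_mono hle hu
  rwa [abs_of_pos hC] at this

lemma gw_mul_norm_fourierCoef_le {α σ : ℝ} {u : L2} (hu : u ∈ gevrey α σ) (k : K3) :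
    gw α σ k * ‖fourierCoef u k‖ ≤ gevreyNorm α σ u := by
  have h := norm_fourierCoef_le (multiplier (gevreySymbol α σ) u) k
  rwa [fourierCoef_gevrey hu, norm_smul, Complex.norm_real, Real.norm_of_nonneg (gw_nonneg _ _ _)] at h

lemma norm_fourierCoef_le_exp {σ : ℝ} {u : L2} (hu : u ∈ gevrey 0 σ) (k : K3) :
    ‖fourierCoef u k‖ ≤ gevreyNorm 0 σ u * Real.exp (-σ * waveLen k) := by
  have h := gw_mul_norm_fourierCoef_le hu k
  rw [gw, mul_zero, Real.rpow_zero, one_mul] at h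
  rw [neg_mul, Real.exp_neg, ← div_eq_mul_inv, le_div_iff₀ (Real.exp_pos _)]
  linarith

lemma summable_exp_waveLen {σ : ℝ} (hσ : 0 < σ) :
    Summable fun k : K3 => Real.exp (-σ * waveLen k) := by
  obtain ⟨C, hC, hle⟩ := exists_rpow_le_exp 4 hσ
  have hs := (summable_waveLen_rpow (r := -4) (by norm_num)).mul_left C
  refine Summable.of_norm_bounded_eventually hs ?_
  have : {k : K3 | ¬ ‖Real.exp (-σ * waveLen k)‖ ≤ C * waveLen k ^ (-4 : ℝ)} ⊆ {0} := by
    intro k hk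
    by_contra h0
    apply hk
    have hp := waveLen_pos h0
    have h1 := hle _ (one_le_waveLen h0)
    rw [Real.norm_of_nonneg (Real.exp_pos _).le, neg_mul, Real.exp_neg, Real.rpow_neg hp.le,
      ← div_eq_mul_inv, le_div_iff₀ (by positivity), inv_mul_le_iff₀ (Real.exp_pos _)]
    linarith
  exact (Set.finite_singleton 0).subset this

/-! ### Passing to the limit in the Galerkin system. -/

/-- The Fourier coefficients of `-A u - B(u, u)`. -/
def nsCoef (u : L2) (k : K3) : C3 :=
  -(waveLen k ^ 2 • fourierCoef u k) - bCoef (fourierCoef u) (fourierCoef u) k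

/-- The Lipschitz constant grows with `|k|`, which is harmless because the limit is taken one mode
at a time. It turns uniform `L²` convergence of the solutions into uniform convergence of the
derivative of each mode. -/
lemma norm_nsCoef_sub_le {u v : L2} (hu : u ∈ gevrey (1 / 2) 0) (hv : v ∈ gevrey (1 / 2) 0) {R : ℝ}
    (hRu : gevreyNorm (1 / 2) 0 u ≤ R) (hRv : gevreyNorm (1 / 2) 0 v ≤ R) (k : K3) :
    ‖nsCoef u k - nsCoef v k‖ ≤ (waveLen k ^ 2 + (2 + waveLen k) * R) * ‖u - v‖ := by
  have h1 := norm_bCoef_sub_le hu hv hRu hRv k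
  have h2 := norm_fourierCoef_le (u - v) k
  have e : nsCoef u k - nsCoef v k = -(waveLen k ^ 2 • fourierCoef (u - v) k)
      - (bCoef (fourierCoef u) (fourierCoef u) k - bCoef (fourierCoef v) (fourierCoef v) k) := by
    rw [nsCoef, nsCoef, fourierCoef_sub]
    module
  rw [e, add_mul]
  refine (norm_sub_le _ _).trans (add_le_add ?_ h1)
  rw [norm_neg, norm_smul, Real.norm_of_nonneg (sq_nonneg _)]
  gcongr

lemma fourierCoef_stokes {u : L2} (hu : u ∈ gevrey 1 0) (k : K3) :
    fourierCoef (stokes u) k = waveLen k ^ 2 • fourierCoef u k := by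
  rw [stokes, fourierCoef_gevrey hu, gw_one]
  exact RCLike.real_smul_eq_coe_smul (K := ℂ) _ _ |>.symm

lemma fourierCoef_neg_stokes_sub_B {u : L2} (hu : u ∈ gevrey 1 0) (k : K3) :
    fourierCoef (-stokes u - B u u) k = nsCoef u k := by
  rw [fourierCoef_sub, fourierCoef_neg, fourierCoef_stokes hu,
    fourierCoef_B hu (gevrey_anti (by norm_num) le_rfl hu).1, nsCoef]

/-- The Galerkin solutions converge on `[0, ∞)`, uniformly on bounded intervals. -/
lemma exists_limit_of_galerkin {u₀ : L2} (hu₀ : u₀ ∈ gevrey (1 / 2) 0) {R : ℝ} (hR : 0 ≤ R)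
    (hR₀ : gevreyNorm (1 / 2) 0 u₀ ≤ R) {v : ℕ → ℝ → L2}
    (hv : ∀ n : ℕ, IsGalerkin (n + 1) (n + 1) u₀ (v n))
    (hvR : ∀ (n : ℕ) (t : ℝ), 0 ≤ t → t < n + 1 → gevreyNorm (1 / 2) 0 (v n t) ≤ R) :
    ∃ u : ℝ → L2, ∀ T, TendstoUniformlyOn v u atTop (Set.Icc 0 T) := by
  obtain ⟨C, hC⟩ := exists_galerkin_sub_le R hR
  have hcauchy : ∀ T, UniformCauchySeqOn v atTop (Set.Icc 0 T) := by
    intro T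
    have hE : Tendsto (fun n : ℕ => ((((n : ℝ) + 1) ^ (-(1 / 4) : ℝ) * R) ^ 2
        + ((n : ℝ) + 1) ^ (-(1 / 4) : ℝ)) * Real.exp (2 * |C| * T)) atTop (𝓝 0) := by
      have h1 : Tendsto (fun n : ℕ => ((n : ℝ) + 1) ^ (-(1 / 4) : ℝ)) atTop (𝓝 0) :=
        (tendsto_rpow_neg_atTop (by norm_num)).comp
          (tendsto_atTop_add_const_right _ _ tendsto_natCast_atTop_atTop)
      simpa using ((((h1.mul_const R).pow 2).add h1).mul_const (Real.exp (2 * |C| * T)))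
    rw [Metric.uniformCauchySeqOn_iff]
    intro ε hε
    obtain ⟨m, hm, hmT⟩ := ((hE.eventually_lt_const (u := (ε / 2) ^ 2) (by positivity)).and
      (eventually_ge_atTop ⌈T⌉₊)).exists
    have hTm : T < m + 1 := (Nat.ceil_le.1 hmT).trans_lt (by linarith)
    -- The difference estimate depends only on the smaller cut-off, so all later solutions are
    -- compared with the single one of index `m`.
    have key : ∀ n ≥ m, ∀ t ∈ Set.Icc 0 T, ‖v n t - v m t‖ < ε / 2 := by
      intro n hn t ht
      have hmn : (m : ℝ) ≤ n := by exact_mod_cast hn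
      rw [← sq_lt_sq₀ (norm_nonneg _) (by positivity)]
      refine (hC u₀ (m + 1) (n + 1) (n + 1) (m + 1) (v n) (v m) (by positivity) (by linarith) hu₀ hR₀
        (hv n) (hv m) t ht.1 (by linarith [ht.2]) (by linarith [ht.2])
        (fun s h0 hs => hvR n s h0 (by linarith [ht.2]))
        (fun s h0 hs => hvR m s h0 (by linarith [ht.2]))).trans_lt (lt_of_le_of_lt ?_ hm)
      gcongr _ * Real.exp ?_
      have := mul_le_mul (le_abs_self C) ht.2 ht.1 (abs_nonneg C)
      linarith
    refine ⟨m, fun n hn n' hn' t ht => ?_⟩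
    have h1 := key n hn t ht
    have h2 := key n' hn' t ht
    calc dist (v n t) (v n' t) ≤ dist (v n t) (v m t) + dist (v n' t) (v m t) :=
          dist_triangle_right _ _ _
      _ < ε := by
          rw [dist_eq_norm, dist_eq_norm]
          linarith
  -- The curve must be defined on all of `ℝ`; negative times receive the irrelevant value `0`.
  have hlim : ∀ t, ∃ x, 0 ≤ t → Tendsto (fun n => v n t) atTop (𝓝 x) := by
    intro t
    by_cases ht : 0 ≤ t
    · obtain ⟨x, hx⟩ := cauchySeq_tendsto_of_complete ((hcauchy t).cauchySeq ⟨ht, le_rfl⟩)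
      exact ⟨x, fun _ => hx⟩
    · exact ⟨0, fun h => absurd h ht⟩
  choose u hu using hlim
  exact ⟨u, fun T => (hcauchy T).tendstoUniformlyOn_of_tendsto fun t ht => hu t ht.1⟩

/-- The equation passes to the limit, mode by mode. -/
lemma hasDerivAt_fourierCoef_of_galerkin {u₀ : L2} {R : ℝ} (hR : 0 ≤ R) {v : ℕ → ℝ → L2}
    (hv : ∀ n : ℕ, IsGalerkin (n + 1) (n + 1) u₀ (v n))
    (hvR : ∀ (n : ℕ) (t : ℝ), 0 ≤ t → t < n + 1 → gevreyNorm (1 / 2) 0 (v n t) ≤ R)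
    {u : ℝ → L2} (hu : ∀ T, TendstoUniformlyOn v u atTop (Set.Icc 0 T))
    (huR : ∀ t, 0 ≤ t → u t ∈ gevrey (1 / 2) 0 ∧ gevreyNorm (1 / 2) 0 (u t) ≤ R)
    {t : ℝ} (ht : 0 < t) (k : K3) :
    HasDerivAt (fun s => fourierCoef (u s) k) (nsCoef (u t) k) t := by
  set L := waveLen k ^ 2 + (2 + waveLen k) * R with hL
  have hk := waveLen_nonneg k
  have hL0 : 0 ≤ L := by positivity
  have hT := hu (2 * t)
  refine hasDerivAt_of_tendstoUniformlyOn (l := atTop) (s := Set.Ioo 0 (2 * t))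
    (f := fun n s => fourierCoef (v n s) k) (f' := fun n s => nsCoef (v n s) k)
    (g' := fun s => nsCoef (u s) k) isOpen_Ioo ?_ ?_ (fun s hs => ?_) ⟨ht, by linarith⟩
  · rw [Metric.tendstoUniformlyOn_iff] at hT ⊢
    intro ε hε
    filter_upwards [hT (ε / (L + 1)) (by positivity), eventually_ge_atTop ⌈2 * t⌉₊] with n hn hnt s hs
    have hs' : s ∈ Set.Icc 0 (2 * t) := ⟨hs.1.le, hs.2.le⟩
    have h1 := hn s hs'
    have h2 := norm_nsCoef_sub_le (huR s hs'.1).1 ((hv n).mem_gevrey s _ _) (huR s hs'.1).2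
      (hvR n s hs'.1 (by have := Nat.ceil_le.1 hnt; linarith [hs.2])) k
    rw [dist_eq_norm, lt_div_iff₀ (by positivity)] at h1
    rw [dist_eq_norm]
    refine h2.trans_lt (lt_of_le_of_lt ?_ h1)
    rw [mul_comm]
    exact mul_le_mul_of_nonneg_left (le_add_of_nonneg_right zero_le_one) (norm_nonneg _)
  · filter_upwards [eventually_ge_atTop ⌈2 * t⌉₊, eventually_ge_atTop ⌈waveLen k⌉₊] with n hnt hnk s hs
    have h1 := Nat.ceil_le.1 hnt
    have h2 := Nat.ceil_le.1 hnk
    obtain ⟨g, hg, hgk⟩ := (hv n).deriv s hs.1.le (by linarith [hs.2])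
    have h3 := hgk k
    rw [cutoff_of_le (by linarith), one_smul] at h3
    rw [nsCoef, ← h3]
    exact (fourierCLM k).hasFDerivAt.comp_hasDerivAt s hg
  · exact ((fourierCLM k).continuous.tendsto _).comp (hT.tendsto_at ⟨hs.1.le, hs.2.le⟩)

/-- Global curves solving the equation mode by mode, with the decay of the Gevrey norms. -/
lemma exists_gevrey_curve {K : ℝ} (hK1 : 1 ≤ K) (hK : IsBilinearConst K) {α δ : ℝ} (hα : 1 / 2 ≤ α)
    (hδ : 0 < δ) (hδ1 : δ < 1) {u₀ : L2} (hu₀ : u₀ ∈ gevrey α 0)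
    (hn : gevreyNorm α 0 u₀ < δ / (2 * K ^ α)) :
    ∃ u : ℝ → L2, u 0 = u₀ ∧ ContinuousOn u (Set.Ici 0) ∧
      (∀ t, 0 ≤ t → u t ∈ gevrey α (δ / 4 * t) ∧
        gevreyNorm α (δ / 4 * t) (u t) ≤ Real.exp (-(1 - δ) * t) * gevreyNorm α 0 u₀) ∧
      ∀ t, 0 < t → ∀ k, HasDerivAt (fun s => fourierCoef (u s) k) (nsCoef (u t) k) t := by
  have hKα : 0 < K ^ α := Real.rpow_pos_of_pos (by linarith) _
  -- `n + 1` is both cut-off and lifespan, so one limit removes the truncation and exhausts `[0,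
  -- ∞)`. The invariant ball has `K^α R = δ/2 ≤ 1`.
  have hg : ∀ n : ℕ, ∃ v, IsGalerkin (n + 1) (n + 1) u₀ v := fun n =>
    exists_galerkin hK hα (R := δ / (2 * K ^ α)) (by positivity)
      (by rw [mul_div_assoc', div_le_one (by positivity)]; nlinarith) hu₀ hn.le _ (by positivity)
  choose v hv using hg
  set R := gevreyNorm α 0 u₀ with hR
  have hR0 : 0 ≤ R := gevreyNorm_nonneg _ _ _
  have hvG : ∀ (n : ℕ) (t : ℝ), 0 ≤ t → t < n + 1 →
      gevreyNorm α (δ / 4 * t) (v n t) ≤ Real.exp (-(1 - δ) * t) * R := fun n t h0 h1 =>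
    (hv n).gevreyNorm_le hK1 hK hα hδ hδ1 hu₀ hn h0 h1
  have hexp : ∀ t : ℝ, 0 ≤ t → Real.exp (-(1 - δ) * t) * R ≤ R := fun t h0 =>
    mul_le_of_le_one_left hR0 (Real.exp_le_one_iff.2 (by nlinarith))
  have hvR : ∀ (n : ℕ) (t : ℝ), 0 ≤ t → t < n + 1 → gevreyNorm (1 / 2) 0 (v n t) ≤ R :=
    fun n t h0 h1 => (gevrey_anti hα (by positivity) ((hv n).mem_gevrey t _ _)).2.trans
      ((hvG n t h0 h1).trans (hexp t h0))
  have hu₀V := gevrey_anti hα le_rfl hu₀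
  obtain ⟨u, hu⟩ := exists_limit_of_galerkin hu₀V.1 hR0 hu₀V.2 hv hvR
  have hlim : ∀ t, 0 ≤ t → Tendsto (fun n => v n t) atTop (𝓝 (u t)) := fun t ht =>
    (hu t).tendsto_at ⟨ht, le_rfl⟩
  have hG : ∀ t, 0 ≤ t → u t ∈ gevrey α (δ / 4 * t) ∧
      gevreyNorm α (δ / 4 * t) (u t) ≤ Real.exp (-(1 - δ) * t) * R := by
    intro t ht
    refine gevrey_of_tendsto (hlim t ht) (by positivity) ?_
    filter_upwards [eventually_ge_atTop ⌈t⌉₊] with n hnt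
    exact ⟨(hv n).mem_gevrey _ _ _, hvG n t ht (by have := Nat.ceil_le.1 hnt; linarith)⟩
  refine ⟨u, ?_, ?_, hG, fun t ht k => hasDerivAt_fourierCoef_of_galerkin hR0 hv hvR hu (fun s hs => ?_)
    ht k⟩
  -- The initial values are truncations of `u₀`, which converge to `u₀`.
  · refine tendsto_nhds_unique (hlim 0 le_rfl) (tendsto_of_fourierCoef (summable_norm_sq u₀)
      (fun k => ?_) (Eventually.of_forall fun n k => ?_))
    · apply tendsto_const_nhds.congr'
      filter_upwards [eventually_ge_atTop ⌈waveLen k⌉₊] with n hnk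
      rw [(hv n).initial, cutoff_of_le (by have := Nat.ceil_le.1 hnk; linarith), one_smul]
    · rw [(hv n).initial, norm_smul, Real.norm_of_nonneg (cutoff_nonneg _ _)]
      exact mul_le_of_le_one_left (norm_nonneg _) (cutoff_le_one _ _)
  · intro t ht
    have hc : ContinuousOn u (Set.Icc 0 (t + 1)) := by
      refine (hu (t + 1)).continuousOn (Eventually.frequently ?_)
      filter_upwards [eventually_ge_atTop ⌈t + 1⌉₊] with n hnt s hs
      have := Nat.ceil_le.1 hnt
      obtain ⟨g, hg, -⟩ := (hv n).deriv s hs.1 (by linarith [hs.2])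
      exact hg.continuousAt.continuousWithinAt
    refine (hc t ⟨ht, by linarith⟩).mono_of_mem_nhdsWithin ?_
    rw [← Set.Ici_inter_Iic]
    exact inter_mem_nhdsWithin _ (Iic_mem_nhds (by linarith))
  · have h := gevrey_anti hα (by positivity) (hG s hs).1
    exact ⟨h.1, h.2.trans ((hG s hs).2.trans (hexp s hs))⟩

/-! ### Regularity of the limit. -/

lemma summable_sq_exp_waveLen {σ : ℝ} (hσ : 0 < σ) (C : ℝ) :
    Summable fun k : K3 => (C * Real.exp (-σ * waveLen k)) ^ 2 := by
  refine ((summable_exp_waveLen (σ := 2 * σ) (by positivity)).mul_left (C ^ 2)).congr fun k => ?_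
  rw [mul_pow, ← Real.exp_nat_mul]
  push_cast
  ring_nf

/-- Differentiability in `L²` from differentiability of the Fourier coefficients with dominated
derivatives. -/
lemma hasDerivAt_of_fourierCoef {u : ℝ → L2} {G : ℝ → K3 → C3} {M : K3 → ℝ}
    (hM : Summable fun k => M k ^ 2) {s : Set ℝ} (hs : Convex ℝ s) {t : ℝ} (ht : s ∈ 𝓝 t)
    (hd : ∀ r ∈ s, ∀ k, HasDerivAt (fun r => fourierCoef (u r) k) (G r k) r)
    (hG : ∀ r ∈ s, ∀ k, ‖G r k‖ ≤ M k) {g : L2} (hg : ∀ k, fourierCoef g k = G t k) :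
    HasDerivAt u g t := by
  have hts := mem_of_mem_nhds ht
  rw [hasDerivAt_iff_tendsto_slope]
  have e : ∀ r k, fourierCoef (slope u t r) k = slope (fun r => fourierCoef (u r) k) t r := by
    intro r k
    rw [slope_def_module, slope_def_module, fourierCoef_smul, fourierCoef_sub]
  refine tendsto_of_fourierCoef hM (fun k => ?_) ?_
  · simp_rw [e, hg]
    exact hasDerivAt_iff_tendsto_slope.1 (hd t hts k)
  · filter_upwards [mem_nhdsWithin_of_mem_nhds ht, self_mem_nhdsWithin] with r hr hrt k
    -- The mean value inequality bounds each difference quotient by `M k`, the majorant for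
    -- dominated convergence.
    have h := hs.norm_image_sub_le_of_norm_hasDerivWithin_le
      (fun x hx => (hd x hx k).hasDerivWithinAt) (fun x hx => hG x hx k) hts hr
    rw [e, slope_def_module, norm_smul, norm_inv, inv_mul_le_iff₀ (norm_pos_iff.2 (sub_ne_zero.2 hrt)),
      mul_comm]
    exact h

/-- A majorant for the time derivative, uniform on Gevrey balls. Shrinking the radius from `σ` to
`σ/2` reaches the order `1` needed to apply (2) with exponent `1/2`. Shrinking again to `σ/3` passes
from order `1/2` to order `0`, where the norm bounds coefficients by a pure exponential. -/
lemma exists_norm_nsCoef_le {K : ℝ} (hK1 : 1 ≤ K) (hK : IsBilinearConst K) (α : ℝ) {σ : ℝ} (hσ : 0 < σ)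
    {R : ℝ} (hR : 0 ≤ R) : ∃ C, ∀ u ∈ gevrey α σ, gevreyNorm α σ u ≤ R → ∀ k,
      ‖nsCoef u k‖ ≤ C * Real.exp (-(σ / 3) * waveLen k) := by
  obtain ⟨C₁, hC₁, h₁⟩ := exists_gevrey_le α 1 (σ := σ) (σ' := σ / 3) (by linarith)
  obtain ⟨C₂, hC₂, h₂⟩ := exists_gevrey_le α 1 (σ := σ) (σ' := σ / 2) (by linarith)
  obtain ⟨C₃, hC₃, h₃⟩ := exists_gevrey_le (1 / 2) 0 (σ := σ / 2) (σ' := σ / 3) (by linarith)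
  refine ⟨C₁ * R + C₃ * (K ^ (1 / 2 : ℝ) * (C₂ * R) * (C₂ * R)), fun u hu huR k => ?_⟩
  have hu1 := h₁ u hu
  have hu2 := h₂ u hu
  have e : (1 : ℝ) = 1 / 2 + 1 / 2 := by norm_num
  have hK0 : 0 ≤ K ^ (1 / 2 : ℝ) := Real.rpow_nonneg (by linarith) _
  have hB := hK (1 / 2) (σ / 2) le_rfl (by linarith) u (e ▸ hu2.1) u (e ▸ hu2.1)
  rw [← e] at hB
  have hB' := h₃ _ hB.1
  have hu2R : gevreyNorm 1 (σ / 2) u ≤ C₂ * R := hu2.2.trans (by gcongr)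
  have hu10 := (gevrey_anti le_rfl (by linarith : (0 : ℝ) ≤ σ / 3) hu1.1).1
  rw [nsCoef, add_mul]
  refine (norm_sub_le _ _).trans (add_le_add ?_ ?_)
  · have h := gw_mul_norm_fourierCoef_le hu1.1 k
    rw [norm_neg, norm_smul, Real.norm_of_nonneg (sq_nonneg _), neg_mul, Real.exp_neg,
      ← div_eq_mul_inv, le_div_iff₀ (Real.exp_pos _)]
    have e2 : gw 1 (σ / 3) k = waveLen k ^ 2 * Real.exp (σ / 3 * waveLen k) := by
      rw [← gw_one]
      simp [gw]
    rw [e2] at h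
    calc _ = _ := by ring
      _ ≤ _ := h
      _ ≤ _ := hu1.2
      _ ≤ _ := by gcongr
  · rw [← fourierCoef_B hu10 (gevrey_anti (by norm_num) le_rfl hu10).1]
    refine (norm_fourierCoef_le_exp hB'.1 k).trans ?_
    gcongr
    refine hB'.2.trans ?_
    gcongr
    refine hB.2.trans ?_
    have := gevreyNorm_nonneg 1 (σ / 2) u
    gcongr

lemma gevreyNorm_sub_tendsto {ι : Type*} {l : Filter ι} {α σ : ℝ} {f : ι → L2} {g : L2}
    (hf : ∀ᶠ i in l, f i ∈ gevrey α σ) (hg : g ∈ gevrey α σ)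
    (h : Tendsto (fun i => multiplier (gevreySymbol α σ) (f i)) l
      (𝓝 (multiplier (gevreySymbol α σ) g))) :
    Tendsto (fun i => gevreyNorm α σ (f i - g)) l (𝓝 0) := by
  refine (tendsto_iff_norm_sub_tendsto_zero.1 h).congr' ?_
  filter_upwards [hf] with i hi
  rw [gevreyNorm, multiplier_sub hi hg]

lemma tendsto_fourierCoef_multiplier {ι : Type*} {l : Filter ι} {α σ : ℝ} {f : ι → L2} {g : L2}
    (hf : ∀ᶠ i in l, f i ∈ gevrey α σ) (hg : g ∈ gevrey α σ) (h : Tendsto f l (𝓝 g)) (k : K3) :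
    Tendsto (fun i => fourierCoef (multiplier (gevreySymbol α σ) (f i)) k) l
      (𝓝 (fourierCoef (multiplier (gevreySymbol α σ) g) k)) := by
  rw [fourierCoef_gevrey hg]
  refine ((((fourierCLM k).continuous.tendsto g).comp h).const_smul (gw α σ k : ℂ)).congr' ?_
  filter_upwards [hf] with i hi
  rw [fourierCoef_gevrey hi]
  rfl

/-- Convergence in `L²` of a family that is bounded in a Gevrey class is convergence in every
class of smaller radius. -/
lemma gevreyNorm_sub_tendsto_of_bounded {ι : Type*} {l : Filter ι} {α α' σ σ' R : ℝ} (hσ : σ' < σ)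
    {f : ι → L2} {g : L2} (hf : ∀ᶠ i in l, f i ∈ gevrey α σ ∧ gevreyNorm α σ (f i) ≤ R)
    (hg : g ∈ gevrey α σ) (h : Tendsto f l (𝓝 g)) :
    Tendsto (fun i => gevreyNorm α' σ' (f i - g)) l (𝓝 0) := by
  obtain ⟨C, hC, hle⟩ := exists_gevrey_le α α' hσ
  -- Half of the lost radius absorbs the change of exponent; the other half becomes the
  -- square-summable majorant `e^{-τ|k|}`.
  set τ := (σ - σ') / 2 with hτ
  obtain ⟨C', hC', hle'⟩ := exists_gevrey_le α α' (σ := σ) (σ' := σ' + τ) (by linarith)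
  have hf' : ∀ᶠ i in l, f i ∈ gevrey α' σ' := hf.mono fun i hi => (hle _ hi.1).1
  have hg' := (hle g hg).1
  refine gevreyNorm_sub_tendsto hf' hg' (tendsto_of_fourierCoef
    (summable_sq_exp_waveLen (σ := τ) (by linarith) (C' * R))
    (tendsto_fourierCoef_multiplier hf' hg' h) ?_)
  filter_upwards [hf, hf'] with i hi hi' k
  have h1 := hle' _ hi.1
  have h2 := gw_mul_norm_fourierCoef_le h1.1 k
  rw [fourierCoef_gevrey hi', norm_smul, Complex.norm_real, Real.norm_of_nonneg (gw_nonneg _ _ _),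
    neg_mul, Real.exp_neg, ← div_eq_mul_inv, le_div_iff₀ (Real.exp_pos _)]
  calc gw α' σ' k * ‖fourierCoef (f i) k‖ * Real.exp (τ * waveLen k)
      = gw α' (σ' + τ) k * ‖fourierCoef (f i) k‖ := by
        rw [gw, gw, add_mul, Real.exp_add]
        ring
    _ ≤ _ := h2
    _ ≤ _ := h1.2
    _ ≤ _ := by
        gcongr
        exact hi.2

/-- Weak-type continuity together with monotonicity of the norm gives strong continuity. -/
lemma gevreyNorm_sub_tendsto_of_le {ι : Type*} {l : Filter ι} {α σ : ℝ}
    {f : ι → L2} {g : L2} (hf : ∀ᶠ i in l, f i ∈ gevrey α σ ∧ gevreyNorm α σ (f i) ≤ gevreyNorm α σ g)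
    (hg : g ∈ gevrey α σ) (h : Tendsto f l (𝓝 g)) :
    Tendsto (fun i => gevreyNorm α σ (f i - g)) l (𝓝 0) :=
  gevreyNorm_sub_tendsto (hf.mono fun _ hi => hi.1) hg (tendsto_of_fourierCoef_of_norm_le
    (tendsto_fourierCoef_multiplier (hf.mono fun _ hi => hi.1) hg h) (hf.mono fun _ hi => hi.2))

/-- Existence of a global regular solution with the Gevrey bounds. -/
lemma exists_regular_solution {K : ℝ} (hK1 : 1 ≤ K) (hK : IsBilinearConst K) {α δ : ℝ}
    (hα : 1 / 2 ≤ α) (hδ : 0 < δ) (hδ1 : δ < 1) {u₀ : L2} (hu₀ : u₀ ∈ gevrey α 0)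
    (hn : gevreyNorm α 0 u₀ < δ / (2 * K ^ α)) :
    ∃ u : ℝ → L2, IsRegularSolution u₀ ⊤ u ∧
      ∀ t, 0 ≤ t → u t ∈ gevrey α (δ / 4 * t) ∧
        gevreyNorm α (δ / 4 * t) (u t) ≤ Real.exp (-(1 - δ) * t) * gevreyNorm α 0 u₀ := by
  obtain ⟨u, hu0, hcont, hG, hd⟩ := exists_gevrey_curve hK1 hK hα hδ hδ1 hu₀ hn
  set R := gevreyNorm α 0 u₀ with hR
  have hR0 : 0 ≤ R := gevreyNorm_nonneg _ _ _
  have hbound : ∀ t σ, 0 ≤ t → σ ≤ δ / 4 * t → u t ∈ gevrey α σ ∧ gevreyNorm α σ (u t) ≤ R := by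
    intro t σ ht hσ
    have h := gevrey_anti le_rfl hσ (hG t ht).1
    refine ⟨h.1, h.2.trans ((hG t ht).2.trans (mul_le_of_le_one_left hR0 ?_))⟩
    exact Real.exp_le_one_iff.2 (by nlinarith)
  have hdom : ∀ t, 0 < t → u t ∈ gevrey 1 0 := fun t ht => by
    obtain ⟨C, -, h⟩ := exists_gevrey_le α 1 (σ := δ / 4 * t) (σ' := 0) (by positivity)
    exact (h _ (hG t ht.le).1).1
  have hset : {s : ℝ | 0 ≤ s ∧ (s : EReal) < ⊤} = Set.Ici 0 := by
    ext s
    simp [EReal.coe_lt_top]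
  refine ⟨u, ⟨hu0, fun t ht _ => ?_, fun t ht _ => ?_, fun t ht _ => hdom t ht, fun t ht _ => ?_⟩, hG⟩
  · exact (gevrey_anti hα le_rfl (hbound t 0 ht (by positivity)).1).1
  · rw [hset]
    have hlim : Tendsto u (𝓝[Set.Ici 0] t) (𝓝 (u t)) := hcont t ht
    -- At `t = 0` there is no positive radius. Instead `|u s|_{α,0} ≤ |u₀|_{α,0}` upgrades `L²`
    -- convergence to convergence in `D(A^α)`, which controls `V`.
    rcases ht.eq_or_lt with rfl | ht
    · have hle : ∀ᶠ s in 𝓝[Set.Ici 0] (0 : ℝ), u s ∈ gevrey α 0 ∧ gevreyNorm α 0 (u s) ≤ R := by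
        filter_upwards [self_mem_nhdsWithin] with s hs
        exact hbound s 0 hs (mul_nonneg (by positivity) hs)
      rw [hu0] at hlim ⊢
      refine squeeze_zero' (Eventually.of_forall fun _ => gevreyNorm_nonneg _ _ _) ?_
        (gevreyNorm_sub_tendsto_of_le hle hu₀ hlim)
      filter_upwards [hle] with s hs
      exact (gevrey_anti hα le_rfl (gevrey_sub hs.1 hu₀)).2
    -- For times after `t/2` the radius is at least `δt/8`, uniformly near `t`.
    · refine gevreyNorm_sub_tendsto_of_bounded (α := α) (σ := δ / 4 * (t / 2)) (R := R)
        (by positivity) ?_ (hbound t _ ht.le (by gcongr; linarith)).1 hlim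
      filter_upwards [mem_nhdsWithin_of_mem_nhds (Ioi_mem_nhds (half_lt_self ht))] with s hs
      have hs' : t / 2 < s := hs
      exact hbound s _ (by linarith) (by gcongr)
  -- The same uniform radius dominates the derivatives of all modes, which upgrades modewise
  -- differentiability to differentiability in `L²`.
  · obtain ⟨C, hC⟩ := exists_norm_nsCoef_le hK1 hK α (σ := δ / 4 * (t / 2)) (by positivity) hR0
    refine hasDerivAt_of_fourierCoef (G := fun s => nsCoef (u s))
      (summable_sq_exp_waveLen (σ := δ / 4 * (t / 2) / 3) (by positivity) C)
      (convex_Ioi (t / 2)) (Ioi_mem_nhds (half_lt_self ht)) (fun r hr k => hd r ?_ k)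
      (fun r hr => ?_) (fun k => fourierCoef_neg_stokes_sub_B (hdom t ht) k)
    · exact (half_pos ht).trans hr
    · have hr' : t / 2 < r := hr
      have h := hbound r (δ / 4 * (t / 2)) (by linarith) (by gcongr)
      exact hC _ h.1 h.2

/-! ### Uniqueness of regular solutions. -/

/-- Continuity in `V` means that `A^{1/2} u` is continuous into `L²`, hence bounded on a compact
interval. -/
lemma IsRegularSolution.exists_gevreyNorm_le {u₀ : L2} {T : EReal} {u : ℝ → L2}
    (hu : IsRegularSolution u₀ T u) {t : ℝ} (ht : (t : EReal) < T) :
    ∃ R, ∀ s ∈ Set.Icc 0 t, gevreyNorm (1 / 2) 0 (u s) ≤ R := by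
  have hlt : ∀ s ∈ Set.Icc 0 t, (s : EReal) < T := fun s hs =>
    (EReal.coe_le_coe_iff.2 hs.2).trans_lt ht
  have hc : ContinuousOn (fun s => multiplier (gevreySymbol (1 / 2) 0) (u s)) (Set.Icc 0 t) := by
    intro s hs
    refine tendsto_iff_norm_sub_tendsto_zero.2 (((hu.continuous_V s hs.1 (hlt s hs)).mono_left
      (nhdsWithin_mono s fun r hr => ⟨hr.1, hlt r hr⟩)).congr' ?_)
    filter_upwards [self_mem_nhdsWithin] with r hr
    rw [gevreyNorm, multiplier_sub (hu.mem_V r hr.1 (hlt r hr)) (hu.mem_V s hs.1 (hlt s hs))]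
  exact isCompact_Icc.exists_bound_of_continuousOn hc

lemma IsRegularSolution.continuousOn {u₀ : L2} {T : EReal} {u : ℝ → L2}
    (hu : IsRegularSolution u₀ T u) {t : ℝ} (ht : (t : EReal) < T) :
    ContinuousOn u (Set.Icc 0 t) := by
  have hlt : ∀ s ∈ Set.Icc 0 t, (s : EReal) < T := fun s hs =>
    (EReal.coe_le_coe_iff.2 hs.2).trans_lt ht
  intro s hs
  refine tendsto_iff_norm_sub_tendsto_zero.2 (squeeze_zero' (Eventually.of_forall fun _ => norm_nonneg _)
    ?_ ((hu.continuous_V s hs.1 (hlt s hs)).mono_left (nhdsWithin_mono s fun r hr => ⟨hr.1, hlt r hr⟩)))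
  filter_upwards [self_mem_nhdsWithin] with r hr
  exact norm_le_gevreyNorm_V (gevrey_sub (hu.mem_V r hr.1 (hlt r hr)) (hu.mem_V s hs.1 (hlt s hs)))

/-- Uniqueness of regular solutions. -/
lemma IsRegularSolution.eq_of_lt {u₀ : L2} {T T' : EReal} {u v : ℝ → L2}
    (hu : IsRegularSolution u₀ T u) (hv : IsRegularSolution u₀ T' v) {t : ℝ} (h0 : 0 ≤ t)
    (ht : (t : EReal) < T) (ht' : (t : EReal) < T') : u t = v t := by
  obtain ⟨R₁, hR₁⟩ := hu.exists_gevreyNorm_le ht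
  obtain ⟨R₂, hR₂⟩ := hv.exists_gevreyNorm_le ht'
  have hR : 0 ≤ max R₁ R₂ :=
    (gevreyNorm_nonneg _ _ _).trans ((hR₁ 0 ⟨le_rfl, h0⟩).trans (le_max_left _ _))
  obtain ⟨C, -, hC⟩ := exists_inner_difference_le (max R₁ R₂) hR
  have key := norm_sq_le_of_inner_deriv_le (f := fun s => u s - v s)
    (f' := fun s => (-stokes (u s) - B (u s) (u s)) - (-stokes (v s) - B (v s) (v s)))
    (C := C) (ε := 0) h0 ((hu.continuousOn ht).sub (hv.continuousOn ht')) (fun s hs => ?_)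
    (fun s hs => ?_)
  · simp only [hu.initial, hv.initial, sub_self, norm_zero, add_zero] at key
    have h : ‖u t - v t‖ ^ 2 ≤ 0 := by simpa using key
    exact sub_eq_zero.1 (norm_eq_zero.1 (pow_eq_zero_iff two_ne_zero |>.1
      (le_antisymm h (sq_nonneg _))))
  all_goals
    have hs1 : (s : EReal) < T := (EReal.coe_lt_coe_iff.2 hs.2).trans ht
    have hs2 : (s : EReal) < T' := (EReal.coe_lt_coe_iff.2 hs.2).trans ht'
    have hs3 : s ∈ Set.Icc 0 t := ⟨hs.1.le, hs.2.le⟩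
  · exact (hu.equation s hs.1 hs1).sub (hv.equation s hs.1 hs2)
  -- The energy estimate without truncation: `χ = 1`, `η = 0`, `ε = 0`. Gronwall with equal initial
  -- data then forces equality.
  · refine hC _ (hu.mem_V s hs.1.le hs1) _ (hv.mem_V s hs.1.le hs2)
      ((hR₁ s hs3).trans (le_max_left _ _)) ((hR₂ s hs3).trans (le_max_right _ _)) _
      (fun _ => 1) (fun _ => 0) 0 le_rfl (fun k => by simp) (fun k => by simp) (fun k => ?_)
    rw [fourierCoef_sub, fourierCoef_neg_stokes_sub_B (hu.mem_domain s hs.1 hs1),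
      fourierCoef_neg_stokes_sub_B (hv.mem_domain s hs.1 hs2), nsCoef, nsCoef, fourierCoef_sub]
    module

end NSE

end

theorem lemma2p2 :
    (∃ K : ℝ, 1 ≤ K ∧ NSE.IsBilinearConst K) ∧
    ∀ K : ℝ, 1 ≤ K → NSE.IsBilinearConst K →
      ∀ α δ : ℝ, 1 / 2 ≤ α → 0 < δ → δ < 1 →
      ∀ u₀ ∈ NSE.gevrey α 0, NSE.gevreyNorm α 0 u₀ < δ / (2 * K ^ α) →
      ∃ u : ℝ → NSE.L2,
        NSE.IsRegularSolution u₀ ⊤ u ∧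
        (∀ (T : EReal) (v : ℝ → NSE.L2), 0 < T → NSE.IsRegularSolution u₀ T v →
          ∀ t : ℝ, 0 ≤ t → (t : EReal) < T → v t = u t) ∧
        (∀ β t : ℝ, 0 < β → 0 < t → u t ∈ NSE.gevrey β 0) ∧
        (∀ σ : ℝ, 0 < σ → ∀ t : ℝ, 4 * σ / δ ≤ t →
          u t ∈ NSE.gevrey α σ ∧
          NSE.gevreyNorm α σ (u t) ≤
            Real.exp (-(1 - δ) * t) * NSE.gevreyNorm α 0 u₀) := by
  refine ⟨NSE.exists_isBilinearConst, fun K hK1 hK α δ hα hδ hδ1 u₀ hu₀ hn => ?_⟩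
  obtain ⟨u, hu, hG⟩ := NSE.exists_regular_solution hK1 hK hα hδ hδ1 hu₀ hn
  refine ⟨u, hu, fun T v _ hv t h0 hT => hv.eq_of_lt hu h0 hT (EReal.coe_lt_top t), fun β t _ ht => ?_,
    fun σ hσ t ht => ?_⟩
  -- For `t > 0` the whole radius `δt/4` is given up in exchange for arbitrarily many derivatives.
  · obtain ⟨C, -, h⟩ := NSE.exists_gevrey_le α β (σ := δ / 4 * t) (σ' := 0) (by positivity)
    exact (h _ (hG t ht.le).1).1
  · rw [div_le_iff₀ hδ] at ht
    have h0 : 0 ≤ t := by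
      by_contra! h
      nlinarith
    have h := NSE.gevrey_anti le_rfl (by linarith : σ ≤ δ / 4 * t) (hG t h0).1
    exact ⟨h.1, h.2.trans (hG t h0).2⟩
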